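/- Let $R>0$, $\tau\ge 0$, $\gamma<0$, let $\mathcal B=\{x\in\mathbb R^2:|x|<R\}$ and $\mathcal B^{\rm ext}=\mathbb R^2\setminus\overline{\mathcal B}$. Let $\mathsf H$ be the self-adjoint operator in $L^2(\mathcal B^{\rm ext})$ (complex-valued functions) associated, via the first representation theorem, with the quadratic form $$\mathfrak h[u]=\int_{\mathcal B^{\rm ext}}\big(|\nabla\partial_1u|^2+|\nabla\partial_2u|^2+\tau|\nabla u|^2\big)\,dx+\gamma\int_{\partial\mathcal B}|u|^2\,d\sigma,\qquad \mathrm{dom}\,\mathfrak h=H^2(\mathcal B^{\rm ext}).$$ For $n\in\mathbb Z$ let the fiber operator $\mathsf H_n$ be the self-adjoint operator in $L^2((R,\infty);r\,dr)$ associated with the form $$\mathfrak h_n[f]=\mathfrak h\Big[\tfrac{f(r)e^{in\theta}}{\sqrt{2\pi}}\Big],\qquad \mathrm{dom}\,\mathfrak h_n=\{f\in L^2((R,\infty);r\,dr): f(r)e^{in\theta}\in H^2(\mathcal B^{\rm ext})\},$$ where $(r,\theta)$ are polar coordinates; $\mathsf H$ is the orthogonal sum of the operators $\mathsf H_n$,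 $n\in\mathbb Z$, with respect to the decomposition of $L^2(\mathcal B^{\rm ext})$ into Fourier modes. Then $\mathsf H$ has a lowest eigenvalue $\lambda_1$, it is negative, and the following hold. (i) For every $n\notin\{-1,0,1\}$, $\lambda_1$ is not an eigenvalue of $\mathsf H_n$. Thus $\lambda_1$ is an eigenvalue of $\mathsf H_n$ for some $n\in\{-1,0,1\}$, and every eigenfunction of $\mathsf H$ for $\lambda_1$ is of the form $f_{-1}(r)e^{-i\theta}+f_0(r)+f_1(r)e^{i\theta}$ with $f_{-1},f_0,f_1\in L^2((R,\infty);r\,dr)$. (ii) If $\tau\ge 1/R^2$, then $\lambda_1$ is an eigenvalue of $\mathsf H_n$ if and only if $n=0$; thus every eigenfunction of $\mathsf H$ for $\lambda_1$ is radial. -/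

import Mathlib

open MeasureTheory Set
open scoped ENNReal ContDiff InnerProductSpace

noncomputable section

namespace RobinBilaplacian

/-! ### The operator associated with a quadratic form -/

section Operators

variable {E : Type*} [NormedAddCommGroup E] [InnerProductSpace ℂ E]

/-- The relation of the first representation theorem: `u ∈ dom A` and `A u = w` if and only if
`u ∈ dom h` and `h[u, v] = (w, v)` for all `v ∈ dom h`. (Forms are linear in the first and
conjugate-linear in the second argument; Mathlib's inner product is conjugate-linear in the
first one, so `(w, v)` is `⟪v, w⟫_ℂ`.) -/
def IsAssociated (A : E →ₗ.[ℂ] E) (D : Set E) (h : E → E → ℂ) : Prop :=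
  ∀ u w : E, (u, w) ∈ A.graph ↔ u ∈ D ∧ ∀ v ∈ D, h u v = ⟪v, w⟫_ℂ

open Classical in
/-- The operator associated with the form `h` with domain `D`. It is unique, since an operator is
determined by its graph; it exists whenever `h` is a sesquilinear form on a dense subspace `D`, and
for a closed semi-bounded symmetric `h` it is the self-adjoint operator of the first
representation theorem. (If there were none, the value would be the operator with domain `0`,
which has no eigenvalues.) -/
def formOperator (D : Set E) (h : E → E → ℂ) : E →ₗ.[ℂ] E :=
  if H : ∃ A : E →ₗ.[ℂ] E, IsAssociated A D h then H.choose else ⊥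

/-- `u` is an eigenvector of the (unbounded) operator `A` for the eigenvalue `μ`. -/
def IsEigenvector (A : E →ₗ.[ℂ] E) (μ : ℂ) (u : E) : Prop :=
  u ≠ 0 ∧ ∃ hu : u ∈ A.domain, A ⟨u, hu⟩ = μ • u

/-- `μ` is an eigenvalue of the (unbounded) operator `A`. -/
def IsEigenvalue (A : E →ₗ.[ℂ] E) (μ : ℂ) : Prop :=
  ∃ u : E, IsEigenvector A μ u

end Operators

/-! ### The exterior of a disk and its Sobolev space -/

/-- The exterior `ℝ² ∖ closure B` of the disk `B` of radius `R` centred at the origin. The plane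
`ℝ²` is modelled by `ℂ` with its Euclidean norm and Lebesgue measure, `x₁ = re z`, `x₂ = im z`. -/
def diskExt (R : ℝ) : Set ℂ := {z | R < ‖z‖}

/-- The Hilbert space of complex-valued square-integrable functions on the exterior of the disk. -/
abbrev L2Ext (R : ℝ) : Type := Lp ℂ 2 ((volume : Measure ℂ).restrict (diskExt R))

/-- The unit vector in the `j`-th coordinate direction of the plane. -/
def dir : Fin 2 → ℂ := ![1, Complex.I]

/-- The `j`-th coordinate of a point of the plane. -/
def coord (z : ℂ) : Fin 2 → ℝ := ![z.re, z.im]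

/-- `g` is the weak partial derivative `∂ⱼ u` of `u` in the exterior of the disk. -/
def HasWeakDeriv {R : ℝ} (j : Fin 2) (u g : L2Ext R) : Prop :=
  ∀ φ : ℂ → ℝ, ContDiff ℝ ∞ φ → HasCompactSupport φ → tsupport φ ⊆ diskExt R →
    ∫ z in diskExt R, (fderiv ℝ φ z (dir j)) • u z = -∫ z in diskExt R, φ z • g z

open Classical in
/-- The weak partial derivative `∂ⱼ u`, if it exists in `L²` (and `0` otherwise). -/
def weakDeriv {R : ℝ} (j : Fin 2) (u : L2Ext R) : L2Ext R :=
  if h : ∃ g, HasWeakDeriv j u g then h.choose else 0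

/-- The Sobolev space `H²`: functions in `L²` all of whose weak partial derivatives of first and
second order exist and are in `L²`. -/
def H2 (R : ℝ) : Set (L2Ext R) :=
  {u | ∀ j, (∃ g, HasWeakDeriv j u g) ∧ ∀ k, ∃ g, HasWeakDeriv k (weakDeriv j u) g}

/-- The arc-length measure `dσ = R dθ` on the circle of radius `R` centred at the origin. -/
def arcMeasure (R : ℝ) : Measure ℂ :=
  ENNReal.ofReal R •
    ((volume : Measure ℝ).restrict (Ioc 0 (2 * Real.pi))).map (circleMap 0 R)

/-- The Hilbert space `L²(∂B; dσ)`. -/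
abbrev L2Circle (R : ℝ) : Type := Lp ℂ 2 (arcMeasure R)

/-- `t` is the boundary trace of `u`, characterised by the Gauss-Green formula
`∫ (φ ∂ⱼu + u ∂ⱼφ) dx = ∫ φ t νⱼ dσ` for all `φ` smooth and compactly supported in the whole plane,
where `ν = -z / R` is the unit normal on the circle pointing out of the exterior domain. -/
def HasTrace {R : ℝ} (u : L2Ext R) (t : L2Circle R) : Prop :=
  ∀ φ : ℂ → ℝ, ContDiff ℝ ∞ φ → HasCompactSupport φ → ∀ j : Fin 2,
    ∫ z in diskExt R, (φ z • weakDeriv j u z + (fderiv ℝ φ z (dir j)) • u z)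
      = ∫ z, (φ z * -(coord z j / R)) • t z ∂(arcMeasure R)

open Classical in
/-- The boundary trace `u|_{∂B}` (it exists for every `u` in `H²`; the value is `0` otherwise). -/
def trace {R : ℝ} (u : L2Ext R) : L2Circle R :=
  if h : ∃ t, HasTrace u t then h.choose else 0

/-! ### The perturbed Robin bi-Laplacian -/

/-- The sesquilinear form
`∫ (∇∂₁u · conj ∇∂₁v + ∇∂₂u · conj ∇∂₂v + τ ∇u · conj ∇v) dx + γ ∫_{∂B} u conj v dσ`. -/
def form {R : ℝ} (τ γ : ℝ) (u v : L2Ext R) : ℂ :=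
  (∑ j, ∑ k, ⟪weakDeriv k (weakDeriv j v), weakDeriv k (weakDeriv j u)⟫_ℂ)
    + τ * (∑ j, ⟪weakDeriv j v, weakDeriv j u⟫_ℂ)
    + γ * ⟪trace v, trace u⟫_ℂ

/-- The perturbed Robin bi-Laplacian in the exterior of the disk: the operator associated with
the form `form τ γ` with domain `H²`. -/
def robinOp (R τ γ : ℝ) : L2Ext R →ₗ.[ℂ] L2Ext R :=
  formOperator (H2 R) (form τ γ)

/-! ### The fiber operators -/

/-- The measure `r dr` on `(R, ∞)`. -/
def radialMeasure (R : ℝ) : Measure ℝ :=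
  ((volume : Measure ℝ).restrict (Ioi R)).withDensity fun r => ENNReal.ofReal r

/-- The Hilbert space `L²((R, ∞); r dr)`. -/
abbrev L2Rad (R : ℝ) : Type := Lp ℂ 2 (radialMeasure R)

/-- The function `f(r) e^{inθ} / √(2π)` in polar coordinates `z = r e^{iθ}`. -/
def modeFun (n : ℤ) (f : ℝ → ℂ) (z : ℂ) : ℂ :=
  f ‖z‖ * (z / ‖z‖) ^ n / (Real.sqrt (2 * Real.pi) : ℂ)

theorem map_norm_volume (R : ℝ) :
    ((volume : Measure ℂ).restrict (diskExt R)).map (fun z => ‖z‖)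
      = ENNReal.ofReal (2 * Real.pi) • radialMeasure R := by
  have hm : Measurable (fun z : ℂ => ‖z‖) := measurable_norm
  have hext : MeasurableSet (diskExt R) := measurableSet_lt measurable_const measurable_norm
  ext s hs
  rw [Measure.map_apply hm hs, Measure.restrict_apply (hm hs), Measure.smul_apply, radialMeasure,
    withDensity_apply _ hs, Measure.restrict_restrict hs, smul_eq_mul,
    ← lintegral_indicator_one ((hm hs).inter hext), ← Complex.lintegral_comp_polarCoord_symm]
  have key : ∀ p ∈ polarCoord.target,
      ENNReal.ofReal p.1 • ((fun z : ℂ => ‖z‖) ⁻¹' s ∩ diskExt R).indicator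
        (1 : ℂ → ℝ≥0∞) (Complex.polarCoord.symm p)
      = (s ∩ Ioi R).indicator (fun r => ENNReal.ofReal r) p.1 * (1 : ℝ → ℝ≥0∞) p.2 := by
    rintro ⟨r, t⟩ hp
    have hr : 0 < r := hp.1
    have hn : ‖Complex.polarCoord.symm (r, t)‖ = r := by
      rw [Complex.norm_polarCoord_symm, abs_of_pos hr]
    by_cases hrs : r ∈ s ∩ Ioi R
    · rw [indicator_of_mem hrs, indicator_of_mem]
      · simp
      · refine ⟨?_, ?_⟩
        · change ‖Complex.polarCoord.symm (r, t)‖ ∈ s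
          rw [hn]; exact hrs.1
        · change R < ‖Complex.polarCoord.symm (r, t)‖
          rw [hn]; exact hrs.2
    · rw [indicator_of_notMem hrs, indicator_of_notMem]
      · simp
      · rintro ⟨h1, h2⟩
        change ‖Complex.polarCoord.symm (r, t)‖ ∈ s at h1
        change R < ‖Complex.polarCoord.symm (r, t)‖ at h2
        rw [hn] at h1 h2
        exact hrs ⟨h1, h2⟩
  rw [setLIntegral_congr_fun polarCoord.open_target.measurableSet key]
  change ∫⁻ p in Ioi (0 : ℝ) ×ˢ Ioo (-Real.pi) Real.pi, _ = _
  rw [Measure.volume_eq_prod, ← Measure.prod_restrict, lintegral_prod_mul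
    ((ENNReal.measurable_ofReal.indicator (hs.inter measurableSet_Ioi)).aemeasurable)
    measurable_one.aemeasurable]
  have h2 : ∫⁻ t in Ioo (-Real.pi) Real.pi, (1 : ℝ → ℝ≥0∞) t = ENNReal.ofReal (2 * Real.pi) := by
    simp [two_mul]
  have h1 : ∫⁻ r in Ioi (0 : ℝ), (s ∩ Ioi R).indicator (fun r => ENNReal.ofReal r) r
      = ∫⁻ r in s ∩ Ioi R, ENNReal.ofReal r := by
    rw [← lintegral_indicator (hs.inter measurableSet_Ioi), setLIntegral_eq_of_support_subset]
    intro r hr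
    by_contra h
    apply hr
    have : ENNReal.ofReal r = 0 := ENNReal.ofReal_of_nonpos (not_lt.mp h)
    simp [indicator, this]
  rw [h1, h2, mul_comm]

theorem memLp_modeFun {R : ℝ} (n : ℤ) (f : L2Rad R) :
    MemLp (modeFun n f) 2 ((volume : Measure ℂ).restrict (diskExt R)) := by
  have h0 : MemLp f 2 (((volume : Measure ℂ).restrict (diskExt R)).map (fun z => ‖z‖)) := by
    rw [map_norm_volume]
    exact (Lp.memLp f).smul_measure ENNReal.ofReal_ne_top
  have h1 : MemLp (fun z : ℂ => f ‖z‖) 2 ((volume : Measure ℂ).restrict (diskExt R)) :=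
    h0.comp_of_map measurable_norm.aemeasurable
  have hmeas : Measurable fun z : ℂ => (z / (‖z‖ : ℂ)) ^ n := by fun_prop
  have h2 : MemLp (fun z : ℂ => f ‖z‖ * (z / (‖z‖ : ℂ)) ^ n) 2
      ((volume : Measure ℂ).restrict (diskExt R)) := by
    refine h1.of_le (h1.aestronglyMeasurable.mul hmeas.aestronglyMeasurable) ?_
    filter_upwards with z
    rw [norm_mul, norm_zpow]
    refine mul_le_of_le_one_right (norm_nonneg _) ?_
    by_cases hz : z = 0
    · subst hz
      by_cases hn : n = 0
      · simp [hn]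
      · simp [zero_zpow n hn]
    · simp [hz]
  have h3 := h2.mul_const ((Real.sqrt (2 * Real.pi) : ℂ)⁻¹)
  exact h3

/-- The inverse of the unitary map from the range of the projection onto the `n`-th Fourier mode
to `L²((R, ∞); r dr)`: it sends `f` to `f(r) e^{inθ} / √(2π)`. -/
def mode {R : ℝ} (n : ℤ) (f : L2Rad R) : L2Ext R :=
  (memLp_modeFun n f).toLp _

/-- The domain of the `n`-th fiber form: those `f` with `f(r) e^{inθ} ∈ H²`. -/
def fiberDom (R : ℝ) (n : ℤ) : Set (L2Rad R) := {f | mode n f ∈ H2 R}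

/-- The `n`-th fiber form `h[f(r) e^{inθ} / √(2π), g(r) e^{inθ} / √(2π)]`. -/
def fiberForm {R : ℝ} (τ γ : ℝ) (n : ℤ) (f g : L2Rad R) : ℂ :=
  form τ γ (mode n f) (mode n g)

/-- The `n`-th fiber operator, acting in `L²((R, ∞); r dr)`. -/
def fiberOp (R τ γ : ℝ) (n : ℤ) : L2Rad R →ₗ.[ℂ] L2Rad R :=
  formOperator (fiberDom R n) (fiberForm τ γ n)

end RobinBilaplacian

end

noncomputable section

namespace RobinBilaplacian

/-! ### Polar coordinates and Fourier modes -/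

/-! Separation of variables reduces everything to quadratic forms on the half-line. The combinations
∂₁ ± i∂₂ send the Fourier mode n to the mode n ± 1, by f ↦ f' ∓ n f/r, and they commute with the
mode projections up to this shift (`wirt_proj`). Since the form is a sum of squares of first and
second derivatives of this kind plus the boundary term, it is diagonal in the Fourier modes. For the
n-th fiber the result is (`norm_fiberGrad_sq`, `fiberForm_eq`) ‖f''‖² + 2n²‖f'/r - f/r²‖² + ‖f'/r -
n²f/r²‖² + τ(‖f'‖² + n²‖f/r‖²) + γR|f(R)|², with norms in L²(r dr) and a domain that does not depend
on n (`mem_fiberDom_iff`).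

Hence the fibers can be compared function by function, and the boundary term cancels. With x = f'/r
and y = f/r², the difference between the fibers n and 0 is n²(2‖x‖² - 6 Re⟨x, y⟩ + (n² + 2)‖y‖²) +
τn²‖f/r‖². For |n| ≥ 2 the quadratic form in x, y is positive definite (`norm_fiberGrad_lt`). For n
= ±1 it is indefinite, but an integration by parts evaluates Re⟨x, y⟩, and the remaining loss
‖f/r²‖² is less than R⁻²‖f/r‖², which the τ term covers when τ ≥ 1/R² (`norm_fiberGrad_one_lt`).
These inequalities are strict for f ≠ 0, so the excluded fibers lie strictly above the lower bound
of fiber 0.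

It remains to see that the lowest of the bounds for n = 0, ±1 is negative and attained. A
logarithmic cutoff has boundary value 1 and arbitrarily small energy, since dimension two is
critical for the gradient term (`exists_fiberGrad_lt_boundary`). Each fiber form is a closed
non-negative form perturbed by a negative rank-one form; the Riesz representer of the boundary
functional, taken at the optimal shift, is then an eigenfunction (`exists_ground_state`). No
compactness or spectral theorem enters. -/

/-- Lebesgue measure on a fundamental interval for the angle. -/
def angMeasure : Measure ℝ := volume.restrict (Ioc (-Real.pi) Real.pi)

instance : IsFiniteMeasure angMeasure := by unfold angMeasure; infer_instance

instance (R : ℝ) : SigmaFinite (radialMeasure R) := by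
  unfold radialMeasure; exact SigmaFinite.withDensity_ofReal _

/-- The parametrisation of the plane by polar coordinates. -/
def polarMap (p : ℝ × ℝ) : ℂ := circleMap 0 p.1 p.2

theorem polarMap_apply (r t : ℝ) : polarMap (r, t) = r * Complex.exp (t * Complex.I) := by
  simp [polarMap, circleMap]

theorem continuous_polarMap : Continuous polarMap := by
  unfold polarMap circleMap; fun_prop

theorem norm_polarMap {r : ℝ} (hr : 0 ≤ r) (t : ℝ) : ‖polarMap (r, t)‖ = r := by
  simp [polarMap_apply, Complex.norm_exp_ofReal_mul_I, abs_of_nonneg hr]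

theorem measurableSet_diskExt (R : ℝ) : MeasurableSet (diskExt R) :=
  measurableSet_lt measurable_const measurable_norm

theorem isOpen_diskExt (R : ℝ) : IsOpen (diskExt R) := isOpen_lt continuous_const continuous_norm

/-- The chart `polarCoord` uses the open angular interval and `angMeasure` the half-open one; the
missing endpoint is a null set. -/
theorem radialMeasure_prod_angMeasure (R : ℝ) :
    (radialMeasure R).prod angMeasure
      = ((volume : Measure (ℝ × ℝ)).restrict (Ioi R ×ˢ Ioo (-Real.pi) Real.pi)).withDensity
          fun p => ENNReal.ofReal p.1 := by
  unfold radialMeasure angMeasure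
  rw [prod_withDensity_left ENNReal.measurable_ofReal, Measure.prod_restrict,
    ← Measure.volume_eq_prod]
  congr 1
  rw [Measure.volume_eq_prod, ← Measure.prod_restrict, ← Measure.prod_restrict,
    restrict_Ioo_eq_restrict_Ioc]

theorem map_polarMap {R : ℝ} (hR : 0 < R) :
    ((radialMeasure R).prod angMeasure).map polarMap
      = (volume : Measure ℂ).restrict (diskExt R) := by
  have hm : Measurable polarMap := continuous_polarMap.measurable
  ext s hs
  rw [Measure.map_apply hm hs, radialMeasure_prod_angMeasure, withDensity_apply _ (hm hs),
    Measure.restrict_restrict (hm hs), Measure.restrict_apply hs,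
    ← lintegral_indicator_one (hs.inter (measurableSet_diskExt R)),
    ← Complex.lintegral_comp_polarCoord_symm]
  change _ = ∫⁻ p in Ioi (0 : ℝ) ×ˢ Ioo (-Real.pi) Real.pi, _
  have hM : MeasurableSet (polarMap ⁻¹' s ∩ Ioi R ×ˢ Ioo (-Real.pi) Real.pi) :=
    (hm hs).inter (measurableSet_Ioi.prod measurableSet_Ioo)
  rw [← lintegral_indicator hM, ← lintegral_indicator (measurableSet_Ioi.prod measurableSet_Ioo)]
  congr 1
  ext ⟨r, t⟩
  have hpol : Complex.polarCoord.symm (r, t) = polarMap (r, t) := by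
    rw [polarMap_apply, Complex.polarCoord_symm_apply, Complex.exp_mul_I]; simp
  by_cases h : (r, t) ∈ polarMap ⁻¹' s ∩ Ioi R ×ˢ Ioo (-Real.pi) Real.pi
  · have hr : 0 < r := hR.trans h.2.1
    have h0 : (r, t) ∈ Ioi (0 : ℝ) ×ˢ Ioo (-Real.pi) Real.pi := ⟨hr, h.2.2⟩
    rw [indicator_of_mem h, indicator_of_mem h0, hpol, indicator_of_mem]
    · simp
    · refine ⟨h.1, ?_⟩
      change R < _
      rw [norm_polarMap hr.le]; exact h.2.1
  · rw [indicator_of_notMem h]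
    by_cases h0 : (r, t) ∈ Ioi (0 : ℝ) ×ˢ Ioo (-Real.pi) Real.pi
    · rw [indicator_of_mem h0, hpol, indicator_of_notMem]
      · simp
      · rintro ⟨h1, h2⟩
        change R < _ at h2
        rw [norm_polarMap (le_of_lt h0.1)] at h2
        exact h ⟨h1, h2, h0.2⟩
    · rw [indicator_of_notMem h0]

theorem measurePreserving_polarMap {R : ℝ} (hR : 0 < R) :
    MeasurePreserving polarMap ((radialMeasure R).prod angMeasure)
      ((volume : Measure ℂ).restrict (diskExt R)) :=
  ⟨continuous_polarMap.measurable, map_polarMap hR⟩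

theorem ae_radialMeasure_gt (R : ℝ) : ∀ᵐ r ∂radialMeasure R, R < r :=
  (withDensity_absolutelyContinuous _ _).ae_le (ae_restrict_mem measurableSet_Ioi)

theorem ae_prod_gt (R : ℝ) : ∀ᵐ p ∂(radialMeasure R).prod angMeasure, R < p.1 :=
  (Measure.quasiMeasurePreserving_fst).ae (ae_radialMeasure_gt R)

theorem integral_diskExt {R : ℝ} (hR : 0 < R) {F : ℂ → ℂ}
    (hF : AEStronglyMeasurable F ((volume : Measure ℂ).restrict (diskExt R))) :
    ∫ z in diskExt R, F z = ∫ p, F (polarMap p) ∂(radialMeasure R).prod angMeasure := by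
  rw [← map_polarMap hR] at hF ⊢
  exact integral_map continuous_polarMap.aemeasurable hF

theorem integral_exp_angMeasure (k : ℤ) :
    ∫ t, Complex.exp (k * (t * Complex.I)) ∂angMeasure
      = if k = 0 then ((2 * Real.pi : ℝ) : ℂ) else 0 := by
  unfold angMeasure
  rw [← intervalIntegral.integral_of_le (by linarith [Real.pi_pos])]
  split_ifs with h
  · subst h; simp; ring
  · have hc : (k * Complex.I : ℂ) ≠ 0 := by simp [h]
    have := integral_exp_mul_complex (a := -Real.pi) (b := Real.pi) hc
    simp_rw [show ∀ t : ℝ, (k : ℂ) * (t * Complex.I) = k * Complex.I * t from fun t => by ring]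
    rw [this, div_eq_zero_iff]
    left
    rw [sub_eq_zero, Complex.exp_eq_exp_iff_exists_int]
    exact ⟨k, by push_cast; ring⟩

theorem modeFun_polarMap {r : ℝ} (hr : 0 < r) (t : ℝ) (n : ℤ) (f : ℝ → ℂ) :
    modeFun n f (polarMap (r, t))
      = f r * Complex.exp (n * (t * Complex.I)) / (Real.sqrt (2 * Real.pi) : ℂ) := by
  unfold modeFun
  rw [norm_polarMap hr.le, polarMap_apply, mul_div_cancel_left₀ _ (by exact_mod_cast hr.ne'),
    ← Complex.exp_int_mul]

theorem mode_coe {R : ℝ} (n : ℤ) (f : L2Rad R) :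
    mode n f =ᵐ[(volume : Measure ℂ).restrict (diskExt R)] modeFun n f :=
  (memLp_modeFun n f).coeFn_toLp

/-- Null sets of radii have null preimages in the plane, so a radial function may be replaced by any
almost-everywhere representative inside `modeFun`. -/
theorem quasiMeasurePreserving_norm (R : ℝ) : Measure.QuasiMeasurePreserving (fun z : ℂ => ‖z‖)
    ((volume : Measure ℂ).restrict (diskExt R)) (radialMeasure R) := by
  refine ⟨measurable_norm, ?_⟩
  rw [map_norm_volume]
  exact Measure.smul_absolutelyContinuous

theorem mode_coe_of_ae {R : ℝ} (n : ℤ) (f : L2Rad R) {F : ℝ → ℂ} (h : f =ᵐ[radialMeasure R] F) :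
    mode n f =ᵐ[(volume : Measure ℂ).restrict (diskExt R)] modeFun n F := by
  filter_upwards [mode_coe n f, (quasiMeasurePreserving_norm R).ae h] with z h1 h2
  rw [h1]; unfold modeFun; rw [h2]

theorem mode_polarMap {R : ℝ} (hR : 0 < R) (n : ℤ) (f : L2Rad R) :
    (fun p => mode n f (polarMap p)) =ᵐ[(radialMeasure R).prod angMeasure] fun p =>
      f p.1 * Complex.exp (n * (p.2 * Complex.I)) / (Real.sqrt (2 * Real.pi) : ℂ) := by
  filter_upwards [(measurePreserving_polarMap hR).quasiMeasurePreserving.ae (mode_coe n f),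
    ae_prod_gt R] with p h1 h2
  rw [h1]
  exact modeFun_polarMap (hR.trans h2) _ _ _

theorem sqrt_two_pi_mul_self :
    ((Real.sqrt (2 * Real.pi) : ℝ) : ℂ) * (Real.sqrt (2 * Real.pi) : ℝ) = (2 * Real.pi : ℝ) := by
  rw [← Complex.ofReal_mul, Real.mul_self_sqrt (by positivity)]

theorem inner_mode_mode {R : ℝ} (hR : 0 < R) (m n : ℤ) (f g : L2Rad R) :
    ⟪mode m f, mode n g⟫_ℂ = if m = n then ⟪f, g⟫_ℂ else 0 := by
  rw [L2.inner_def, integral_diskExt hR (L2.integrable_inner (𝕜 := ℂ) _ _).aestronglyMeasurable]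
  have h1 : (fun p => ⟪mode m f (polarMap p), mode n g (polarMap p)⟫_ℂ)
      =ᵐ[(radialMeasure R).prod angMeasure] fun p =>
        ⟪f p.1, g p.1⟫_ℂ * (Complex.exp ((n - m : ℤ) * (p.2 * Complex.I))
          / (2 * Real.pi : ℝ)) := by
    filter_upwards [mode_polarMap hR m f, mode_polarMap hR n g] with p h1 h2
    rw [h1, h2, RCLike.inner_apply, RCLike.inner_apply, map_div₀, map_mul, ← Complex.exp_conj]
    simp only [map_mul, Complex.conj_ofReal, Complex.conj_I, map_intCast]
    rw [show (((n - m : ℤ) : ℂ) * (p.2 * Complex.I))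
      = n * (p.2 * Complex.I) + m * (p.2 * -Complex.I) by push_cast; ring, Complex.exp_add,
      ← sqrt_two_pi_mul_self]
    field_simp
  rw [integral_congr_ae h1, integral_prod_mul (fun r => ⟪f r, g r⟫_ℂ)
    (fun t : ℝ => Complex.exp ((n - m : ℤ) * (t * Complex.I)) / (2 * Real.pi : ℝ)),
    ← L2.inner_def, integral_div, integral_exp_angMeasure]
  have hpi : ((2 * Real.pi : ℝ) : ℂ) ≠ 0 := by exact_mod_cast (by positivity)
  by_cases h : m = n
  · simp [h, Real.pi_ne_zero]
  · rw [if_neg h, if_neg (by omega)]; simp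

theorem mode_add {R : ℝ} (n : ℤ) (f g : L2Rad R) : mode n (f + g) = mode n f + mode n g := by
  apply Lp.ext
  filter_upwards [mode_coe n f, mode_coe n g, mode_coe_of_ae n _ (Lp.coeFn_add f g),
    Lp.coeFn_add (mode n f) (mode n g)] with z h1 h2 h3 h4
  rw [h3, h4, Pi.add_apply, h1, h2]
  simp only [modeFun, Pi.add_apply]; ring

theorem mode_smul {R : ℝ} (n : ℤ) (c : ℂ) (f : L2Rad R) : mode n (c • f) = c • mode n f := by
  apply Lp.ext
  filter_upwards [mode_coe n f, mode_coe_of_ae n _ (Lp.coeFn_smul c f),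
    Lp.coeFn_smul c (mode n f)] with z h1 h3 h4
  rw [h3, h4, Pi.smul_apply, h1]
  simp only [modeFun, Pi.smul_apply, smul_eq_mul]; ring

/-- The map `f ↦ f(r) e^{inθ} / √(2π)` as a linear isometry. -/
def modeL {R : ℝ} (hR : 0 < R) (n : ℤ) : L2Rad R →ₗᵢ[ℂ] L2Ext R where
  toFun := mode n
  map_add' := mode_add n
  map_smul' := mode_smul n
  norm_map' f := by
    change ‖mode n f‖ = ‖f‖
    rw [@norm_eq_sqrt_re_inner ℂ, @norm_eq_sqrt_re_inner ℂ _ _ _ _ f, inner_mode_mode hR]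
    simp

@[simp] theorem modeL_apply {R : ℝ} (hR : 0 < R) (n : ℤ) (f : L2Rad R) :
    modeL hR n f = mode n f := rfl

/-- The `n`-th Fourier coefficient of a function on the exterior of the disk. -/
def coef {R : ℝ} (hR : 0 < R) (n : ℤ) : L2Ext R →L[ℂ] L2Rad R :=
  ContinuousLinearMap.adjoint (modeL hR n).toContinuousLinearMap

theorem inner_coef_right {R : ℝ} (hR : 0 < R) (n : ℤ) (f : L2Rad R) (u : L2Ext R) :
    ⟪f, coef hR n u⟫_ℂ = ⟪mode n f, u⟫_ℂ :=
  ContinuousLinearMap.adjoint_inner_right _ _ _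

theorem inner_coef_left {R : ℝ} (hR : 0 < R) (n : ℤ) (f : L2Rad R) (u : L2Ext R) :
    ⟪coef hR n u, f⟫_ℂ = ⟪u, mode n f⟫_ℂ :=
  ContinuousLinearMap.adjoint_inner_left _ _ _

theorem coef_mode {R : ℝ} (hR : 0 < R) (m n : ℤ) (f : L2Rad R) :
    coef hR m (mode n f) = if m = n then f else 0 := by
  refine ext_inner_left ℂ fun g => ?_
  rw [inner_coef_right, inner_mode_mode hR]
  split_ifs <;> simp

/-- By Parseval's identity on (-π, π) the L² norm of G is the sum of the squares of its Fourier
coefficients. -/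
theorem ae_eq_zero_of_fourier {G : ℝ → ℂ} (hG : MemLp G 2 angMeasure)
    (h : ∀ n : ℤ, ∫ t, Complex.exp (-(n * (t * Complex.I))) * G t ∂angMeasure = 0) :
    G =ᵐ[angMeasure] 0 := by
  have hlt : -Real.pi < Real.pi := by linarith [Real.pi_pos]
  have hs := hasSum_sq_fourierCoeffOn hlt hG
  have h0 : ∀ n : ℤ, fourierCoeffOn hlt G n = 0 := by
    intro n
    rw [fourierCoeffOn_eq_integral, intervalIntegral.integral_of_le hlt.le]
    have := h n
    unfold angMeasure at this
    rw [← this]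
    simp only [smul_eq_mul, fourier_coe_apply]
    rw [integral_congr_ae, this, smul_zero]
    filter_upwards with t
    congr 2
    have : (Real.pi : ℂ) ≠ 0 := by exact_mod_cast Real.pi_ne_zero
    push_cast
    field_simp
    ring
  simp only [h0, norm_zero, ne_eq, OfNat.ofNat_ne_zero, not_false_eq_true, zero_pow] at hs
  have h1 := hs.unique hasSum_zero
  rw [smul_eq_zero, or_iff_right (by rw [inv_eq_zero]; linarith [Real.pi_pos]),
    intervalIntegral.integral_of_le hlt.le] at h1
  have h2 := (integral_eq_zero_iff_of_nonneg (fun t => by positivity)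
    (by simpa [angMeasure] using hG.integrable_norm_pow (by norm_num))).1 h1
  filter_upwards [h2] with t ht
  simpa using ht

/-- A function on the exterior of the disk with vanishing Fourier coefficients vanishes. -/
theorem eq_zero_of_coef {R : ℝ} (hR : 0 < R) (u : L2Ext R) (h : ∀ n, coef hR n u = 0) : u = 0 := by
  have hU : MemLp (fun p => u (polarMap p)) 2 ((radialMeasure R).prod angMeasure) :=
    (Lp.memLp u).comp_measurePreserving (measurePreserving_polarMap hR)
  have hcoef : ∀ n : ℤ, ∀ᵐ r ∂radialMeasure R,
      ∫ t, Complex.exp (-(n * (t * Complex.I))) * u (polarMap (r, t)) ∂angMeasure = 0 := by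
    intro n
    -- The measure on the radii is infinite, so square integrability gives integrability only over
    -- sets of finite measure.
    have hInt : ∀ s, MeasurableSet s → radialMeasure R s < ⊤ →
        Integrable (fun p : ℝ × ℝ => Complex.exp (-(n * (p.2 * Complex.I))) * u (polarMap p))
          (((radialMeasure R).restrict s).prod angMeasure) := by
      intro s hs hsf
      have : IsFiniteMeasure ((radialMeasure R).restrict s) := ⟨by simpa using hsf⟩
      have h1 : MemLp (fun p => u (polarMap p)) 2
          (((radialMeasure R).restrict s).prod angMeasure) := by
        rw [← Measure.restrict_univ (μ := angMeasure), Measure.prod_restrict]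
        exact hU.restrict _
      refine (h1.integrable (by norm_num)).bdd_mul (c := 1) (by fun_prop) ?_
      filter_upwards with p
      rw [Complex.norm_exp]; simp
    refine ae_eq_zero_of_forall_setIntegral_eq_of_sigmaFinite (fun s hs hsf => ?_)
      (fun s hs hsf => ?_)
    · exact (hInt s hs hsf).integral_prod_left
    · rw [← integral_prod _ (hInt s hs hsf)]
      -- Pairing with the mode built on the indicator of s shows that the angular Fourier integral,
      -- as a function of r, integrates to zero over every s of finite measure.
      have hz := inner_coef_right hR n (indicatorConstLp 2 hs hsf.ne (1 : ℂ)) u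
      rw [h n, inner_zero_right, L2.inner_def,
        integral_diskExt hR (L2.integrable_inner (𝕜 := ℂ) _ _).aestronglyMeasurable] at hz
      have key : (fun p => ⟪mode n (indicatorConstLp 2 hs hsf.ne (1 : ℂ)) (polarMap p),
          u (polarMap p)⟫_ℂ) =ᵐ[(radialMeasure R).prod angMeasure] (s ×ˢ univ).indicator fun p =>
          Complex.exp (-(n * (p.2 * Complex.I))) * u (polarMap p)
            / (Real.sqrt (2 * Real.pi) : ℂ) := by
        filter_upwards [mode_polarMap hR n (indicatorConstLp 2 hs hsf.ne (1 : ℂ)),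
          Measure.quasiMeasurePreserving_fst.ae (indicatorConstLp_coeFn (p := 2) (hs := hs)
            (hμs := hsf.ne) (c := (1 : ℂ)))] with p h1 h2
        rw [h1, h2, RCLike.inner_apply]
        by_cases hp : p.1 ∈ s
        · rw [indicator_of_mem hp, indicator_of_mem (show p ∈ s ×ˢ univ from ⟨hp, mem_univ _⟩),
            map_div₀, map_mul, ← Complex.exp_conj]
          simp only [map_mul, Complex.conj_ofReal, Complex.conj_I, map_intCast, map_one]
          ring_nf
        · rw [indicator_of_notMem hp, indicator_of_notMem (fun h => hp h.1)]
          simp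
      rw [integral_congr_ae key, integral_indicator (hs.prod MeasurableSet.univ),
        ← Measure.prod_restrict, Measure.restrict_univ, integral_div] at hz
      have hpi : (Real.sqrt (2 * Real.pi) : ℂ) ≠ 0 := by
        exact_mod_cast (Real.sqrt_pos.2 (by positivity)).ne'
      exact (div_eq_zero_iff.1 hz.symm).resolve_right hpi
  have hslice : ∀ᵐ r ∂radialMeasure R, MemLp (fun t => u (polarMap (r, t))) 2 angMeasure := by
    have h2 := (hU.integrable_norm_pow (by norm_num)).prod_right_ae
    have h3 := hU.aestronglyMeasurable.prodMk_left
    filter_upwards [h2, h3] with r h2 h3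
    refine (memLp_two_iff_integrable_sq_norm h3).2 (by simpa using h2)
  -- There are countably many n, so a single null set of radii is discarded for all of them.
  have hz : ∀ᵐ r ∂radialMeasure R, ∀ᵐ t ∂angMeasure, u (polarMap (r, t)) = 0 := by
    filter_upwards [hslice, ae_all_iff.2 hcoef] with r h1 h2
    exact ae_eq_zero_of_fourier h1 h2
  have hz2 : ∀ᵐ p ∂(radialMeasure R).prod angMeasure, u (polarMap p) = 0 := by
    refine (Measure.ae_prod_iff_ae_ae ?_).2 hz
    exact ((Lp.stronglyMeasurable u).measurable.comp continuous_polarMap.measurable)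
      (measurableSet_singleton 0)
  apply (Lp.eq_zero_iff_ae_eq_zero).2
  have h4 : ∀ᵐ z ∂((radialMeasure R).prod angMeasure).map polarMap, u z = 0 := by
    refine (ae_map_iff continuous_polarMap.aemeasurable ?_).2 hz2
    exact (Lp.stronglyMeasurable u).measurable (measurableSet_singleton 0)
  rwa [map_polarMap hR] at h4


/-! ### Primitives on a half-line -/

/-- `F` is a primitive of the locally integrable function `f` on `[R, ∞)`. -/
structure IsPrim (R : ℝ) (F f : ℝ → ℂ) : Prop where
  int : ∀ b, R ≤ b → IntervalIntegrable f volume R b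
  eq : ∀ r, R ≤ r → F r = F R + ∫ t in R..r, f t

/-- The product of the integrals is the integral of f(t)g(s) over a square. The diagonal, a null
set, cuts it into two triangles, and Fubini's theorem identifies their contributions with the two
terms on the left. This is the product rule for absolutely continuous functions, without any
pointwise differentiation. -/
theorem integral_mul_integral_add {a b : ℝ} (hab : a ≤ b) {f g : ℝ → ℂ}
    (hf : IntervalIntegrable f volume a b) (hg : IntervalIntegrable g volume a b) :
    ∫ t in a..b, (f t * (∫ s in a..t, g s) + (∫ s in a..t, f s) * g t)
      = (∫ t in a..b, f t) * ∫ t in a..b, g t := by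
  have hf' : Integrable f (volume.restrict (Ioc a b)) := (intervalIntegrable_iff_integrableOn_Ioc_of_le hab).1 hf
  have hg' : Integrable g (volume.restrict (Ioc a b)) := (intervalIntegrable_iff_integrableOn_Ioc_of_le hab).1 hg
  set μ := (volume : Measure ℝ).restrict (Ioc a b) with hμ
  have hprim : ∀ h : ℝ → ℂ, ∀ t ∈ Ioc a b,
      ∫ s in a..t, h s = ∫ s, (Iic t).indicator h s ∂μ := by
    intro h t ht
    rw [intervalIntegral.integral_of_le ht.1.le, integral_indicator measurableSet_Iic, hμ,
      Measure.restrict_restrict measurableSet_Iic]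
    congr 2
    ext s; simp only [mem_Ioc, mem_inter_iff, mem_Iic]
    constructor
    · rintro ⟨h1, h2⟩; exact ⟨h2, h1, h2.trans ht.2⟩
    · rintro ⟨h1, h2, -⟩; exact ⟨h2, h1⟩
  have hT : MeasurableSet {p : ℝ × ℝ | p.2 ≤ p.1} := measurableSet_le measurable_snd measurable_fst
  have hInt1 : Integrable ({p : ℝ × ℝ | p.2 ≤ p.1}.indicator fun p => f p.1 * g p.2) (μ.prod μ) :=
    (hf'.mul_prod hg').indicator hT
  have hInt2 : Integrable ({p : ℝ × ℝ | p.2 ≤ p.1}.indicator fun p => f p.2 * g p.1) (μ.prod μ) :=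
    ((hg'.mul_prod hf').congr (by filter_upwards with p; exact mul_comm _ _)).indicator hT
  have e1 : ∀ t, ∫ s, {p : ℝ × ℝ | p.2 ≤ p.1}.indicator (fun p => f p.1 * g p.2) (t, s) ∂μ
      = f t * ∫ s, (Iic t).indicator g s ∂μ := by
    intro t
    rw [← integral_const_mul]
    congr 1; ext s
    by_cases h : s ≤ t
    · rw [indicator_of_mem (by exact h), indicator_of_mem (by exact h)]
    · rw [indicator_of_notMem (by exact h), indicator_of_notMem (by exact h), mul_zero]
  have e2 : ∀ t, ∫ s, {p : ℝ × ℝ | p.2 ≤ p.1}.indicator (fun p => f p.2 * g p.1) (t, s) ∂μ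
      = (∫ s, (Iic t).indicator f s ∂μ) * g t := by
    intro t
    rw [← integral_mul_const]
    congr 1; ext s
    by_cases h : s ≤ t
    · rw [indicator_of_mem (by exact h), indicator_of_mem (by exact h)]
    · rw [indicator_of_notMem (by exact h), indicator_of_notMem (by exact h), zero_mul]
  have e3 : ∀ t, ∫ s, {p : ℝ × ℝ | p.2 ≤ p.1}.indicator (fun p => f p.2 * g p.1) (s, t) ∂μ
      = f t * ∫ s, (Ici t).indicator g s ∂μ := by
    intro t
    rw [← integral_const_mul]
    congr 1; ext s
    by_cases h : t ≤ s
    · rw [indicator_of_mem (by exact h), indicator_of_mem (by exact h)]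
    · rw [indicator_of_notMem (by exact h), indicator_of_notMem (by exact h), mul_zero]
  have i1 := hInt1.integral_prod_left
  have i2 := hInt2.integral_prod_left
  have i3 := hInt2.integral_prod_right
  simp_rw [e1] at i1
  simp_rw [e2] at i2
  simp_rw [e3] at i3
  -- After the swap both triangles have f(t) as outer factor, and their inner integrals of g over s
  -- ≤ t and s ≥ t add up to the full integral.
  have hsw : ∫ t, (∫ s, (Iic t).indicator f s ∂μ) * g t ∂μ
      = ∫ t, f t * ∫ s, (Ici t).indicator g s ∂μ ∂μ := by
    simp_rw [← e2, ← e3]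
    exact integral_integral_swap hInt2
  rw [intervalIntegral.integral_of_le hab, ← hμ]
  have hc : ∫ t, (f t * (∫ s in a..t, g s) + (∫ s in a..t, f s) * g t) ∂μ
      = ∫ t, (f t * (∫ s, (Iic t).indicator g s ∂μ)
          + (∫ s, (Iic t).indicator f s ∂μ) * g t) ∂μ := by
    apply integral_congr_ae
    filter_upwards [ae_restrict_mem measurableSet_Ioc] with t ht
    rw [hprim g t ht, hprim f t ht]
  rw [hc, integral_add i1 i2, hsw, ← integral_add i1 i3, intervalIntegral.integral_of_le hab,
    intervalIntegral.integral_of_le hab, ← integral_mul_const]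
  congr 1; ext t
  rw [← mul_add, ← integral_add (hg'.indicator measurableSet_Iic)
    (hg'.indicator measurableSet_Ici)]
  congr 1
  apply integral_congr_ae
  have hne : ∀ᵐ s ∂μ, s ≠ t := by
    rw [hμ]; exact ae_restrict_of_ae (Measure.ae_ne volume t)
  filter_upwards [hne] with s hs
  rcases lt_or_gt_of_ne hs with h | h
  · rw [indicator_of_mem (by exact h.le), indicator_of_notMem (by exact not_le.2 h), add_zero]
  · rw [indicator_of_notMem (by exact not_le.2 h), indicator_of_mem (by exact h.le), zero_add]

namespace IsPrim

variable {R : ℝ} {F f G g : ℝ → ℂ}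

theorem continuousOn_Icc (h : IsPrim R F f) {b : ℝ} (hb : R ≤ b) : ContinuousOn F (Icc R b) := by
  have h1 : ContinuousOn (fun r => F R + ∫ t in R..r, f t) (Icc R b) := by
    refine continuousOn_const.add ?_
    have := intervalIntegral.continuousOn_primitive_interval' (h.int b hb) (left_mem_uIcc)
    rwa [uIcc_of_le hb] at this
  exact h1.congr fun r hr => h.eq r hr.1

theorem continuousOn (h : IsPrim R F f) : ContinuousOn F (Ici R) := by
  intro r hr
  have h1 := h.continuousOn_Icc (b := r + 1) (by linarith [mem_Ici.1 hr])
  refine (h1 r ⟨hr, by linarith⟩).mono_of_mem_nhdsWithin ?_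
  have : Iio (r + 1) ∈ nhdsWithin r (Ici R) := mem_nhdsWithin_of_mem_nhds (Iio_mem_nhds (by linarith))
  filter_upwards [this, self_mem_nhdsWithin] with x h1 h2
  exact ⟨h2, le_of_lt h1⟩

theorem of_hasDerivAt (h : ∀ r, R ≤ r → HasDerivAt F (f r) r) (hf : ContinuousOn f (Ici R)) :
    IsPrim R F f := by
  have hi : ∀ b, R ≤ b → IntervalIntegrable f volume R b := fun b hb =>
    (hf.mono Icc_subset_Ici_self).intervalIntegrable_of_Icc hb
  refine ⟨hi, fun r hr => ?_⟩
  rw [intervalIntegral.integral_eq_sub_of_hasDerivAt (fun x hx => h x ?_) (hi r hr)]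
  · ring
  · rw [uIcc_of_le hr] at hx; exact hx.1

theorem of_integral (hf : ∀ b, R ≤ b → IntervalIntegrable f volume R b) (a : ℂ) :
    IsPrim R (fun r => a + ∫ t in R..r, f t) f :=
  ⟨hf, fun r _ => by simp⟩

theorem add (hF : IsPrim R F f) (hG : IsPrim R G g) :
    IsPrim R (fun r => F r + G r) (fun r => f r + g r) := by
  refine ⟨fun b hb => (hF.int b hb).add (hG.int b hb), fun r hr => ?_⟩
  rw [intervalIntegral.integral_add (hF.int r hr) (hG.int r hr), hF.eq r hr, hG.eq r hr]
  ring

theorem const_mul (hF : IsPrim R F f) (c : ℂ) :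
    IsPrim R (fun r => c * F r) (fun r => c * f r) := by
  refine ⟨fun b hb => (hF.int b hb).const_mul c, fun r hr => ?_⟩
  rw [intervalIntegral.integral_const_mul, hF.eq r hr]
  ring

theorem conj (hF : IsPrim R F f) :
    IsPrim R (fun r => starRingEnd ℂ (F r)) (fun r => starRingEnd ℂ (f r)) := by
  refine ⟨fun b hb => ?_, fun r hr => ?_⟩
  · have := hF.int b hb
    rw [intervalIntegrable_iff] at this ⊢
    exact (Complex.conjLIE.toContinuousLinearEquiv.toContinuousLinearMap.integrable_comp this)
  · rw [hF.eq r hr, map_add, intervalIntegral.integral_of_le hr, intervalIntegral.integral_of_le hr,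
      ← integral_conj]

theorem mul (hF : IsPrim R F f) (hG : IsPrim R G g) :
    IsPrim R (fun r => F r * G r) (fun r => f r * G r + F r * g r) := by
  have hi1 : ∀ b, R ≤ b → IntervalIntegrable (fun r => f r * G r) volume R b := fun b hb =>
    (hF.int b hb).mul_continuousOn (by rw [uIcc_of_le hb]; exact hG.continuousOn_Icc hb)
  have hi2 : ∀ b, R ≤ b → IntervalIntegrable (fun r => F r * g r) volume R b := fun b hb =>
    (hG.int b hb).continuousOn_mul (by rw [uIcc_of_le hb]; exact hF.continuousOn_Icc hb)
  refine ⟨fun b hb => (hi1 b hb).add (hi2 b hb), fun r hr => ?_⟩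
  have key := integral_mul_integral_add hr (hF.int r hr) (hG.int r hr)
  -- Inserting F = F R + ∫ f and G = G R + ∫ g separates the initial values from the case of
  -- `integral_mul_integral_add`.
  have hc : ∫ t in R..r, (f t * G t + F t * g t)
      = ∫ t in R..r, ((f t * (∫ s in R..t, g s) + (∫ s in R..t, f s) * g t)
          + (G R * f t + F R * g t)) := by
    apply intervalIntegral.integral_congr
    intro t ht
    rw [uIcc_of_le hr] at ht
    simp only []
    rw [hF.eq t ht.1, hG.eq t ht.1]
    ring
  have hj1 : IntervalIntegrable (fun t => f t * (∫ s in R..t, g s)) volume R r := by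
    refine ((hi1 r hr).sub ((hF.int r hr).const_mul (G R))).congr ?_
    intro t ht
    rw [uIoc_of_le hr] at ht
    simp only []
    rw [hG.eq t ht.1.le]; ring
  have hj2 : IntervalIntegrable (fun t => (∫ s in R..t, f s) * g t) volume R r := by
    refine ((hi2 r hr).sub ((hG.int r hr).const_mul (F R))).congr ?_
    intro t ht
    rw [uIoc_of_le hr] at ht
    simp only []
    rw [hF.eq t ht.1.le]; ring
  rw [hc, intervalIntegral.integral_add (hj1.add hj2)
    (((hF.int r hr).const_mul _).add ((hG.int r hr).const_mul _)), key,
    intervalIntegral.integral_add ((hF.int r hr).const_mul _) ((hG.int r hr).const_mul _),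
    intervalIntegral.integral_const_mul, intervalIntegral.integral_const_mul, hF.eq r hr,
    hG.eq r hr]
  ring

/-- Integrability of f gives F a limit at infinity, and integrability of F forces this limit to be
0. No decay has to be assumed. -/
theorem integral_Ioi (hF : IsPrim R F f) (h1 : IntegrableOn F (Ioi R)) (h2 : IntegrableOn f (Ioi R)) :
    ∫ t in Ioi R, f t = -F R := by
  have hlim := intervalIntegral_tendsto_integral_Ioi R h2 Filter.tendsto_id
  have hlim2 : Filter.Tendsto F Filter.atTop (nhds (F R + ∫ t in Ioi R, f t)) := by
    refine (hlim.const_add (F R)).congr' ?_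
    filter_upwards [Filter.eventually_ge_atTop R] with r hr
    exact (hF.eq r hr).symm
  have h0 : IntegrableAtFilter F Filter.atTop := ⟨Ioi R, Filter.Ioi_mem_atTop R, h1⟩
  have := h0.eq_zero_of_tendsto (fun s hs => by
    obtain ⟨a, ha⟩ := Filter.mem_atTop_sets.1 hs
    refine measure_mono_top (fun x hx => ha x hx) (Real.volume_Ici (a := a))) hlim2
  linear_combination this

end IsPrim

/-! ### The fundamental lemma of the calculus of variations on a half-line -/

/-- Test functions on the half-line `(R, ∞)`. -/
structure IsTest (R : ℝ) (ψ : ℝ → ℝ) : Prop where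
  smooth : ContDiff ℝ ∞ ψ
  compact : HasCompactSupport ψ
  supp : tsupport ψ ⊆ Ioi R

namespace IsTest

variable {R : ℝ} {ψ : ℝ → ℝ}

theorem deriv (h : IsTest R ψ) : IsTest R (deriv ψ) :=
  ⟨(contDiff_infty_iff_deriv.1 h.smooth).2, h.compact.deriv, fun _ hx => h.supp (tsupport_deriv_subset hx)⟩

theorem exists_bounds (h : IsTest R ψ) : ∃ a b, R < a ∧ a ≤ b ∧ ∀ x, x ∉ Icc a b → ψ x = 0 := by
  -- The point R + 1 is added so that the compact set is non-empty even if ψ vanishes identically.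
  have hK : IsCompact (insert (R + 1) (tsupport ψ)) := h.compact.isCompact.insert _
  have hne : (insert (R + 1) (tsupport ψ)).Nonempty := insert_nonempty _ _
  refine ⟨sInf (insert (R + 1) (tsupport ψ)), sSup (insert (R + 1) (tsupport ψ)), ?_, ?_, ?_⟩
  · have := hK.sInf_mem hne
    rcases this with h1 | h1
    · rw [h1]; linarith
    · exact h.supp h1
  · exact csInf_le_csSup hne hK.bddBelow hK.bddAbove
  · intro x hx
    by_contra hn
    have : x ∈ insert (R + 1) (tsupport ψ) := mem_insert_of_mem _ (subset_tsupport _ hn)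
    exact hx ⟨csInf_le hK.bddBelow this, le_csSup hK.bddAbove this⟩

theorem isPrim (h : IsTest R ψ) : IsPrim R (fun r => (ψ r : ℂ)) (fun r => ((_root_.deriv ψ r : ℝ) : ℂ)) :=
  IsPrim.of_hasDerivAt
    (fun r _ => ((h.smooth.differentiable (by simp)) r).hasDerivAt.ofReal_comp)
    (Complex.continuous_ofReal.comp h.deriv.smooth.continuous).continuousOn

theorem of_bounds {a b : ℝ} (hs : ContDiff ℝ ∞ ψ) (ha : R < a) (h : ∀ x, x ∉ Icc a b → ψ x = 0) :
    IsTest R ψ := by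
  have h1 : tsupport ψ ⊆ Icc a b :=
    closure_minimal (fun x hx => by by_contra h2; exact hx (h x h2)) isClosed_Icc
  exact ⟨hs, HasCompactSupport.intro isCompact_Icc h, h1.trans fun x hx => ha.trans_le hx.1⟩

theorem exists_integral_one (R : ℝ) : ∃ ρ : ℝ → ℝ, IsTest R ρ ∧ ∫ x, ρ x = 1 := by
  let B : ContDiffBump (R + 1 : ℝ) := ⟨1 / 4, 1 / 2, by norm_num, by norm_num⟩
  refine ⟨B.normed volume, ⟨B.contDiff_normed, B.hasCompactSupport_normed, ?_⟩, B.integral_normed⟩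
  rw [B.tsupport_normed_eq]
  intro x hx
  rw [Real.closedBall_eq_Icc] at hx
  have := hx.1
  change R + 1 - 1 / 2 ≤ x at this
  change R < x
  linarith

theorem integrable (h : IsTest R ψ) : Integrable ψ :=
  h.smooth.continuous.integrable_of_hasCompactSupport h.compact

/-- The mean value zero is what makes the primitive vanish again to the right of the support. -/
theorem exists_primitive (h : IsTest R ψ) (h0 : ∫ x, ψ x = 0) :
    ∃ Ψ, IsTest R Ψ ∧ _root_.deriv Ψ = ψ := by
  obtain ⟨a, b, ha, hab, hz⟩ := h.exists_bounds
  have hc := h.smooth.continuous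
  have hd : ∀ x, HasDerivAt (fun x => ∫ t in a..x, ψ t) (ψ x) x := fun x =>
    intervalIntegral.integral_hasDerivAt_right (hc.intervalIntegrable _ _)
      hc.aestronglyMeasurable.stronglyMeasurableAtFilter hc.continuousAt
  have hder : _root_.deriv (fun x => ∫ t in a..x, ψ t) = ψ := funext fun x => (hd x).deriv
  refine ⟨fun x => ∫ t in a..x, ψ t, of_bounds (a := a) (b := b) ?_ ha ?_, hder⟩
  · rw [contDiff_infty_iff_deriv, hder]
    exact ⟨fun x => (hd x).differentiableAt, h.smooth⟩
  · intro x hx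
    rcases lt_or_ge x a with h1 | h1
    · apply intervalIntegral.integral_zero_ae
      have : ∀ᵐ t : ℝ, t ≠ a := Measure.ae_ne volume a
      filter_upwards [this] with t ht1 ht
      rw [uIoc_of_ge h1.le] at ht
      exact hz t fun h2 => ht1 (le_antisymm ht.2 h2.1)
    · have h2 : b < x := by by_contra h2; exact hx ⟨h1, not_lt.1 h2⟩
      rw [← h0, intervalIntegral.integral_of_le h1, ← integral_Icc_eq_integral_Ioc]
      apply setIntegral_eq_integral_of_forall_compl_eq_zero
      intro t ht
      exact hz t fun h3 => ht ⟨h3.1, h3.2.trans h2.le⟩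

/-- The lemma of du Bois-Reymond. Subtracting from ψ the multiple (∫ψ)ρ of a fixed bump of integral
one leaves the derivative of a test function, so h is tested by ψ in the same way as the constant
∫ρh. -/
theorem ae_eq_const {h : ℝ → ℂ} (hh : LocallyIntegrableOn h (Ioi R))
    (hz : ∀ ψ, IsTest R ψ → ∫ r in Ioi R, (_root_.deriv ψ r) • h r = 0) :
    ∃ c, ∀ᵐ r ∂volume.restrict (Ioi R), h r = c := by
  obtain ⟨ρ, hρ, hρ1⟩ := exists_integral_one R
  have hInt : ∀ ψ, IsTest R ψ → IntegrableOn (fun r => ψ r • h r) (Ioi R) := by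
    intro ψ hψ
    obtain ⟨a, b, ha, hab, hz⟩ := hψ.exists_bounds
    have h1 : IntegrableOn h (Icc a b) :=
      hh.integrableOn_compact_subset (fun x hx => ha.trans_le hx.1) isCompact_Icc
    have h2 : IntegrableOn (fun r => ψ r • h r) (Icc a b) :=
      h1.continuousOn_smul hψ.smooth.continuous.continuousOn isCompact_Icc
    have h3 : Integrable (fun r => ψ r • h r) := by
      rw [← integrableOn_iff_integrable_of_support_subset (s := Icc a b)]
      · exact h2
      · intro x hx
        by_contra hn
        exact hx (by simp [hz x hn])
    exact h3.integrableOn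
  refine ⟨∫ r in Ioi R, ρ r • h r, ?_⟩
  set c := ∫ r in Ioi R, ρ r • h r with hc
  rw [ae_restrict_iff' measurableSet_Ioi]
  have hmain := isOpen_Ioi.ae_eq_zero_of_integral_contDiff_smul_eq_zero
    (f := fun r => h r - c) (μ := volume) (U := Ioi R)
    (hh.sub (locallyIntegrableOn_const c)) ?_
  · filter_upwards [hmain] with r hr h1
    exact sub_eq_zero.1 (hr h1)
  intro ψ h1 h2 h3
  have hψ : IsTest R ψ := ⟨h1, h2, h3⟩
  have hsupp : ∫ x, ψ x • (h x - c) = ∫ x in Ioi R, ψ x • (h x - c) := by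
    rw [setIntegral_eq_integral_of_forall_compl_eq_zero]
    intro x hx
    rw [image_eq_zero_of_notMem_tsupport fun h4 => hx (h3 h4), zero_smul]
  have hψI : ∫ x in Ioi R, ψ x = ∫ x, ψ x := by
    rw [setIntegral_eq_integral_of_forall_compl_eq_zero]
    intro x hx
    rw [image_eq_zero_of_notMem_tsupport fun h4 => hx (h3 h4)]
  have hdiff : IsTest R fun x => ψ x - (∫ y, ψ y) * ρ x := by
    obtain ⟨a, b, ha, hab, hz1⟩ := hψ.exists_bounds
    obtain ⟨a', b', ha', hab', hz2⟩ := hρ.exists_bounds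
    refine of_bounds (a := min a a') (b := max b b')
      (hψ.smooth.sub (contDiff_const.mul hρ.smooth)) (lt_min ha ha') fun x hx => ?_
    rw [hz1 x, hz2 x]
    · simp
    · exact fun h5 => hx ⟨(min_le_right _ _).trans h5.1, h5.2.trans (le_max_right _ _)⟩
    · exact fun h5 => hx ⟨(min_le_left _ _).trans h5.1, h5.2.trans (le_max_left _ _)⟩
  obtain ⟨Ψ, hΨ, hd⟩ := hdiff.exists_primitive (by
    rw [integral_sub hψ.integrable (hρ.integrable.const_mul _), integral_const_mul, hρ1]; ring)
  have h4 := hz Ψ hΨ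
  rw [hd] at h4
  have h5 : ∫ r in Ioi R, (ψ r - (∫ y, ψ y) * ρ r) • h r
      = (∫ r in Ioi R, ψ r • h r) - (∫ y, ψ y) • c := by
    rw [hc, ← integral_smul, ← integral_sub (hInt ψ hψ) (by exact (hInt ρ hρ).smul (∫ y, ψ y))]
    congr 1; ext r; simp only [Complex.real_smul]; push_cast; ring
  rw [h5] at h4
  rw [hsupp]
  simp_rw [smul_sub]
  rw [integral_sub (hInt ψ hψ) (hψ.integrable.integrableOn.smul_const c), integral_smul_const,
    hψI]
  exact h4

end IsTest


/-! ### Weakly differentiable functions in `L²((R, ∞); r dr)` -/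

section Radial

variable {R : ℝ}

theorem ae_radialMeasure_iff (hR : 0 < R) {p : ℝ → Prop} :
    (∀ᵐ r ∂radialMeasure R, p r) ↔ ∀ᵐ r ∂volume.restrict (Ioi R), p r := by
  unfold radialMeasure
  rw [ae_withDensity_iff ENNReal.measurable_ofReal]
  constructor
  · intro h
    filter_upwards [h, ae_restrict_mem measurableSet_Ioi] with r h1 h2
    exact h1 (by simpa using hR.trans h2)
  · intro h
    filter_upwards [h] with r h1 _ using h1

theorem integral_radialMeasure (hR : 0 < R) (F : ℝ → ℂ) :
    ∫ r, F r ∂radialMeasure R = ∫ r in Ioi R, (r : ℂ) * F r := by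
  unfold radialMeasure
  rw [integral_withDensity_eq_integral_toReal_smul ENNReal.measurable_ofReal
    (by filter_upwards with r using ENNReal.ofReal_lt_top)]
  apply integral_congr_ae
  filter_upwards [ae_restrict_mem measurableSet_Ioi] with r hr
  rw [ENNReal.toReal_ofReal (hR.trans hr).le, Complex.real_smul]

theorem integrable_radialMeasure_iff (hR : 0 < R) {F : ℝ → ℂ} :
    Integrable F (radialMeasure R) ↔ IntegrableOn (fun r : ℝ => (r : ℂ) * F r) (Ioi R) := by
  unfold radialMeasure
  rw [integrable_withDensity_iff_integrable_smul' ENNReal.measurable_ofReal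
    (by filter_upwards with r using ENNReal.ofReal_lt_top)]
  apply integrable_congr
  filter_upwards [ae_restrict_mem measurableSet_Ioi] with r hr
  rw [ENNReal.toReal_ofReal (hR.trans hr).le, Complex.real_smul]

/-- On (R, ∞) the weight satisfies r/R ≥ 1. Therefore elements of L²(r dr) are square integrable for
Lebesgue measure, in particular locally integrable up to the endpoint R. -/
theorem restrict_le_radialMeasure (hR : 0 < R) :
    (volume : Measure ℝ).restrict (Ioi R) ≤ ENNReal.ofReal R⁻¹ • radialMeasure R := by
  rw [Measure.le_iff]
  intro s hs
  rw [Measure.smul_apply, radialMeasure, withDensity_apply _ hs, smul_eq_mul,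
    ← lintegral_const_mul _ ENNReal.measurable_ofReal, ← setLIntegral_one]
  apply lintegral_mono_ae
  filter_upwards [ae_restrict_of_ae (ae_restrict_mem measurableSet_Ioi)] with r hr
  rw [← ENNReal.ofReal_mul (by positivity), ENNReal.one_le_ofReal, inv_mul_eq_div, le_div_iff₀ hR]
  linarith [mem_Ioi.1 hr]

theorem memLp_restrict (hR : 0 < R) (f : L2Rad R) : MemLp f 2 (volume.restrict (Ioi R)) :=
  (Lp.memLp f).of_measure_le_smul ENNReal.ofReal_ne_top (restrict_le_radialMeasure hR)

theorem integrableOn_Ioc (hR : 0 < R) (f : L2Rad R) (b : ℝ) : IntegrableOn f (Ioc R b) := by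
  have h := (memLp_restrict hR f).restrict (Ioc R b)
  rw [Measure.restrict_restrict measurableSet_Ioc,
    inter_eq_left.2 Ioc_subset_Ioi_self] at h
  exact h.integrable (by norm_num)

theorem intervalIntegrable (hR : 0 < R) (f : L2Rad R) (b : ℝ) (hb : R ≤ b) :
    IntervalIntegrable f volume R b :=
  (intervalIntegrable_iff_integrableOn_Ioc_of_le hb).2 (integrableOn_Ioc hR f b)

/-- `f` has the absolutely continuous representative with weak derivative `g` and value `a`
at the endpoint `R`. -/
def HasRadDeriv (f g : L2Rad R) (a : ℂ) : Prop :=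
  f =ᵐ[radialMeasure R] fun r => a + ∫ t in R..r, g t

theorem isPrim_coe (hR : 0 < R) (g : L2Rad R) (a : ℂ) :
    IsPrim R (fun r => a + ∫ t in R..r, g t) g :=
  IsPrim.of_integral (fun b hb => intervalIntegrable hR g b hb) a

theorem HasRadDeriv.of_isPrim (hR : 0 < R) {F φ : ℝ → ℂ} (h : IsPrim R F φ) {f g : L2Rad R}
    (hf : f =ᵐ[radialMeasure R] F) (hg : g =ᵐ[radialMeasure R] φ) : HasRadDeriv f g (F R) := by
  filter_upwards [hf, ae_radialMeasure_gt R] with r h1 h2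
  rw [h1, h.eq r h2.le]
  congr 1
  rw [intervalIntegral.integral_of_le h2.le, intervalIntegral.integral_of_le h2.le]
  apply integral_congr_ae
  have h3 := (ae_radialMeasure_iff hR).1 hg
  have h4 := ae_restrict_of_ae_restrict_of_subset (Ioc_subset_Ioi_self : Ioc R r ⊆ Ioi R) h3
  filter_upwards [h4] with t ht using ht.symm

theorem HasRadDeriv.add (hR : 0 < R) {f g f' g' : L2Rad R} {a a' : ℂ} (h : HasRadDeriv f g a)
    (h' : HasRadDeriv f' g' a') : HasRadDeriv (f + f') (g + g') (a + a') := by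
  have := HasRadDeriv.of_isPrim hR ((isPrim_coe hR g a).add (isPrim_coe hR g' a'))
    (f := f + f') (g := g + g') (by
      filter_upwards [Lp.coeFn_add f f', h, h'] with r h1 h2 h3
      rw [h1, Pi.add_apply, h2, h3]) (Lp.coeFn_add g g')
  simpa using this

theorem HasRadDeriv.smul (hR : 0 < R) {f g : L2Rad R} {a : ℂ} (h : HasRadDeriv f g a) (c : ℂ) :
    HasRadDeriv (c • f) (c • g) (c * a) := by
  have := HasRadDeriv.of_isPrim hR ((isPrim_coe hR g a).const_mul c)
    (f := c • f) (g := c • g) (by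
      filter_upwards [Lp.coeFn_smul c f, h] with r h1 h2
      rw [h1, Pi.smul_apply, h2, smul_eq_mul]) (Lp.coeFn_smul c g)
  simpa using this

theorem memLp_inv_mul (hR : 0 < R) (f : L2Rad R) :
    MemLp (fun r : ℝ => (r : ℂ)⁻¹ * f r) 2 (radialMeasure R) := by
  refine (Lp.memLp f).of_le_mul (c := R⁻¹)
    ((by fun_prop : Measurable fun r : ℝ => (r : ℂ)⁻¹).aestronglyMeasurable.mul
      (Lp.aestronglyMeasurable f)) ?_
  filter_upwards [ae_radialMeasure_gt R] with r hr
  rw [norm_mul, norm_inv, Complex.norm_real, Real.norm_eq_abs, abs_of_pos (hR.trans hr)]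
  gcongr

/-- Multiplication by `1 / r`. -/
def invR (hR : 0 < R) : L2Rad R →L[ℂ] L2Rad R :=
  LinearMap.mkContinuous
    { toFun := fun f => (memLp_inv_mul hR f).toLp _
      map_add' := fun f g => by
        rw [← MemLp.toLp_add]
        apply MemLp.toLp_congr
        filter_upwards [Lp.coeFn_add f g] with r h
        simp only [h, Pi.add_apply]; ring
      map_smul' := fun c f => by
        rw [RingHom.id_apply, ← MemLp.toLp_const_smul]
        apply MemLp.toLp_congr
        filter_upwards [Lp.coeFn_smul c f] with r h
        simp only [h, Pi.smul_apply, smul_eq_mul]; ring } R⁻¹ (fun f => by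
      refine Lp.norm_le_mul_norm_of_ae_le_mul ?_
      filter_upwards [(memLp_inv_mul hR f).coeFn_toLp, ae_radialMeasure_gt R] with r h hr
      simp only [LinearMap.coe_mk, AddHom.coe_mk]
      rw [h, norm_mul, norm_inv, Complex.norm_real, Real.norm_eq_abs, abs_of_pos (hR.trans hr)]
      gcongr)

theorem coeFn_invR (hR : 0 < R) (f : L2Rad R) :
    invR hR f =ᵐ[radialMeasure R] fun r => (r : ℂ)⁻¹ * f r :=
  (memLp_inv_mul hR f).coeFn_toLp

theorem norm_invR_le (hR : 0 < R) (f : L2Rad R) : ‖invR hR f‖ ≤ R⁻¹ * ‖f‖ :=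
  (LinearMap.mkContinuous_norm_le _ (by positivity) _ |> fun h =>
    ContinuousLinearMap.le_of_opNorm_le _ h f)

theorem inner_invR_left (hR : 0 < R) (f g : L2Rad R) :
    ⟪invR hR f, g⟫_ℂ = ⟪f, invR hR g⟫_ℂ := by
  rw [L2.inner_def, L2.inner_def]
  apply integral_congr_ae
  filter_upwards [coeFn_invR hR f, coeFn_invR hR g] with r h1 h2
  rw [h1, h2, RCLike.inner_apply, RCLike.inner_apply, map_mul, map_inv₀, Complex.conj_ofReal]
  ring

theorem re_inner_invR_nonneg (hR : 0 < R) (f : L2Rad R) : 0 ≤ (⟪f, invR hR f⟫_ℂ).re := by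
  rw [L2.inner_def, ← RCLike.re_eq_complex_re, ← integral_re (L2.integrable_inner (𝕜 := ℂ) _ _)]
  apply integral_nonneg_of_ae
  filter_upwards [coeFn_invR hR f, ae_radialMeasure_gt R] with r h1 h2
  rw [h1, RCLike.inner_apply, mul_assoc, Complex.mul_conj, ← Complex.ofReal_inv,
    ← Complex.ofReal_mul]
  change (0 : ℝ) ≤ r⁻¹ * Complex.normSq (f r)
  have := hR.trans h2
  have := Complex.normSq_nonneg (f r)
  positivity

/-- The weight R⁻² - r⁻² is positive for every r > R, so equality would force f = 0. The strictness
matters at the threshold τ = 1/R². -/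
theorem norm_invR_sq_lt (hR : 0 < R) {f : L2Rad R} (hf : f ≠ 0) :
    ‖invR hR f‖ ^ 2 < (R ^ 2)⁻¹ * ‖f‖ ^ 2 := by
  have hns : ∀ g : L2Rad R, ‖g‖ ^ 2 = ∫ r, ‖g r‖ ^ 2 ∂radialMeasure R := by
    intro g
    have h := @inner_self_eq_norm_sq ℂ _ _ _ _ g
    rw [← h, L2.inner_def, ← integral_re (L2.integrable_inner (𝕜 := ℂ) _ _)]
    apply integral_congr_ae
    filter_upwards with r
    exact inner_self_eq_norm_sq _
  have hi : ∀ g : L2Rad R, Integrable (fun r => ‖g r‖ ^ 2) (radialMeasure R) := fun g => by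
    simpa using (Lp.memLp g).integrable_norm_pow (by norm_num)
  have hpt : ∀ᵐ r ∂radialMeasure R, (R ^ 2)⁻¹ * ‖f r‖ ^ 2 - ‖invR hR f r‖ ^ 2
      = ((R ^ 2)⁻¹ - (r ^ 2)⁻¹) * ‖f r‖ ^ 2 := by
    filter_upwards [coeFn_invR hR f] with r h1
    rw [h1, norm_mul, norm_inv, Complex.norm_real, mul_pow, Real.norm_eq_abs, inv_pow, sq_abs]
    ring
  have hpos : ∀ r, R < r → 0 < (R ^ 2)⁻¹ - (r ^ 2)⁻¹ := fun r hr => by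
    rw [sub_pos]; gcongr
  have hnn : ∀ᵐ r ∂radialMeasure R, 0 ≤ (R ^ 2)⁻¹ * ‖f r‖ ^ 2 - ‖invR hR f r‖ ^ 2 := by
    filter_upwards [hpt, ae_radialMeasure_gt R] with r h1 h2
    rw [h1]
    have := hpos r h2
    positivity
  have hInt := ((hi f).const_mul (R ^ 2)⁻¹).sub (hi (invR hR f))
  have hval : ∫ r, ((R ^ 2)⁻¹ * ‖f r‖ ^ 2 - ‖invR hR f r‖ ^ 2) ∂radialMeasure R
      = (R ^ 2)⁻¹ * ‖f‖ ^ 2 - ‖invR hR f‖ ^ 2 := by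
    rw [integral_sub ((hi f).const_mul _) (hi _), integral_const_mul, ← hns, ← hns]
  rw [← sub_pos, ← hval]
  refine lt_of_le_of_ne (integral_nonneg_of_ae hnn) fun h0 => hf ?_
  have hz := (integral_eq_zero_iff_of_nonneg_ae hnn hInt).1 h0.symm
  apply (Lp.eq_zero_iff_ae_eq_zero).2
  filter_upwards [hz, hpt, ae_radialMeasure_gt R] with r h1 h2 h3
  rw [h2] at h1
  have h4 := (mul_eq_zero.1 h1).resolve_left (hpos r h3).ne'
  simpa using h4

theorem invR_ne_zero (hR : 0 < R) {f : L2Rad R} (hf : f ≠ 0) : invR hR f ≠ 0 := by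
  intro h
  apply hf
  apply (Lp.eq_zero_iff_ae_eq_zero).2
  filter_upwards [coeFn_invR hR f, (Lp.eq_zero_iff_ae_eq_zero).1 h, ae_radialMeasure_gt R]
    with r h1 h2 h3
  rw [h1] at h2
  have : (r : ℂ) ≠ 0 := by exact_mod_cast (hR.trans h3).ne'
  simpa [this] using h2

theorem HasRadDeriv.invR (hR : 0 < R) {f g : L2Rad R} {a : ℂ} (h : HasRadDeriv f g a) :
    HasRadDeriv (invR hR f) (invR hR g - invR hR (invR hR f)) ((R : ℂ)⁻¹ * a) := by
  have h0 : IsPrim R (fun r : ℝ => (r : ℂ)⁻¹) (fun r : ℝ => -((r : ℂ) ^ 2)⁻¹) := by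
    refine IsPrim.of_hasDerivAt (fun r hr => ?_) ?_
    · have hr0 : (r : ℂ) ≠ 0 := by exact_mod_cast (hR.trans_le hr).ne'
      have := (hasDerivAt_inv hr0).comp_ofReal
      exact this
    · refine ContinuousOn.neg (ContinuousOn.inv₀ (by fun_prop) fun r hr => ?_)
      exact pow_ne_zero _ (by exact_mod_cast (hR.trans_le hr).ne')
  have := HasRadDeriv.of_isPrim hR (h0.mul (isPrim_coe hR g a))
    (f := RobinBilaplacian.invR hR f)
    (g := RobinBilaplacian.invR hR g - RobinBilaplacian.invR hR (RobinBilaplacian.invR hR f)) (by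
      filter_upwards [coeFn_invR hR f, h] with r h1 h2
      rw [h1, h2]) (by
      filter_upwards [coeFn_invR hR f, h, coeFn_invR hR g, coeFn_invR hR (RobinBilaplacian.invR hR f),
        Lp.coeFn_sub (RobinBilaplacian.invR hR g)
          (RobinBilaplacian.invR hR (RobinBilaplacian.invR hR f))] with r h1 h2 h3 h4 h5
      rw [h5, Pi.sub_apply, h4, h3, h1, h2]
      ring)
  simpa using this

/-- Integration by parts in `L²((R, ∞); r dr)`. -/
theorem HasRadDeriv.integral_by_parts (hR : 0 < R) {f f' g g' : L2Rad R} {a b : ℂ}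
    (hf : HasRadDeriv f f' a) (hg : HasRadDeriv g g' b) :
    ⟪g, f'⟫_ℂ + ⟪g', f⟫_ℂ + ⟪g, RobinBilaplacian.invR hR f⟫_ℂ = -(R * a * starRingEnd ℂ b) := by
  have hr : IsPrim R (fun r : ℝ => (r : ℂ)) (fun _ => 1) :=
    IsPrim.of_hasDerivAt (fun r _ => (hasDerivAt_id r).ofReal_comp) continuousOn_const
  -- The function r f ḡ is integrated. Differentiating its factor r produces f ḡ, which in L²(r dr)
  -- is the term with `invR`; square integrability makes the function and its derivative integrable,
  -- so nothing is left at infinity.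
  have hP := hr.mul ((isPrim_coe hR f' a).mul (isPrim_coe hR g' b).conj)
  have i1 := L2.integrable_inner (𝕜 := ℂ) g f'
  have i2 := L2.integrable_inner (𝕜 := ℂ) g' f
  have i3 := L2.integrable_inner (𝕜 := ℂ) g (RobinBilaplacian.invR hR f)
  have i0 := L2.integrable_inner (𝕜 := ℂ) g f
  have e0 : (fun r => (r : ℂ) * ⟪g r, f r⟫_ℂ) =ᵐ[volume.restrict (Ioi R)] fun r =>
      (r : ℂ) * ((a + ∫ t in R..r, f' t) * starRingEnd ℂ (b + ∫ t in R..r, g' t)) := by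
    filter_upwards [(ae_radialMeasure_iff hR).1 hf, (ae_radialMeasure_iff hR).1 hg] with r h1 h2
    rw [h1, h2, RCLike.inner_apply]
  have e1 : (fun r => (r : ℂ) * (⟪g r, f' r⟫_ℂ + ⟪g' r, f r⟫_ℂ
      + ⟪g r, RobinBilaplacian.invR hR f r⟫_ℂ)) =ᵐ[volume.restrict (Ioi R)] fun r =>
      1 * ((a + ∫ t in R..r, f' t) * starRingEnd ℂ (b + ∫ t in R..r, g' t))
        + (r : ℂ) * (f' r * starRingEnd ℂ (b + ∫ t in R..r, g' t)
          + (a + ∫ t in R..r, f' t) * starRingEnd ℂ (g' r)) := by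
    filter_upwards [(ae_radialMeasure_iff hR).1 hf, (ae_radialMeasure_iff hR).1 hg,
      (ae_radialMeasure_iff hR).1 (coeFn_invR hR f), ae_restrict_mem measurableSet_Ioi]
      with r h1 h2 h3 h4
    have hr0 : (r : ℂ) ≠ 0 := by exact_mod_cast (hR.trans h4).ne'
    rw [h3, ← h1, ← h2, RCLike.inner_apply, RCLike.inner_apply, RCLike.inner_apply]
    field_simp
    ring
  have hI := hP.integral_Ioi (((integrable_radialMeasure_iff hR).1 i0).congr e0)
    (((integrable_radialMeasure_iff hR).1 ((i1.add i2).add i3)).congr e1)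
  rw [← integral_congr_ae e1, ← integral_radialMeasure hR, integral_add (by exact i1.add i2) i3,
    integral_add i1 i2, ← L2.inner_def, ← L2.inner_def, ← L2.inner_def] at hI
  rw [hI]
  simp only [intervalIntegral.integral_same, add_zero]
  ring

/-- Integration by parts of f against itself; the term ⟨f, f/r⟩ has the favourable sign and is
dropped. -/
theorem HasRadDeriv.boundary_le (hR : 0 < R) {f f' : L2Rad R} {a : ℂ} (h : HasRadDeriv f f' a) :
    R * ‖a‖ ^ 2 ≤ 2 * (‖f'‖ * ‖f‖) := by
  have h1 := congrArg Complex.re (h.integral_by_parts hR h)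
  have h2 := re_inner_invR_nonneg hR f
  have h3 : (⟪f', f⟫_ℂ).re = (⟪f, f'⟫_ℂ).re := by
    rw [← inner_conj_symm, Complex.conj_re]
  rw [Complex.add_re, Complex.add_re, h3, mul_assoc, Complex.mul_conj, Complex.neg_re,
    ← Complex.ofReal_mul, Complex.ofReal_re, Complex.normSq_eq_norm_sq] at h1
  have h4 := abs_le.1 ((Complex.abs_re_le_norm _).trans (norm_inner_le_norm (𝕜 := ℂ) f f'))
  nlinarith [h4.1]

/-- Interpolation: the first derivative is controlled by the function and its second derivative. -/
theorem HasRadDeriv.norm_deriv_sq_le (hR : 0 < R) {f f' f'' : L2Rad R} {a b : ℂ}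
    (h : HasRadDeriv f f' a) (h' : HasRadDeriv f' f'' b) :
    ‖f'‖ ^ 2 ≤ 10 * (‖f''‖ * ‖f‖) + 4 * (R ^ 2)⁻¹ * ‖f‖ ^ 2 := by
  have h1 := h.integral_by_parts hR h'
  have h2 := h.boundary_le hR
  have h3 := h'.boundary_le hR
  set x := ‖f'‖
  set y := ‖f‖
  set w := ‖f''‖
  have hx : 0 ≤ x := norm_nonneg _
  have hy : 0 ≤ y := norm_nonneg _
  have hw : 0 ≤ w := norm_nonneg _
  -- Integration by parts of f against f', which leaves a boundary term with both f(R) and f'(R).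
  have h4 : x ^ 2 ≤ R * (‖a‖ * ‖b‖) + w * y + R⁻¹ * (x * y) := by
    have e : ⟪f', f'⟫_ℂ = -(R * a * starRingEnd ℂ b) - ⟪f'', f⟫_ℂ - ⟪f', RobinBilaplacian.invR hR f⟫_ℂ := by
      rw [← h1]; ring
    have e2 : x ^ 2 = ‖⟪f', f'⟫_ℂ‖ := by
      rw [inner_self_eq_norm_sq_to_K]; simp [x]
    rw [e2, e]
    refine (norm_sub_le _ _).trans (add_le_add ((norm_sub_le _ _).trans (add_le_add ?_ ?_)) ?_)
    · rw [norm_neg, norm_mul, norm_mul, Complex.norm_real, RCLike.norm_conj, Real.norm_eq_abs,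
        abs_of_pos hR, mul_assoc]
    · exact norm_inner_le_norm _ _
    · refine (norm_inner_le_norm _ _).trans ?_
      have := mul_le_mul_of_nonneg_left (norm_invR_le hR f) hx
      calc _ ≤ x * (R⁻¹ * y) := this
        _ = _ := by ring
  -- The product of the boundary estimates R|a|² ≤ 2xy and R|b|² ≤ 2wx.
  have h5 : (R * (‖a‖ * ‖b‖)) ^ 2 ≤ (2 * x) ^ 2 * (w * y) := by
    have := mul_le_mul h2 h3 (by positivity) (by positivity)
    nlinarith
  -- This bound and the next one each cost a quarter of x². Half of x² is thus absorbed, which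
  -- doubles the coefficient 4 + 1 of wy to 10.
  have h6 : R * (‖a‖ * ‖b‖) ≤ x ^ 2 / 4 + 4 * (w * y) := by
    refine abs_le_of_sq_le_sq' ?_ (by positivity) |>.2
    refine h5.trans ?_
    nlinarith [sq_nonneg (x ^ 2 / 4 - 4 * (w * y))]
  have h7 : R⁻¹ * (x * y) ≤ x ^ 2 / 4 + (R ^ 2)⁻¹ * y ^ 2 := by
    rw [← inv_pow]
    nlinarith [sq_nonneg (x / 2 - R⁻¹ * y)]
  have h8 : 0 ≤ (R ^ 2)⁻¹ * y ^ 2 := by positivity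
  nlinarith

/-- The weak formulation of `f' = g`. -/
def WeakRadDeriv (f g : L2Rad R) : Prop :=
  ∀ ψ, IsTest R ψ → ∫ r in Ioi R, (deriv ψ r) • f r = -∫ r in Ioi R, ψ r • g r

theorem locallyIntegrableOn_coe (hR : 0 < R) (f : L2Rad R) : LocallyIntegrableOn f (Ioi R) := by
  have h := (memLp_restrict hR f)
  have h2 : LocallyIntegrable f (volume.restrict (Ioi R)) := h.locallyIntegrable (by norm_num)
  exact locallyIntegrableOn_of_locallyIntegrable_restrict h2

theorem IsTest.integrable_smul (hR : 0 < R) {ψ : ℝ → ℝ} (hψ : IsTest R ψ) (f : L2Rad R) :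
    IntegrableOn (fun r => ψ r • f r) (Ioi R) := by
  have h1 : MemLp ψ 2 (volume.restrict (Ioi R)) :=
    (hψ.smooth.continuous.memLp_of_hasCompactSupport hψ.compact)
  simpa only [Complex.real_smul] using! (h1.ofReal (K := ℂ)).integrable_mul (memLp_restrict hR f)

theorem IsTest.integral_deriv_prim (hR : 0 < R) {ψ : ℝ → ℝ} (hψ : IsTest R ψ) (g : L2Rad R) (a : ℂ) :
    IntegrableOn (fun r => (_root_.deriv ψ r) • (a + ∫ t in R..r, g t)) (Ioi R) ∧
    ∫ r in Ioi R, (_root_.deriv ψ r) • (a + ∫ t in R..r, g t) = -∫ r in Ioi R, ψ r • g r := by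
  have hG := isPrim_coe hR g a
  have hInt : ∀ φ, IsTest R φ →
      IntegrableOn (fun r => φ r • (a + ∫ t in R..r, g t)) (Ioi R) := by
    intro φ hφ
    obtain ⟨c, d, hc, hcd, hz⟩ := hφ.exists_bounds
    have h1 : IntegrableOn (fun r => φ r • (a + ∫ t in R..r, g t)) (Icc c d) := by
      refine ContinuousOn.integrableOn_compact isCompact_Icc ?_
      exact hφ.smooth.continuous.continuousOn.smul
        (hG.continuousOn.mono fun x hx => hc.le.trans hx.1)
    have h3 : Integrable (fun r => φ r • (a + ∫ t in R..r, g t)) := by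
      rw [← integrableOn_iff_integrable_of_support_subset (s := Icc c d)]
      · exact h1
      · intro x hx
        by_contra hn
        exact hx (by simp [hz x hn])
    exact h3.integrableOn
  refine ⟨hInt _ hψ.deriv, ?_⟩
  have hP := hψ.isPrim.mul hG
  have hR0 : ψ R = 0 := image_eq_zero_of_notMem_tsupport fun h => lt_irrefl R (hψ.supp h)
  have j1 := hInt _ hψ.deriv
  have j2 := hψ.integrable_smul hR g
  have := hP.integral_Ioi (by simpa only [Complex.real_smul] using hInt ψ hψ)
    (by simpa only [Complex.real_smul] using! j1.add j2)
  simp only [← Complex.real_smul] at this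
  rw [integral_add j1 j2, hR0] at this
  simp only [zero_smul, neg_zero] at this
  exact eq_neg_of_add_eq_zero_left this

theorem HasRadDeriv.weak (hR : 0 < R) {f g : L2Rad R} {a : ℂ} (h : HasRadDeriv f g a) :
    WeakRadDeriv f g := by
  intro ψ hψ
  rw [← (hψ.integral_deriv_prim hR g a).2]
  apply integral_congr_ae
  filter_upwards [(ae_radialMeasure_iff hR).1 h] with r hr
  rw [hr]

/-- The difference of f and a primitive of g has weak derivative zero, hence is constant by
`IsTest.ae_eq_const`; the constant is the boundary value. -/
theorem WeakRadDeriv.exists (hR : 0 < R) {f g : L2Rad R} (h : WeakRadDeriv f g) :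
    ∃ a, HasRadDeriv f g a := by
  have hG := isPrim_coe hR g 0
  obtain ⟨c, hc⟩ := IsTest.ae_eq_const (R := R) (h := fun r => f r - (0 + ∫ t in R..r, g t))
    ((locallyIntegrableOn_coe hR f).sub
      ((hG.continuousOn.mono Ioi_subset_Ici_self).locallyIntegrableOn measurableSet_Ioi))
    (fun ψ hψ => by
      simp_rw [smul_sub]
      have h1 := hψ.integral_deriv_prim hR g 0
      rw [integral_sub (hψ.deriv.integrable_smul hR f) h1.1, h1.2, h ψ hψ, sub_self])
  refine ⟨c, (ae_radialMeasure_iff hR).2 ?_⟩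
  filter_upwards [hc] with r hr
  rw [← hr]; ring

end Radial


/-! ### Weak derivatives in the exterior of the disk -/

section Weak

variable {R : ℝ}

theorem locallyIntegrable_coe (u : L2Ext R) :
    LocallyIntegrable u ((volume : Measure ℂ).restrict (diskExt R)) :=
  (Lp.memLp u).locallyIntegrable (by norm_num)

theorem memLp_of_compact {E : Type*} [NormedAddCommGroup E] {φ : ℂ → E} (h1 : Continuous φ)
    (h2 : HasCompactSupport φ) : MemLp φ 2 ((volume : Measure ℂ).restrict (diskExt R)) :=
  h1.memLp_of_hasCompactSupport h2

theorem integrable_smul_coe {φ : ℂ → ℝ} (h1 : Continuous φ) (h2 : HasCompactSupport φ)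
    (u : L2Ext R) : Integrable (fun z => φ z • u z) (volume.restrict (diskExt R)) := by
  simpa only [Complex.real_smul] using!
    ((memLp_of_compact (R := R) h1 h2).ofReal (K := ℂ)).integrable_mul (Lp.memLp u)

theorem integrable_mul_coe {φ : ℂ → ℂ} (h1 : Continuous φ) (h2 : HasCompactSupport φ)
    (u : L2Ext R) : Integrable (fun z => φ z * u z) (volume.restrict (diskExt R)) :=
  (memLp_of_compact (R := R) h1 h2).integrable_mul (Lp.memLp u)

theorem continuous_fderiv_dir {E : Type*} [NormedAddCommGroup E] [NormedSpace ℝ E] {φ : ℂ → E}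
    (h : ContDiff ℝ ∞ φ) (v : ℂ) : Continuous fun z => fderiv ℝ φ z v :=
  (h.continuous_fderiv (by simp)).clm_apply continuous_const

theorem hasCompactSupport_fderiv_dir {E : Type*} [NormedAddCommGroup E] [NormedSpace ℝ E]
    {φ : ℂ → E} (h : HasCompactSupport φ) (v : ℂ) :
    HasCompactSupport fun z => fderiv ℝ φ z v :=
  h.fderiv_apply (𝕜 := ℝ) v

/-- Weak derivatives are defined with real test functions, while the Fourier analysis tests with
functions ρ(r)e^{imθ}. Real and imaginary parts are treated separately. -/
theorem HasWeakDeriv.complex {j : Fin 2} {u g : L2Ext R} (h : HasWeakDeriv j u g) {φ : ℂ → ℂ}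
    (h1 : ContDiff ℝ ∞ φ) (h2 : HasCompactSupport φ) (h3 : tsupport φ ⊆ diskExt R) :
    ∫ z in diskExt R, fderiv ℝ φ z (dir j) * u z = -∫ z in diskExt R, φ z * g z := by
  have hr1 : ContDiff ℝ ∞ (fun z => (φ z).re) := Complex.reCLM.contDiff.comp h1
  have hi1 : ContDiff ℝ ∞ (fun z => (φ z).im) := Complex.imCLM.contDiff.comp h1
  have hr2 : HasCompactSupport (fun z => (φ z).re) := h2.comp_left (g := Complex.re) rfl
  have hi2 : HasCompactSupport (fun z => (φ z).im) := h2.comp_left (g := Complex.im) rfl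
  have hr3 : tsupport (fun z => (φ z).re) ⊆ diskExt R :=
    (tsupport_comp_subset (g := Complex.re) rfl φ).trans h3
  have hi3 : tsupport (fun z => (φ z).im) ⊆ diskExt R :=
    (tsupport_comp_subset (g := Complex.im) rfl φ).trans h3
  have dr : ∀ z, fderiv ℝ (fun z => (φ z).re) z (dir j) = (fderiv ℝ φ z (dir j)).re := fun z => by
    have := (Complex.reCLM.hasFDerivAt.comp z ((h1.differentiable (by simp)) z).hasFDerivAt).fderiv
    change fderiv ℝ (Complex.reCLM ∘ φ) z _ = _
    rw [this]; rfl
  have di : ∀ z, fderiv ℝ (fun z => (φ z).im) z (dir j) = (fderiv ℝ φ z (dir j)).im := fun z => by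
    have := (Complex.imCLM.hasFDerivAt.comp z ((h1.differentiable (by simp)) z).hasFDerivAt).fderiv
    change fderiv ℝ (Complex.imCLM ∘ φ) z _ = _
    rw [this]; rfl
  have er := h _ hr1 hr2 hr3
  have ei := h _ hi1 hi2 hi3
  have split : ∀ (a : ℂ → ℂ) (w : L2Ext R),
      Integrable (fun z => (a z).re • w z) (volume.restrict (diskExt R)) →
      Integrable (fun z => (a z).im • w z) (volume.restrict (diskExt R)) →
      ∫ z in diskExt R, a z * w z = (∫ z in diskExt R, (a z).re • w z)
        + Complex.I * ∫ z in diskExt R, (a z).im • w z := by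
    intro a w h1 h2
    rw [← integral_const_mul, ← integral_add h1 (h2.const_mul _)]
    congr 1; ext z
    rw [Complex.real_smul, Complex.real_smul]
    nth_rewrite 1 [← Complex.re_add_im (a z)]
    ring
  simp only [dr] at er
  simp only [di] at ei
  rw [split (fun z => fderiv ℝ φ z (dir j)) u, split φ g, er, ei]
  · ring
  · exact integrable_smul_coe hr1.continuous hr2 g
  · exact integrable_smul_coe hi1.continuous hi2 g
  · exact integrable_smul_coe (Complex.continuous_re.comp (continuous_fderiv_dir h1 _))
      ((hasCompactSupport_fderiv_dir h2 _).comp_left (g := Complex.re) rfl) u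
  · exact integrable_smul_coe (Complex.continuous_im.comp (continuous_fderiv_dir h1 _))
      ((hasCompactSupport_fderiv_dir h2 _).comp_left (g := Complex.im) rfl) u

theorem HasWeakDeriv.unique {j : Fin 2} {u g g' : L2Ext R} (h : HasWeakDeriv j u g)
    (h' : HasWeakDeriv j u g') : g = g' := by
  rw [← sub_eq_zero]
  apply (Lp.eq_zero_iff_ae_eq_zero).2
  have hmain := (isOpen_diskExt R).ae_eq_zero_of_integral_contDiff_smul_eq_zero
    (f := (g - g' : L2Ext R)) (μ := volume)
    (locallyIntegrableOn_of_locallyIntegrable_restrict (locallyIntegrable_coe _)) ?_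
  · exact (ae_restrict_iff' (measurableSet_diskExt R)).2 hmain
  intro φ h1 h2 h3
  have hs : ∫ z, φ z • (g - g' : L2Ext R) z = ∫ z in diskExt R, φ z • (g - g' : L2Ext R) z := by
    rw [setIntegral_eq_integral_of_forall_compl_eq_zero]
    intro x hx
    rw [image_eq_zero_of_notMem_tsupport fun h4 => hx (h3 h4), zero_smul]
  have e : ∫ z in diskExt R, φ z • (g - g' : L2Ext R) z
      = (∫ z in diskExt R, φ z • g z) - ∫ z in diskExt R, φ z • g' z := by
    rw [← integral_sub (integrable_smul_coe h1.continuous h2 g)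
      (integrable_smul_coe h1.continuous h2 g')]
    apply integral_congr_ae
    filter_upwards [Lp.coeFn_sub g g'] with z hz
    rw [hz, Pi.sub_apply, smul_sub]
  rw [hs, e, sub_eq_zero]
  exact neg_injective ((h φ h1 h2 h3).symm.trans (h' φ h1 h2 h3))

/-- By uniqueness the arbitrary choice made in `weakDeriv` is harmless. -/
theorem weakDeriv_eq {j : Fin 2} {u g : L2Ext R} (h : HasWeakDeriv j u g) : weakDeriv j u = g := by
  have hex : ∃ g, HasWeakDeriv j u g := ⟨g, h⟩
  unfold weakDeriv
  rw [dif_pos hex]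
  exact hex.choose_spec.unique h

theorem hasWeakDeriv_weakDeriv {j : Fin 2} {u : L2Ext R} (h : ∃ g, HasWeakDeriv j u g) :
    HasWeakDeriv j u (weakDeriv j u) := by
  obtain ⟨g, hg⟩ := h
  rwa [weakDeriv_eq hg]

theorem integral_smul_add {φ : ℂ → ℝ} (h1 : Continuous φ) (h2 : HasCompactSupport φ)
    (u v : L2Ext R) : ∫ z in diskExt R, φ z • (u + v : L2Ext R) z
      = (∫ z in diskExt R, φ z • u z) + ∫ z in diskExt R, φ z • v z := by
  rw [← integral_add (integrable_smul_coe h1 h2 u) (integrable_smul_coe h1 h2 v)]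
  apply integral_congr_ae
  filter_upwards [Lp.coeFn_add u v] with z hz
  rw [hz, Pi.add_apply, smul_add]

theorem integral_smul_smul (φ : ℂ → ℝ) (c : ℂ) (u : L2Ext R) :
    ∫ z in diskExt R, φ z • (c • u : L2Ext R) z = c * ∫ z in diskExt R, φ z • u z := by
  rw [← integral_const_mul]
  apply integral_congr_ae
  filter_upwards [Lp.coeFn_smul c u] with z hz
  rw [hz, Pi.smul_apply, Complex.real_smul, Complex.real_smul, smul_eq_mul]
  ring

theorem HasWeakDeriv.add {j : Fin 2} {u g v h : L2Ext R} (hu : HasWeakDeriv j u g)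
    (hv : HasWeakDeriv j v h) : HasWeakDeriv j (u + v) (g + h) := by
  intro φ h1 h2 h3
  rw [integral_smul_add (continuous_fderiv_dir h1 _) (hasCompactSupport_fderiv_dir h2 _),
    integral_smul_add h1.continuous h2, hu φ h1 h2 h3, hv φ h1 h2 h3]
  ring

theorem HasWeakDeriv.smul {j : Fin 2} {u g : L2Ext R} (hu : HasWeakDeriv j u g) (c : ℂ) :
    HasWeakDeriv j (c • u) (c • g) := by
  intro φ h1 h2 h3
  rw [integral_smul_smul, integral_smul_smul, hu φ h1 h2 h3]
  ring

/-! ### Weak derivatives of Fourier coefficients -/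

theorem dir_zero : dir 0 = 1 := rfl

theorem dir_one : dir 1 = Complex.I := rfl

/-- The Wirtinger-type combination of partial derivatives in polar coordinates. -/
theorem wirtinger_polar (L : ℂ →L[ℝ] ℂ) (t : ℝ) {s : ℤ} (hs : s = 1 ∨ s = -1) :
    L (dir 0) + s * Complex.I * L (dir 1)
      = Complex.exp (s * (t * Complex.I)) * (L (Complex.exp (t * Complex.I))
        + Complex.I * s * L (Complex.I * Complex.exp (t * Complex.I))) := by
  have e1 : Complex.exp (t * Complex.I) = (Real.cos t) • (1 : ℂ) + (Real.sin t) • Complex.I := by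
    rw [Complex.exp_mul_I, Complex.real_smul, Complex.real_smul]; simp
  have e2 : Complex.I * Complex.exp (t * Complex.I)
      = (-Real.sin t) • (1 : ℂ) + (Real.cos t) • Complex.I := by
    rw [Complex.exp_mul_I, Complex.real_smul, Complex.real_smul]
    push_cast
    linear_combination (Complex.sin t) * Complex.I_mul_I
  have e3 : Complex.exp (s * (t * Complex.I))
      = (Real.cos t : ℂ) + s * Real.sin t * Complex.I := by
    rcases hs with rfl | rfl
    · rw [Int.cast_one, one_mul, Complex.exp_mul_I]; simp
    · rw [show ((-1 : ℤ) : ℂ) * (t * Complex.I) = ((-t : ℝ) : ℂ) * Complex.I by push_cast; ring,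
        Complex.exp_mul_I]
      simp
  have hcs : (Real.cos t : ℂ) ^ 2 + (Real.sin t : ℂ) ^ 2 = 1 := by
    exact_mod_cast Real.cos_sq_add_sin_sq t
  rw [e3, e2, e1, map_add, map_add, map_smul, map_smul, map_smul, map_smul, dir_zero, dir_one]
  simp only [Complex.real_smul]
  push_cast at hcs ⊢
  have hss : (s : ℂ) ^ 2 = 1 := by rcases hs with rfl | rfl <;> norm_num
  linear_combination (-(L 1 + s * Complex.I * L Complex.I)) * hcs
    + (Complex.sin t ^ 2 * L 1 - Complex.sin t * Complex.cos t * L Complex.I)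
      * (s ^ 2 * Complex.I_sq - hss)

/-- Away from its closed support the function vanishes locally. This removes the singularity at the
origin of the norm, of z/|z| and of 1/r. -/
theorem contDiff_of_contDiffAt_tsupport {E F : Type*} [NormedAddCommGroup E] [NormedSpace ℝ E]
    [NormedAddCommGroup F] [NormedSpace ℝ F] {φ : E → F}
    (h : ∀ z ∈ tsupport φ, ContDiffAt ℝ ∞ φ z) : ContDiff ℝ ∞ φ := by
  rw [contDiff_iff_contDiffAt]
  intro z
  by_cases hz : z ∈ tsupport φ
  · exact h z hz
  · exact contDiffAt_const.congr_of_eventuallyEq (notMem_tsupport_iff_eventuallyEq.1 hz)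

/-- The function `ρ(r) e^{imθ}`. -/
def angFun (ρ : ℝ → ℝ) (m : ℤ) (z : ℂ) : ℂ := (ρ ‖z‖ : ℂ) * (z / ‖z‖) ^ m

theorem tsupport_angFun {ρ : ℝ → ℝ} (m : ℤ) :
    tsupport (angFun ρ m) ⊆ (fun z => ‖z‖) ⁻¹' tsupport ρ := by
  refine closure_minimal (fun z hz => ?_) ((isClosed_tsupport ρ).preimage continuous_norm)
  refine subset_tsupport _ fun h => hz ?_
  simp [angFun, h]

theorem contDiff_angFun (hR : 0 < R) {ρ : ℝ → ℝ} (hρ : IsTest R ρ) (m : ℤ) :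
    ContDiff ℝ ∞ (angFun ρ m) := by
  refine contDiff_of_contDiffAt_tsupport fun z hz => ?_
  have h1 : R < ‖z‖ := hρ.supp (tsupport_angFun m hz)
  have hz0 : z ≠ 0 := norm_pos_iff.1 (hR.trans h1)
  have hn : ContDiffAt ℝ ∞ (fun z : ℂ => ‖z‖) z := contDiffAt_norm ℝ hz0
  have hn0 : (‖z‖ : ℂ) ≠ 0 := by exact_mod_cast (hR.trans h1).ne'
  have hnc : ContDiffAt ℝ ∞ (fun z : ℂ => (‖z‖ : ℂ)) z :=
    Complex.ofRealCLM.contDiff.contDiffAt.comp z hn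
  have hq : ContDiffAt ℝ ∞ (fun z : ℂ => z / (‖z‖ : ℂ)) z := by
    simp only [div_eq_mul_inv]
    exact contDiffAt_id.mul (hnc.inv hn0)
  have hp : ContDiffAt ℝ ∞ (fun z : ℂ => (z / (‖z‖ : ℂ)) ^ m) z := by
    rcases m with k | k
    · simpa using hq.pow k
    · simp only [zpow_negSucc]
      exact (hq.pow _).inv (pow_ne_zero _ (div_ne_zero hz0 hn0))
  exact (Complex.ofRealCLM.contDiff.contDiffAt.comp z
    (hρ.smooth.contDiffAt.comp z hn)).mul hp

theorem hasCompactSupport_angFun {ρ : ℝ → ℝ} (hρ : IsTest R ρ) (m : ℤ) :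
    HasCompactSupport (angFun ρ m) := by
  obtain ⟨a, b, ha, hab, hz⟩ := hρ.exists_bounds
  refine HasCompactSupport.intro (isCompact_closedBall (0 : ℂ) b) fun z hz' => ?_
  have : ρ ‖z‖ = 0 := hz _ fun h => hz' (by simpa using h.2)
  simp [angFun, this]

theorem angFun_polarMap {r : ℝ} (hr : 0 < r) (t : ℝ) (ρ : ℝ → ℝ) (m : ℤ) :
    angFun ρ m (polarMap (r, t)) = ρ r * Complex.exp (m * (t * Complex.I)) := by
  unfold angFun
  rw [norm_polarMap hr.le, polarMap_apply, mul_div_cancel_left₀ _ (by exact_mod_cast hr.ne'),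
    ← Complex.exp_int_mul]

theorem hasDerivAt_polarMap_fst (r t : ℝ) :
    HasDerivAt (fun r => polarMap (r, t)) (Complex.exp (t * Complex.I)) r := by
  simp only [polarMap_apply]
  simpa using ((hasDerivAt_id r).ofReal_comp).mul_const (Complex.exp (t * Complex.I))

theorem hasDerivAt_polarMap_snd (r t : ℝ) :
    HasDerivAt (fun t => polarMap (r, t)) (r * (Complex.I * Complex.exp (t * Complex.I))) t := by
  simp only [polarMap_apply]
  have h1 : HasDerivAt (fun t : ℝ => (t : ℂ) * Complex.I) Complex.I t := by
    simpa using ((hasDerivAt_id t).ofReal_comp).mul_const Complex.I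
  exact ((h1.cexp).const_mul (r : ℂ)).congr_deriv (by ring)

/-- In polar coordinates ∂₁ + is∂₂ equals e^{isθ}(∂_r + is r⁻¹∂_θ): the exponential raises the mode
by s, and ∂_θ contributes the factor im. -/
theorem wirtinger_angFun (hR : 0 < R) {ρ : ℝ → ℝ} (hρ : IsTest R ρ) (m : ℤ) {s : ℤ}
    (hs : s = 1 ∨ s = -1) {r : ℝ} (hr : R < r) (t : ℝ) :
    fderiv ℝ (angFun ρ m) (polarMap (r, t)) (dir 0)
        + s * Complex.I * fderiv ℝ (angFun ρ m) (polarMap (r, t)) (dir 1)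
      = (deriv ρ r - s * m * ρ r / r) * Complex.exp ((m + s : ℤ) * (t * Complex.I)) := by
  have hr0 := hR.trans hr
  have hrc : (r : ℂ) ≠ 0 := by exact_mod_cast hr0.ne'
  have hd := (((contDiff_angFun hR hρ m).differentiable (by simp)) (polarMap (r, t))).hasFDerivAt
  have h1 := (hd.comp_hasDerivAt r (hasDerivAt_polarMap_fst r t)).deriv
  have h2 := (HasFDerivAt.comp_hasDerivAt (f := fun t => polarMap (r, t)) t hd
    (hasDerivAt_polarMap_snd r t)).deriv
  have h1' : HasDerivAt (angFun ρ m ∘ fun r => polarMap (r, t))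
      (deriv ρ r * Complex.exp (m * (t * Complex.I))) r := by
    have h3 : HasDerivAt (fun r => (ρ r : ℂ) * Complex.exp (m * (t * Complex.I)))
        (deriv ρ r * Complex.exp (m * (t * Complex.I))) r :=
      (((hρ.smooth.differentiable (by simp)) r).hasDerivAt.ofReal_comp).mul_const _
    refine h3.congr_of_eventuallyEq ?_
    filter_upwards [Ioi_mem_nhds hr0] with x hx
    exact angFun_polarMap hx t ρ m
  have h2' : HasDerivAt (angFun ρ m ∘ fun t => polarMap (r, t))
      (ρ r * (Complex.exp (m * (t * Complex.I)) * (m * Complex.I))) t := by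
    have h4 : HasDerivAt (fun t : ℝ => (m : ℂ) * ((t : ℂ) * Complex.I)) (m * Complex.I) t := by
      simpa using (((hasDerivAt_id t).ofReal_comp).mul_const Complex.I).const_mul (m : ℂ)
    refine (h4.cexp.const_mul (ρ r : ℂ)).congr_of_eventuallyEq ?_
    filter_upwards with x
    exact angFun_polarMap hr0 x ρ m
  rw [h1'.deriv] at h1
  rw [h2'.deriv, ← Complex.real_smul (x := r), map_smul, Complex.real_smul] at h2
  rw [wirtinger_polar _ t hs, ← h1]
  have h5 : fderiv ℝ (angFun ρ m) (polarMap (r, t)) (Complex.I * Complex.exp (t * Complex.I))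
      = ρ r * (Complex.exp (m * (t * Complex.I)) * (m * Complex.I)) / r := by
    rw [h2]; field_simp
  rw [h5, show ((m + s : ℤ) : ℂ) * (t * Complex.I) = m * (t * Complex.I) + s * (t * Complex.I) by
    push_cast; ring, Complex.exp_add]
  field_simp
  linear_combination (s * m * ρ r : ℂ) * Complex.I_sq

instance : IsLocallyFiniteMeasure (radialMeasure R) := by
  unfold radialMeasure; exact IsLocallyFiniteMeasure.withDensity_ofReal continuous_id

theorem memLp_ofReal_radial {ρ : ℝ → ℝ} (h1 : Continuous ρ) (h2 : HasCompactSupport ρ) :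
    MemLp (fun r => (ρ r : ℂ)) 2 (radialMeasure R) :=
  (h1.memLp_of_hasCompactSupport h2).ofReal

end Weak


section Weak

variable {R : ℝ}

theorem IsTest.div (hR : 0 < R) {ψ : ℝ → ℝ} (hψ : IsTest R ψ) : IsTest R fun r => ψ r / r := by
  obtain ⟨a, b, ha, hab, hz⟩ := hψ.exists_bounds
  refine IsTest.of_bounds (a := a) (b := b) ?_ ha fun x hx => by simp [hz x hx]
  refine contDiff_of_contDiffAt_tsupport fun r hr => ?_
  have h1 : r ∈ tsupport ψ := by
    have h2 : tsupport (fun r => ψ r / r) ⊆ tsupport ψ :=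
      closure_mono fun x hx h0 => hx (by simp [h0])
    exact h2 hr
  have h2 : r ≠ 0 := (hR.trans (hψ.supp h1)).ne'
  simp only [div_eq_mul_inv]
  exact hψ.smooth.contDiffAt.mul (contDiffAt_id.inv h2)

/-- A test function as an element of `L²((R, ∞); r dr)`. -/
def IsTest.toRad {ψ : ℝ → ℝ} (hψ : IsTest R ψ) : L2Rad R :=
  (memLp_ofReal_radial hψ.smooth.continuous hψ.compact).toLp _

theorem IsTest.coeFn_toRad {ψ : ℝ → ℝ} (hψ : IsTest R ψ) :
    hψ.toRad =ᵐ[radialMeasure R] fun r => (ψ r : ℂ) :=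
  MemLp.coeFn_toLp _

/-- The division by r cancels the weight of the measure. Pairings with respect to dr, as in
`WeakRadDeriv`, thereby become inner products of L²(r dr). -/
theorem IsTest.inner_toRad_div (hR : 0 < R) {ψ : ℝ → ℝ} (hψ : IsTest R ψ) (f : L2Rad R) :
    ⟪(hψ.div hR).toRad, f⟫_ℂ = ∫ r in Ioi R, ψ r • f r := by
  rw [L2.inner_def, integral_radialMeasure hR]
  apply integral_congr_ae
  filter_upwards [(ae_radialMeasure_iff hR).1 (hψ.div hR).coeFn_toRad,
    ae_restrict_mem measurableSet_Ioi] with r h1 h2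
  have hr0 : (r : ℂ) ≠ 0 := by exact_mod_cast (hR.trans h2).ne'
  rw [h1, RCLike.inner_apply, Complex.conj_ofReal, Complex.real_smul]
  push_cast
  field_simp

theorem polarMap_norm_arg (z : ℂ) : polarMap (‖z‖, z.arg) = z := by
  rw [polarMap_apply, Complex.norm_mul_exp_arg_mul_I]

theorem modeFun_eq (n : ℤ) (f : ℝ → ℂ) {z : ℂ} (hz : z ≠ 0) :
    modeFun n f z = f ‖z‖ * Complex.exp (n * (z.arg * Complex.I))
      / (Real.sqrt (2 * Real.pi) : ℂ) := by
  nth_rewrite 1 [← polarMap_norm_arg z]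
  exact modeFun_polarMap (norm_pos_iff.2 hz) _ _ _

/-- The Fourier coefficients of a weakly differentiable function are weakly differentiable. -/
theorem weakRadDeriv_coef (hR : 0 < R) {u g₀ g₁ : L2Ext R} (h0 : HasWeakDeriv 0 u g₀)
    (h1 : HasWeakDeriv 1 u g₁) (n : ℤ) {s : ℤ} (hs : s = 1 ∨ s = -1) :
    WeakRadDeriv (coef hR n u) (coef hR (n + s) (g₀ + (s * Complex.I) • g₁)
      + (s * n : ℂ) • invR hR (coef hR n u)) := by
  intro ψ hψ
  have hρ := hψ.div hR
  set ρ : ℝ → ℝ := fun r => ψ r / r with hρd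
  -- Paired with g₀ + is g₁, this function extracts the coefficient n + s; its derivative ∂₁ + is∂₂
  -- has mode -n and extracts the coefficient n of u. The factor ρ = ψ/r compensates the weight r
  -- dr.
  set φ := angFun ρ (-(n + s)) with hφ
  have c1 := contDiff_angFun hR hρ (-(n + s))
  have c2 := hasCompactSupport_angFun hρ (-(n + s))
  have c3 : tsupport φ ⊆ diskExt R := (tsupport_angFun _).trans fun z hz => hρ.supp hz
  have e0 := h0.complex c1 c2 c3
  have e1 := h1.complex c1 c2 c3
  have i0 := integrable_mul_coe (R := R) (continuous_fderiv_dir c1 (dir 0))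
    (hasCompactSupport_fderiv_dir c2 _) u
  have i1 := integrable_mul_coe (R := R) (continuous_fderiv_dir c1 (dir 1))
    (hasCompactSupport_fderiv_dir c2 _) u
  have j0 := integrable_mul_coe (R := R) c1.continuous c2 g₀
  have j1 := integrable_mul_coe (R := R) c1.continuous c2 g₁
  have hq : (Real.sqrt (2 * Real.pi) : ℂ) ≠ 0 := by
    exact_mod_cast (Real.sqrt_pos.2 (by positivity)).ne'
  -- Here ρ' + s(n + s)ρ/r with ρ = ψ/r becomes ψ'/r + snψ/r², because s² = 1.
  have hL : ⟪(hψ.deriv.div hR).toRad + (s * n : ℂ) • invR hR hρ.toRad, coef hR n u⟫_ℂ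
      * (Real.sqrt (2 * Real.pi) : ℂ)
      = (∫ z in diskExt R, fderiv ℝ φ z (dir 0) * u z)
        + s * Complex.I * ∫ z in diskExt R, fderiv ℝ φ z (dir 1) * u z := by
    rw [← integral_const_mul, ← integral_add i0 (i1.const_mul _), inner_coef_right, L2.inner_def,
      ← integral_mul_const]
    apply integral_congr_ae
    have hW : ((hψ.deriv.div hR).toRad + (s * n : ℂ) • invR hR hρ.toRad : L2Rad R)
        =ᵐ[radialMeasure R] fun r => ((deriv ψ r / r : ℝ) : ℂ)
          + (s * n : ℂ) * ((r : ℂ)⁻¹ * ((ψ r / r : ℝ) : ℂ)) := by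
      filter_upwards [(hψ.deriv.div hR).coeFn_toRad, hρ.coeFn_toRad, coeFn_invR hR hρ.toRad,
        Lp.coeFn_add (hψ.deriv.div hR).toRad ((s * n : ℂ) • invR hR hρ.toRad),
        Lp.coeFn_smul (s * n : ℂ) (invR hR hρ.toRad)] with r h1 h2 h3 h4 h5
      rw [h4, Pi.add_apply, h5, Pi.smul_apply, h3, h2, h1, smul_eq_mul]
    filter_upwards [mode_coe_of_ae n _ hW, ae_restrict_mem (measurableSet_diskExt R)] with z h1 h2
    have hz : R < ‖z‖ := h2
    have hz0 : z ≠ 0 := norm_pos_iff.1 (hR.trans hz)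
    have hr0 : (‖z‖ : ℂ) ≠ 0 := by exact_mod_cast (hR.trans hz).ne'
    have hw := wirtinger_angFun hR hρ (-(n + s)) hs hz z.arg
    rw [polarMap_norm_arg] at hw
    have hd : deriv ρ ‖z‖ = deriv ψ ‖z‖ / ‖z‖ - ψ ‖z‖ / ‖z‖ ^ 2 := by
      have hn : ‖z‖ ≠ 0 := norm_ne_zero_iff.2 hz0
      rw [hρd, deriv_fun_div ((hψ.smooth.differentiable (by simp)) _) differentiableAt_fun_id hn,
        deriv_id'']
      field_simp
    rw [← mul_assoc, ← add_mul, hw, h1, modeFun_eq n _ hz0, RCLike.inner_apply, map_div₀, map_mul,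
      ← Complex.exp_conj, hd]
    simp only [map_mul, Complex.conj_ofReal, Complex.conj_I, map_intCast, map_add, map_inv₀]
    rw [show ((-(n + s) + s : ℤ) : ℂ) * (z.arg * Complex.I) = n * (z.arg * -Complex.I) by
      push_cast; ring]
    have hss : (s : ℂ) ^ 2 = 1 := by rcases hs with rfl | rfl <;> norm_num
    push_cast
    field_simp
    simp only [hρd]
    push_cast
    field_simp
    linear_combination (-(u z * ψ ‖z‖ : ℂ)) * hss
  have hRt : ⟪hρ.toRad, coef hR (n + s) (g₀ + (s * Complex.I) • g₁)⟫_ℂ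
      * (Real.sqrt (2 * Real.pi) : ℂ)
      = (∫ z in diskExt R, φ z * g₀ z) + s * Complex.I * ∫ z in diskExt R, φ z * g₁ z := by
    rw [← integral_const_mul, ← integral_add j0 (j1.const_mul _), inner_coef_right, L2.inner_def,
      ← integral_mul_const]
    apply integral_congr_ae
    filter_upwards [mode_coe_of_ae (n + s) _ hρ.coeFn_toRad, ae_restrict_mem (measurableSet_diskExt R),
      Lp.coeFn_add g₀ ((s * Complex.I) • g₁), Lp.coeFn_smul (s * Complex.I) g₁] with z h1 h2 h3 h4
    have hz : R < ‖z‖ := h2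
    have hz0 : z ≠ 0 := norm_pos_iff.1 (hR.trans hz)
    have ha := angFun_polarMap (hR.trans hz) z.arg ρ (-(n + s))
    rw [polarMap_norm_arg] at ha
    rw [h1, modeFun_eq _ _ hz0, h3, Pi.add_apply, h4, Pi.smul_apply, ha, RCLike.inner_apply,
      map_div₀, map_mul, ← Complex.exp_conj]
    simp only [map_mul, Complex.conj_ofReal, Complex.conj_I, map_intCast, smul_eq_mul]
    rw [show ((-(n + s) : ℤ) : ℂ) * (z.arg * Complex.I)
      = (n + s : ℤ) * (z.arg * -Complex.I) by push_cast; ring]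
    field_simp
  rw [e0, e1] at hL
  have key : ⟪(hψ.deriv.div hR).toRad + (s * n : ℂ) • invR hR hρ.toRad, coef hR n u⟫_ℂ
      = -⟪hρ.toRad, coef hR (n + s) (g₀ + (s * Complex.I) • g₁)⟫_ℂ := by
    apply mul_right_cancel₀ hq
    rw [hL, neg_mul, hRt]; ring
  rw [inner_add_left, inner_smul_left, inner_invR_left, map_mul, map_intCast, map_intCast] at key
  rw [← hψ.deriv.inner_toRad_div hR, ← hψ.inner_toRad_div hR, inner_add_right, inner_smul_right]
  linear_combination key

/-! ### The Gauss-Green formula for a single Fourier mode -/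

theorem integrable_prod_mul {K : ℝ × ℝ → ℂ} (hK : Continuous K) {C B : ℝ} (hC : ∀ p, ‖K p‖ ≤ C)
    (hB : ∀ p : ℝ × ℝ, B < p.1 → K p = 0) (f : L2Rad R) :
    Integrable (fun p => K p * f p.1) ((radialMeasure R).prod angMeasure) := by
  have : IsFiniteMeasure ((radialMeasure R).restrict (Icc R B)) :=
    ⟨by simpa using isCompact_Icc.measure_lt_top⟩
  have h1 : IntegrableOn f (Icc R B) (radialMeasure R) :=
    ((Lp.memLp f).restrict (Icc R B)).integrable (by norm_num)
  have h2 : Integrable ((Icc R B).indicator f) (radialMeasure R) :=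
    h1.integrable_indicator measurableSet_Icc
  have h3 := (h2.comp_fst angMeasure).bdd_mul (c := C) hK.aestronglyMeasurable
    (by filter_upwards with p using hC p)
  refine h3.congr ?_
  filter_upwards [ae_prod_gt R] with p hp
  by_cases h : p.1 ≤ B
  · rw [indicator_of_mem (show p.1 ∈ Icc R B from ⟨hp.le, h⟩)]
  · rw [hB p (not_le.1 h)]; simp

/-- In polar coordinates the derivative of φ splits into a radial and an angular part. For each
fixed angle the radial part is integrated by parts on (R, ∞), which yields the boundary term; for
almost every radius the angular part is the integral of a periodic derivative and vanishes. -/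
theorem gauss_green_mode (hR : 0 < R) {f g : L2Rad R} {a : ℂ} (h : HasRadDeriv f g a) (n : ℤ)
    {s : ℤ} (hs : s = 1 ∨ s = -1) {φ : ℂ → ℝ} (h1 : ContDiff ℝ ∞ φ) (h2 : HasCompactSupport φ) :
    ∫ z in diskExt R, ((φ z : ℂ) * mode (n + s) (g - (s * n : ℂ) • invR hR f) z
        + ((fderiv ℝ φ z (dir 0) : ℂ) + s * Complex.I * (fderiv ℝ φ z (dir 1) : ℂ)) * mode n f z)
      = -∫ t, R * a * φ (polarMap (R, t)) * Complex.exp ((n + s : ℤ) * (t * Complex.I))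
          / (Real.sqrt (2 * Real.pi) : ℂ) ∂angMeasure := by
  set q : ℂ := (Real.sqrt (2 * Real.pi) : ℂ) with hqd
  have hq : q ≠ 0 := by
    rw [hqd]; exact_mod_cast (Real.sqrt_pos.2 (by positivity)).ne'
  have hss : (s : ℂ) ^ 2 = 1 := by rcases hs with rfl | rfl <;> norm_num
  set E : ℝ → ℂ := fun t => Complex.exp ((n + s : ℤ) * (t * Complex.I)) with hE
  set A : ℝ × ℝ → ℝ := fun p => fderiv ℝ φ (polarMap p) (Complex.exp (p.2 * Complex.I)) with hA
  set B : ℝ × ℝ → ℝ := fun p => fderiv ℝ φ (polarMap p)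
    (Complex.I * Complex.exp (p.2 * Complex.I)) with hB
  have hEc : Continuous E := by rw [hE]; fun_prop
  have hEn : ∀ t, ‖E t‖ = 1 := fun t => by rw [hE]; simp [Complex.norm_exp]
  have hfc := h1.continuous_fderiv (n := ∞) (by simp)
  have hAc : Continuous A := (hfc.comp continuous_polarMap).clm_apply (by fun_prop)
  have hBc : Continuous B := (hfc.comp continuous_polarMap).clm_apply (by fun_prop)
  obtain ⟨C, hC⟩ := h2.exists_bound_of_continuous h1.continuous
  obtain ⟨C', hC'⟩ := (h2.fderiv (𝕜 := ℝ)).exists_bound_of_continuous hfc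
  have hAn : ∀ p, ‖A p‖ ≤ C' := fun p => by
    refine (ContinuousLinearMap.le_opNorm _ _).trans ?_
    rw [Complex.norm_exp_ofReal_mul_I, mul_one]; exact hC' _
  have hBn : ∀ p, ‖B p‖ ≤ C' := fun p => by
    refine (ContinuousLinearMap.le_opNorm _ _).trans ?_
    rw [norm_mul, Complex.norm_exp_ofReal_mul_I, Complex.norm_I, mul_one, mul_one]; exact hC' _
  obtain ⟨b, hb⟩ := h2.isCompact.isBounded.subset_closedBall (0 : ℂ)
  have hnorm : ∀ p : ℝ × ℝ, ‖polarMap p‖ = |p.1| := fun p => by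
    obtain ⟨r, t⟩ := p
    simp [polarMap_apply, Complex.norm_exp_ofReal_mul_I]
  have hout : ∀ p : ℝ × ℝ, b < |p.1| → polarMap p ∉ tsupport φ := fun p hp hmem => by
    have := hb hmem
    rw [mem_closedBall_zero_iff, hnorm] at this
    linarith
  have hφ0 : ∀ p : ℝ × ℝ, b < |p.1| → φ (polarMap p) = 0 := fun p hp =>
    image_eq_zero_of_notMem_tsupport (hout p hp)
  have hfd0 : ∀ p : ℝ × ℝ, b < |p.1| → fderiv ℝ φ (polarMap p) = 0 := fun p hp =>
    image_eq_zero_of_notMem_tsupport fun h => hout p hp (tsupport_fderiv_subset ℝ h)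
  have hA0 : ∀ p : ℝ × ℝ, b < |p.1| → A p = 0 := fun p hp => by simp [hA, hfd0 p hp]
  have hB0 : ∀ p : ℝ × ℝ, b < |p.1| → B p = 0 := fun p hp => by simp [hB, hfd0 p hp]
  -- integrability of the pieces
  have iΦ : ∀ x : L2Rad R, Integrable (fun p : ℝ × ℝ => E p.2 * φ (polarMap p) * x p.1)
      ((radialMeasure R).prod angMeasure) := fun x =>
    integrable_prod_mul (K := fun p => E p.2 * φ (polarMap p)) (C := C) (B := b)
      ((hEc.comp continuous_snd).mul
        (Complex.continuous_ofReal.comp (h1.continuous.comp continuous_polarMap)))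
      (fun p => by rw [norm_mul, hEn, one_mul, Complex.norm_real]; exact hC _)
      (fun p hp => by rw [hφ0 p (hp.trans_le (le_abs_self _))]; simp) x
  have iA : Integrable (fun p : ℝ × ℝ => E p.2 * A p * f p.1)
      ((radialMeasure R).prod angMeasure) :=
    integrable_prod_mul (K := fun p => E p.2 * A p) (C := C') (B := b)
      ((hEc.comp continuous_snd).mul (Complex.continuous_ofReal.comp hAc))
      (fun p => by rw [norm_mul, hEn, one_mul, Complex.norm_real]; exact hAn _)
      (fun p hp => by rw [hA0 p (hp.trans_le (le_abs_self _))]; simp) f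
  have iB : Integrable (fun p : ℝ × ℝ => E p.2 * B p * f p.1)
      ((radialMeasure R).prod angMeasure) :=
    integrable_prod_mul (K := fun p => E p.2 * B p) (C := C') (B := b)
      ((hEc.comp continuous_snd).mul (Complex.continuous_ofReal.comp hBc))
      (fun p => by rw [norm_mul, hEn, one_mul, Complex.norm_real]; exact hBn _)
      (fun p hp => by rw [hB0 p (hp.trans_le (le_abs_self _))]; simp) f
  -- the radial part
  set I₁ : ℝ × ℝ → ℂ := fun p => E p.2 * φ (polarMap p) * g p.1 + E p.2 * A p * f p.1
    + E p.2 * φ (polarMap p) * invR hR f p.1 with hI₁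
  have iI₁ : Integrable I₁ ((radialMeasure R).prod angMeasure) := ((iΦ g).add iA).add (iΦ _)
  have hrad : ∀ t, ∫ r, I₁ (r, t) ∂radialMeasure R = -(R * a * φ (polarMap (R, t)) * E t) := by
    intro t
    have hdΦ : ∀ r, HasDerivAt (fun r => φ (polarMap (r, t))) (A (r, t)) r := fun r =>
      ((h1.differentiable (by simp)) _).hasFDerivAt.comp_hasDerivAt r (hasDerivAt_polarMap_fst r t)
    have hc0 : Continuous fun r => φ (polarMap (r, t)) :=
      h1.continuous.comp (continuous_polarMap.comp (by fun_prop))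
    have hc1 : Continuous fun r => A (r, t) := hAc.comp (by fun_prop)
    have hs0 : HasCompactSupport fun r => φ (polarMap (r, t)) :=
      HasCompactSupport.intro (isCompact_closedBall (0 : ℝ) b) fun r hr =>
        hφ0 (r, t) (by simpa using hr)
    have hs1 : HasCompactSupport fun r => A (r, t) :=
      HasCompactSupport.intro (isCompact_closedBall (0 : ℝ) b) fun r hr =>
        hA0 (r, t) (by simpa using hr)
    have m0 := memLp_ofReal_radial (R := R) hc0 hs0
    have m1 := memLp_ofReal_radial (R := R) hc1 hs1
    have hG : HasRadDeriv (m0.toLp _) (m1.toLp _) (φ (polarMap (R, t)) : ℂ) :=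
      HasRadDeriv.of_isPrim hR
        (IsPrim.of_hasDerivAt (fun r _ => (hdΦ r).ofReal_comp)
          (Complex.continuous_ofReal.comp hc1).continuousOn) m0.coeFn_toLp m1.coeFn_toLp
    have hibp := h.integral_by_parts hR hG
    have k1 := L2.integrable_inner (𝕜 := ℂ) (m0.toLp _) g
    have k2 := L2.integrable_inner (𝕜 := ℂ) (m1.toLp _) f
    have k3 := L2.integrable_inner (𝕜 := ℂ) (m0.toLp _) (invR hR f)
    rw [L2.inner_def, L2.inner_def, L2.inner_def, ← integral_add k1 k2,
      ← integral_add (by exact k1.add k2) k3,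
      Complex.conj_ofReal] at hibp
    rw [show -(R * a * φ (polarMap (R, t)) * E t) = E t * -(R * a * φ (polarMap (R, t))) by ring,
      ← hibp, ← integral_const_mul]
    apply integral_congr_ae
    filter_upwards [m0.coeFn_toLp, m1.coeFn_toLp] with r e0 e1
    rw [e0, e1]
    simp only [RCLike.inner_apply, Complex.conj_ofReal, hI₁]
    ring
  -- the angular part
  set I₂ : ℝ × ℝ → ℂ := fun p => -(s * n + 1) * (E p.2 * φ (polarMap p) * invR hR f p.1)
    + Complex.I * s * (E p.2 * B p * f p.1) with hI₂
  have iI₂ : Integrable I₂ ((radialMeasure R).prod angMeasure) :=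
    ((iΦ _).const_mul _).add (iB.const_mul _)
  have hang : ∀ᵐ r ∂radialMeasure R, ∫ t, I₂ (r, t) ∂angMeasure = 0 := by
    filter_upwards [coeFn_invR hR f, ae_radialMeasure_gt R] with r hr hr2
    have hr0 : (r : ℂ) ≠ 0 := by exact_mod_cast (hR.trans hr2).ne'
    have hEd : ∀ t, HasDerivAt E (E t * ((n + s : ℤ) * Complex.I)) t := fun t => by
      have h4 : HasDerivAt (fun t : ℝ => ((n + s : ℤ) : ℂ) * ((t : ℂ) * Complex.I))
          ((n + s : ℤ) * Complex.I) t := by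
        simpa using (((hasDerivAt_id t).ofReal_comp).mul_const Complex.I).const_mul ((n + s : ℤ) : ℂ)
      exact h4.cexp
    have hdΦ : ∀ t, HasDerivAt (fun t => φ (polarMap (r, t))) (r * B (r, t)) t := fun t => by
      have := HasFDerivAt.comp_hasDerivAt (f := fun t => polarMap (r, t)) t
        ((h1.differentiable (by simp)) _).hasFDerivAt (hasDerivAt_polarMap_snd r t)
      refine this.congr_deriv ?_
      rw [← Complex.real_smul (x := r), map_smul]; rfl
    have hprod := fun t => ((hEd t).mul (hdΦ t).ofReal_comp).const_mul
      (Complex.I * s * ((r : ℂ)⁻¹ * f r))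
    have hFTC := intervalIntegral.integral_eq_sub_of_hasDerivAt (a := -Real.pi) (b := Real.pi)
      (fun t _ => hprod t) (Continuous.intervalIntegrable (by
        have c1 : Continuous fun t => ((r * B (r, t) : ℝ) : ℂ) :=
          Complex.continuous_ofReal.comp (continuous_const.mul (hBc.comp (by fun_prop)))
        have c2 : Continuous fun t => (φ (polarMap (r, t)) : ℂ) :=
          Complex.continuous_ofReal.comp
            (h1.continuous.comp (continuous_polarMap.comp (by fun_prop)))
        exact continuous_const.mul (((hEc.mul continuous_const).mul c2).add (hEc.mul c1))) _ _)
    have hper : E Real.pi = E (-Real.pi) := by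
      simp only [hE]
      rw [Complex.exp_eq_exp_iff_exists_int]
      exact ⟨n + s, by push_cast; ring⟩
    have hper2 : polarMap (r, Real.pi) = polarMap (r, -Real.pi) := by
      rw [polarMap_apply, polarMap_apply, Complex.exp_pi_mul_I, Complex.ofReal_neg, neg_mul,
        Complex.exp_neg, Complex.exp_pi_mul_I]
      norm_num
    simp only [Pi.mul_apply] at hFTC
    rw [hper, hper2, sub_self, intervalIntegral.integral_of_le (by linarith [Real.pi_pos])] at hFTC
    rw [← hFTC]
    apply integral_congr_ae
    filter_upwards with t
    simp only [hI₂, hr]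
    push_cast
    field_simp
    linear_combination (-(E t * φ (polarMap (r, t)) * f r * s * (n + s))) * Complex.I_sq
      + E t * φ (polarMap (r, t)) * f r * hss
  have hmain : (fun p => (φ (polarMap p) : ℂ) * mode (n + s) (g - (s * n : ℂ) • invR hR f) (polarMap p)
        + ((fderiv ℝ φ (polarMap p) (dir 0) : ℂ)
          + s * Complex.I * (fderiv ℝ φ (polarMap p) (dir 1) : ℂ)) * mode n f (polarMap p))
      =ᵐ[(radialMeasure R).prod angMeasure] fun p => (I₁ p + I₂ p) / q := by
    have hsub : ∀ᵐ r ∂radialMeasure R, (g - (s * n : ℂ) • invR hR f : L2Rad R) r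
        = g r - s * n * invR hR f r := by
      filter_upwards [Lp.coeFn_sub g ((s * n : ℂ) • invR hR f),
        Lp.coeFn_smul (s * n : ℂ) (invR hR f)] with r k1 k2
      rw [k1, Pi.sub_apply, k2, Pi.smul_apply, smul_eq_mul]
    filter_upwards [mode_polarMap hR (n + s) (g - (s * n : ℂ) • invR hR f), mode_polarMap hR n f,
      Measure.quasiMeasurePreserving_fst.ae hsub] with p k1 k2 k3
    have hw := wirtinger_polar (Complex.ofRealCLM.comp (fderiv ℝ φ (polarMap p))) p.2 hs
    simp only [ContinuousLinearMap.comp_apply, Complex.ofRealCLM_apply] at hw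
    rw [hw, k1, k2, k3]
    simp only [hI₁, hI₂, hE, hA, hB]
    rw [show ((n + s : ℤ) : ℂ) * (p.2 * Complex.I) = n * (p.2 * Complex.I) + s * (p.2 * Complex.I) by
      push_cast; ring, Complex.exp_add]
    field_simp
    ring
  have hmeas : AEStronglyMeasurable (fun z => (φ z : ℂ)
      * mode (n + s) (g - (s * n : ℂ) • invR hR f) z
        + ((fderiv ℝ φ z (dir 0) : ℂ) + s * Complex.I * (fderiv ℝ φ z (dir 1) : ℂ)) * mode n f z)
      ((volume : Measure ℂ).restrict (diskExt R)) := by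
    have k0 := continuous_fderiv_dir h1 (dir 0)
    have k1 := continuous_fderiv_dir h1 (dir 1)
    have k2 := h1.continuous
    exact ((by fun_prop : Continuous fun z => (φ z : ℂ)).aestronglyMeasurable.mul
      (Lp.aestronglyMeasurable _)).add ((by fun_prop : Continuous fun z =>
        ((fderiv ℝ φ z (dir 0) : ℂ)
          + s * Complex.I * (fderiv ℝ φ z (dir 1) : ℂ))).aestronglyMeasurable.mul
      (Lp.aestronglyMeasurable _))
  rw [integral_diskExt hR hmeas, integral_congr_ae hmain, integral_div, integral_add iI₁ iI₂,
    integral_prod_symm _ iI₁, integral_prod _ iI₂, integral_congr_ae hang]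
  simp only [hrad, integral_zero, add_zero]
  rw [integral_neg, neg_div, integral_div]

end Weak


/-! ### Traces of Fourier modes -/

section Trace

variable {R : ℝ}

instance : IsFiniteMeasure (arcMeasure R) := by
  unfold arcMeasure
  have : IsFiniteMeasure ((volume.restrict (Ioc 0 (2 * Real.pi))).map (circleMap 0 R)) :=
    inferInstance
  exact Measure.smul_finite _ ENNReal.ofReal_ne_top

/-- The arc measure is parametrised over (0, 2π] and `angMeasure` over (-π, π]; periodicity makes up
for the difference. -/
theorem integral_arcMeasure (hR : 0 < R) {F : ℂ → ℂ} (hF : AEStronglyMeasurable F (arcMeasure R)) :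
    ∫ z, F z ∂arcMeasure R = R * ∫ t, F (polarMap (R, t)) ∂angMeasure := by
  have hac : (volume.restrict (Ioc 0 (2 * Real.pi))).map (circleMap 0 R) ≪ arcMeasure R :=
    Measure.absolutelyContinuous_smul (by simpa using hR)
  have hper : Function.Periodic (fun t => F (circleMap 0 R t)) (2 * Real.pi) := fun t => by
    simp only [periodic_circleMap 0 R t]
  have h1 := hper.intervalIntegral_add_eq 0 (-Real.pi)
  rw [zero_add, show -Real.pi + 2 * Real.pi = Real.pi by ring,
    intervalIntegral.integral_of_le (by positivity),
    intervalIntegral.integral_of_le (by linarith [Real.pi_pos])] at h1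
  change _ = R * ∫ t in Ioc (-Real.pi) Real.pi, F (circleMap 0 R t)
  rw [← h1]
  unfold arcMeasure
  rw [integral_smul_measure, integral_map (by fun_prop) (hF.mono_ac hac),
    ENNReal.toReal_ofReal hR.le, Complex.real_smul]

theorem ae_arcMeasure_norm (hR : 0 < R) : ∀ᵐ z ∂arcMeasure R, ‖z‖ = R := by
  unfold arcMeasure
  refine Measure.smul_absolutelyContinuous.ae_le ?_
  refine (ae_map_iff (by fun_prop) (measurableSet_eq_fun (by fun_prop) (by fun_prop))).2 ?_
  filter_upwards with t
  simp [abs_of_pos hR]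

theorem memLp_modeFun_one (n : ℤ) : MemLp (modeFun n fun _ => 1) 2 (arcMeasure R) := by
  refine MemLp.of_bound (C := (Real.sqrt (2 * Real.pi))⁻¹)
    (Measurable.aestronglyMeasurable (by unfold modeFun; fun_prop)) ?_
  filter_upwards with z
  unfold modeFun
  rw [one_mul, norm_div, norm_zpow, Complex.norm_real, Real.norm_eq_abs,
    abs_of_nonneg (Real.sqrt_nonneg _), div_eq_mul_inv]
  refine mul_le_of_le_one_left (by positivity) ?_
  by_cases hz : z = 0
  · subst hz
    by_cases hn : n = 0
    · simp [hn]
    · simp [zero_zpow n hn]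
  · simp [hz]

/-- The `n`-th Fourier mode on the circle. -/
def circMode (R : ℝ) (n : ℤ) : L2Circle R := (memLp_modeFun_one n).toLp _

theorem coeFn_circMode (n : ℤ) : circMode R n =ᵐ[arcMeasure R] modeFun n fun _ => 1 :=
  MemLp.coeFn_toLp _

theorem inner_circMode (hR : 0 < R) (m n : ℤ) :
    ⟪circMode R m, circMode R n⟫_ℂ = if m = n then (R : ℂ) else 0 := by
  have hpi : ((2 * Real.pi : ℝ) : ℂ) ≠ 0 := by exact_mod_cast (by positivity)
  have h1 : ⟪circMode R m, circMode R n⟫_ℂ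
      = ∫ z, starRingEnd ℂ (modeFun m (fun _ => 1) z) * modeFun n (fun _ => 1) z ∂arcMeasure R := by
    rw [L2.inner_def]
    apply integral_congr_ae
    filter_upwards [coeFn_circMode m, coeFn_circMode n] with z h1 h2
    rw [h1, h2, RCLike.inner_apply, mul_comm]
  rw [h1, integral_arcMeasure hR (Measurable.aestronglyMeasurable (by unfold modeFun; fun_prop))]
  have h2 : ∀ t, starRingEnd ℂ (modeFun m (fun _ => 1) (polarMap (R, t)))
      * modeFun n (fun _ => 1) (polarMap (R, t))
      = Complex.exp ((n - m : ℤ) * (t * Complex.I)) / (2 * Real.pi : ℝ) := by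
    intro t
    rw [modeFun_polarMap hR, modeFun_polarMap hR, map_div₀, map_mul, ← Complex.exp_conj]
    simp only [map_mul, Complex.conj_ofReal, Complex.conj_I, map_intCast, map_one, one_mul]
    rw [show (((n - m : ℤ) : ℂ) * (t * Complex.I))
      = n * (t * Complex.I) + m * (t * -Complex.I) by push_cast; ring, Complex.exp_add,
      ← sqrt_two_pi_mul_self]
    field_simp
  simp_rw [h2]
  rw [integral_div, integral_exp_angMeasure]
  by_cases h : m = n
  · rw [if_pos h, if_pos (by omega), div_self hpi, mul_one]
  · rw [if_neg h, if_neg (by omega)]; simp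

/-- The candidate for the weak derivative `∂ⱼ` of a Fourier mode. -/
def modeDeriv (hR : 0 < R) (n : ℤ) (f g : L2Rad R) : Fin 2 → L2Ext R :=
  ![(1 / 2 : ℂ) • (mode (n + 1) (g - (n : ℂ) • invR hR f)
      + mode (n - 1) (g + (n : ℂ) • invR hR f)),
    (-(Complex.I / 2)) • (mode (n + 1) (g - (n : ℂ) • invR hR f)
      - mode (n - 1) (g + (n : ℂ) • invR hR f))]

theorem integral_smul_sub {φ : ℂ → ℝ} (h1 : Continuous φ) (h2 : HasCompactSupport φ)
    (u v : L2Ext R) : ∫ z in diskExt R, φ z • (u - v : L2Ext R) z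
      = (∫ z in diskExt R, φ z • u z) - ∫ z in diskExt R, φ z • v z := by
  have := integral_smul_add h1 h2 (u - v) v
  rw [sub_add_cancel] at this
  rw [this]; ring

/-- The formulas for s = 1 and s = -1 are combined to recover ∂₁ and ∂₂; the same combinations of
e^{it} and e^{-it} give cos t and sin t, the components of the normal up to sign. As φ may be
non-zero on the circle, this one formula provides both the weak derivatives and the trace of a mode.
-/
theorem gauss_green_modeDeriv (hR : 0 < R) {f g : L2Rad R} {a : ℂ} (h : HasRadDeriv f g a) (n : ℤ)
    {φ : ℂ → ℝ} (h1 : ContDiff ℝ ∞ φ) (h2 : HasCompactSupport φ) (j : Fin 2) :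
    ∫ z in diskExt R, (φ z • modeDeriv hR n f g j z + (fderiv ℝ φ z (dir j)) • mode n f z)
      = ∫ z, (φ z * -(coord z j / R)) • (a • circMode R n : L2Circle R) z ∂arcMeasure R := by
  have hq : (Real.sqrt (2 * Real.pi) : ℂ) ≠ 0 := by
    exact_mod_cast (Real.sqrt_pos.2 (by positivity)).ne'
  have hRc : (R : ℂ) ≠ 0 := by exact_mod_cast hR.ne'
  have gg : ∀ (s : ℤ), (s = 1 ∨ s = -1) →
      (∫ z in diskExt R, φ z • mode (n + s) (g - (s * n : ℂ) • invR hR f) z)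
        + ((∫ z in diskExt R, (fderiv ℝ φ z (dir 0)) • mode n f z)
          + s * Complex.I * ∫ z in diskExt R, (fderiv ℝ φ z (dir 1)) • mode n f z)
      = -∫ t, R * a * φ (polarMap (R, t)) * Complex.exp ((n + s : ℤ) * (t * Complex.I))
          / (Real.sqrt (2 * Real.pi) : ℂ) ∂angMeasure := by
    intro s hs
    rw [← gauss_green_mode hR h n hs h1 h2]
    have i0 := integrable_smul_coe (R := R) h1.continuous h2
      (mode (n + s) (g - (s * n : ℂ) • invR hR f))
    have i1 := integrable_smul_coe (R := R) (continuous_fderiv_dir h1 (dir 0))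
      (hasCompactSupport_fderiv_dir h2 _) (mode n f)
    have i2 := integrable_smul_coe (R := R) (continuous_fderiv_dir h1 (dir 1))
      (hasCompactSupport_fderiv_dir h2 _) (mode n f)
    rw [← integral_const_mul, ← integral_add i1 (i2.const_mul _),
      ← integral_add i0 (by exact i1.add (i2.const_mul _))]
    congr 1; ext z
    simp only [Complex.real_smul]
    ring
  have hp := gg 1 (Or.inl rfl)
  have hm := gg (-1) (Or.inr rfl)
  have eT : ∀ s : ℤ, Integrable (fun t : ℝ => R * a * φ (polarMap (R, t))
      * Complex.exp ((n + s : ℤ) * (t * Complex.I)) / (Real.sqrt (2 * Real.pi) : ℂ)) angMeasure := by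
    intro s
    have hc : Continuous fun t : ℝ => R * a * φ (polarMap (R, t))
        * Complex.exp ((n + s : ℤ) * (t * Complex.I)) / (Real.sqrt (2 * Real.pi) : ℂ) := by
      have c2 : Continuous fun t => (φ (polarMap (R, t)) : ℂ) :=
        Complex.continuous_ofReal.comp
          (h1.continuous.comp (continuous_polarMap.comp (by fun_prop)))
      exact ((continuous_const.mul c2).mul (by fun_prop)).div_const _
    exact (hc.integrableOn_Icc (a := -Real.pi) (b := Real.pi)).mono_set Ioc_subset_Icc_self
  have hcoord : ∀ j, Continuous fun z : ℂ => coord z j := fun j => by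
    fin_cases j
    · exact Complex.continuous_re
    · exact Complex.continuous_im
  have hRHS : ∀ j, ∫ z, (φ z * -(coord z j / R)) • (a • circMode R n : L2Circle R) z ∂arcMeasure R
      = R * ∫ t, ((φ (polarMap (R, t)) * -(coord (polarMap (R, t)) j / R) : ℝ) : ℂ)
        * (a * Complex.exp (n * (t * Complex.I)) / (Real.sqrt (2 * Real.pi) : ℂ)) ∂angMeasure := by
    intro j
    have e1 : ∫ z, (φ z * -(coord z j / R)) • (a • circMode R n : L2Circle R) z ∂arcMeasure R
        = ∫ z, ((φ z * -(coord z j / R) : ℝ) : ℂ) * (a * modeFun n (fun _ => 1) z)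
          ∂arcMeasure R := by
      apply integral_congr_ae
      filter_upwards [coeFn_circMode n, Lp.coeFn_smul a (circMode R n)] with z k1 k2
      rw [k2, Pi.smul_apply, k1, Complex.real_smul, smul_eq_mul]
    rw [e1, integral_arcMeasure hR]
    · congr 2; ext t
      rw [modeFun_polarMap hR]; ring
    · refine AEStronglyMeasurable.mul ?_ (Measurable.aestronglyMeasurable (by unfold modeFun; fun_prop))
      exact (Complex.continuous_ofReal.comp (h1.continuous.mul
        ((hcoord j).div_const R).neg)).aestronglyMeasurable
  have hexp : ∀ t : ℝ, Complex.exp ((n + 1 : ℤ) * (t * Complex.I))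
      = Complex.exp (n * (t * Complex.I)) * (Real.cos t + Real.sin t * Complex.I) := fun t => by
    rw [show ((n + 1 : ℤ) : ℂ) * (t * Complex.I) = n * (t * Complex.I) + t * Complex.I by
      push_cast; ring, Complex.exp_add, Complex.exp_mul_I (t : ℂ)]; simp
  have hexm : ∀ t : ℝ, Complex.exp ((n + -1 : ℤ) * (t * Complex.I))
      = Complex.exp (n * (t * Complex.I)) * (Real.cos t - Real.sin t * Complex.I) := fun t => by
    rw [show ((n + -1 : ℤ) : ℂ) * (t * Complex.I) = n * (t * Complex.I) + (-t : ℂ) * Complex.I by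
      push_cast; ring, Complex.exp_add, Complex.exp_mul_I (-t : ℂ)]; simp; ring_nf
  have hre : ∀ t : ℝ, (polarMap (R, t)).re = R * Real.cos t := fun t => by
    rw [polarMap_apply, Complex.exp_mul_I]; simp [Complex.cos_ofReal_re]
  have him : ∀ t : ℝ, (polarMap (R, t)).im = R * Real.sin t := fun t => by
    rw [polarMap_apply, Complex.exp_mul_I]; simp [Complex.sin_ofReal_re]
  have ip := eT 1
  have im := eT (-1)
  simp only [Int.cast_one, one_mul, Int.cast_neg, neg_mul, neg_smul, sub_neg_eq_add] at hp hm
  rw [← sub_eq_add_neg n 1] at hm hexm im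
  have j0 := fun j => integrable_smul_coe (R := R) h1.continuous h2 (modeDeriv hR n f g j)
  have j1 := fun j => integrable_smul_coe (R := R) (continuous_fderiv_dir h1 (dir j))
    (hasCompactSupport_fderiv_dir h2 _) (mode n f)
  rw [integral_add (j0 j) (j1 j), hRHS]
  fin_cases j
  · simp only [Fin.zero_eta, modeDeriv, Matrix.cons_val_zero]
    rw [integral_smul_smul, integral_smul_add h1.continuous h2, ← integral_const_mul]
    have e : ∫ t, (R : ℂ) * (((φ (polarMap (R, t)) * -(coord (polarMap (R, t)) 0 / R) : ℝ) : ℂ)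
        * (a * Complex.exp (n * (t * Complex.I)) / (Real.sqrt (2 * Real.pi) : ℂ))) ∂angMeasure
        = (1 / 2 : ℂ) * (-(∫ t, R * a * φ (polarMap (R, t))
            * Complex.exp ((n + 1 : ℤ) * (t * Complex.I)) / (Real.sqrt (2 * Real.pi) : ℂ) ∂angMeasure)
          - (∫ t, R * a * φ (polarMap (R, t))
            * Complex.exp ((n - 1 : ℤ) * (t * Complex.I)) / (Real.sqrt (2 * Real.pi) : ℂ)
              ∂angMeasure)) := by
      rw [← integral_neg, ← integral_sub (by exact ip.neg) im, ← integral_const_mul]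
      congr 1; ext t
      rw [hexp, hexm]
      simp only [coord, Matrix.cons_val_zero, hre]
      push_cast
      field_simp
      ring
    rw [e]
    linear_combination (1 / 2 : ℂ) * hp + (1 / 2 : ℂ) * hm
  · simp only [Fin.mk_one, modeDeriv, Matrix.cons_val_one, Matrix.cons_val_zero]
    rw [integral_smul_smul, integral_smul_sub h1.continuous h2, ← integral_const_mul]
    have e : ∫ t, (R : ℂ) * (((φ (polarMap (R, t)) * -(coord (polarMap (R, t)) 1 / R) : ℝ) : ℂ)
        * (a * Complex.exp (n * (t * Complex.I)) / (Real.sqrt (2 * Real.pi) : ℂ))) ∂angMeasure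
        = (-(Complex.I / 2) : ℂ) * (-(∫ t, R * a * φ (polarMap (R, t))
            * Complex.exp ((n + 1 : ℤ) * (t * Complex.I)) / (Real.sqrt (2 * Real.pi) : ℂ) ∂angMeasure)
          + (∫ t, R * a * φ (polarMap (R, t))
            * Complex.exp ((n - 1 : ℤ) * (t * Complex.I)) / (Real.sqrt (2 * Real.pi) : ℂ)
              ∂angMeasure)) := by
      rw [← integral_neg, ← integral_add (by exact ip.neg) im, ← integral_const_mul]
      congr 1; ext t
      rw [hexp, hexm]
      simp only [coord, Matrix.cons_val_one, him]
      push_cast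
      field_simp
      linear_combination (-(2 * φ (polarMap (R, t)) * Complex.sin t * a)) * Complex.I_sq
    rw [e]
    linear_combination (-(Complex.I / 2) : ℂ) * (hp - hm)
      + (∫ z in diskExt R, (fderiv ℝ φ z (dir 1)) • mode n f z) * Complex.I_sq

theorem hasWeakDeriv_mode (hR : 0 < R) {f g : L2Rad R} {a : ℂ} (h : HasRadDeriv f g a) (n : ℤ)
    (j : Fin 2) : HasWeakDeriv j (mode n f) (modeDeriv hR n f g j) := by
  intro φ h1 h2 h3
  have := gauss_green_modeDeriv hR h n h1 h2 j
  rw [integral_add (integrable_smul_coe h1.continuous h2 _)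
    (integrable_smul_coe (continuous_fderiv_dir h1 (dir j)) (hasCompactSupport_fderiv_dir h2 _) _)]
    at this
  have h0 : ∫ z, (φ z * -(coord z j / R)) • (a • circMode R n : L2Circle R) z ∂arcMeasure R = 0 := by
    apply integral_eq_zero_of_ae
    filter_upwards [ae_arcMeasure_norm hR] with z hz
    have : φ z = 0 := image_eq_zero_of_notMem_tsupport fun h4 => by
      have h5 : R < ‖z‖ := h3 h4
      linarith
    simp [this]
  rw [h0] at this
  linear_combination this

theorem hasTrace_mode (hR : 0 < R) {f g : L2Rad R} {a : ℂ} (h : HasRadDeriv f g a) (n : ℤ) :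
    HasTrace (mode n f) (a • circMode R n) := by
  intro φ h1 h2 j
  rw [weakDeriv_eq (hasWeakDeriv_mode hR h n j)]
  exact gauss_green_modeDeriv hR h n h1 h2 j

/-- The defining formula determines only the products tνⱼ. Applying it to φxⱼ and summing over j
recovers t, because Σ xⱼνⱼ = -R on the circle. -/
theorem HasTrace.unique (hR : 0 < R) {u : L2Ext R} {t t' : L2Circle R} (h : HasTrace u t)
    (h' : HasTrace u t') : t = t' := by
  rw [← sub_eq_zero]
  apply (Lp.eq_zero_iff_ae_eq_zero).2
  refine ae_eq_zero_of_integral_contDiff_smul_eq_zero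
    ((Lp.memLp _).locallyIntegrable (by norm_num)) fun φ h1 h2 => ?_
  have hcoord : ∀ j, ContDiff ℝ ∞ fun z : ℂ => coord z j := fun j => by
    fin_cases j
    · exact Complex.reCLM.contDiff
    · exact Complex.imCLM.contDiff
  have hInt : ∀ (ρ : ℂ → ℝ) (w : L2Circle R), Continuous ρ → HasCompactSupport ρ →
      Integrable (fun z => ρ z • w z) (arcMeasure R) := fun ρ w c1 c2 => by
    have c3 : MemLp ρ 2 (arcMeasure R) := c1.memLp_of_hasCompactSupport c2
    simpa only [Complex.real_smul] using! (c3.ofReal (K := ℂ)).integrable_mul (Lp.memLp w)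
  have key : ∀ j, ∫ z, (φ z * coord z j * -(coord z j / R)) • (t - t' : L2Circle R) z ∂arcMeasure R
      = 0 := by
    intro j
    have c1 : ContDiff ℝ ∞ fun z => φ z * coord z j := h1.mul (hcoord j)
    have c2 : HasCompactSupport fun z => φ z * coord z j := h2.mul_right
    have c3 : Continuous fun z => φ z * coord z j * -(coord z j / R) :=
      c1.continuous.mul ((hcoord j).continuous.div_const R).neg
    have c4 : HasCompactSupport fun z => φ z * coord z j * -(coord z j / R) := c2.mul_right
    have e := (h _ c1 c2 j).symm.trans (h' _ c1 c2 j)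
    rw [← sub_eq_zero, ← integral_sub (hInt _ t c3 c4) (hInt _ t' c3 c4)] at e
    rw [← e]
    apply integral_congr_ae
    filter_upwards [Lp.coeFn_sub t t'] with z hz
    rw [hz, Pi.sub_apply, smul_sub]
  have c3 : ∀ j, Continuous fun z => φ z * coord z j * -(coord z j / R) := fun j =>
    (h1.mul (hcoord j)).continuous.mul ((hcoord j).continuous.div_const R).neg
  have c4 : ∀ j, HasCompactSupport fun z => φ z * coord z j * -(coord z j / R) := fun j =>
    (h2.mul_right (f' := fun z => coord z j)).mul_right
  have hsum : ∫ z, φ z • (t - t' : L2Circle R) z ∂arcMeasure R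
      = -(R : ℂ)⁻¹ * ((∫ z, (φ z * coord z 0 * -(coord z 0 / R)) • (t - t' : L2Circle R) z ∂arcMeasure R)
        + ∫ z, (φ z * coord z 1 * -(coord z 1 / R)) • (t - t' : L2Circle R) z ∂arcMeasure R) := by
    rw [← integral_add (hInt _ _ (c3 0) (c4 0)) (hInt _ _ (c3 1) (c4 1)), ← integral_const_mul]
    apply integral_congr_ae
    filter_upwards [ae_arcMeasure_norm hR] with z hz
    have hz2 : z.re * z.re + z.im * z.im = R ^ 2 := by
      rw [← hz, ← Complex.normSq_apply, Complex.normSq_eq_norm_sq]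
    have hz3 : (z.re : ℂ) * z.re + z.im * z.im = R ^ 2 := by exact_mod_cast hz2
    have hRc : (R : ℂ) ≠ 0 := by exact_mod_cast hR.ne'
    simp only [coord, Matrix.cons_val_zero, Matrix.cons_val_one, Complex.real_smul]
    push_cast
    field_simp
    linear_combination (-(φ z : ℂ) * ((t - t' : L2Circle R) z)) * hz3
  rw [hsum, key, key]; simp

theorem trace_eq (hR : 0 < R) {u : L2Ext R} {t : L2Circle R} (h : HasTrace u t) : trace u = t := by
  have hex : ∃ t, HasTrace u t := ⟨t, h⟩
  unfold trace
  rw [dif_pos hex]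
  exact hex.choose_spec.unique hR h

end Trace


/-! ### Wirtinger derivatives and the decomposition into Fourier modes -/

section Wirtinger

variable {R : ℝ}

/-- The function has weak partial derivatives in `L²`. -/
def IsH1 (u : L2Ext R) : Prop := ∀ j : Fin 2, ∃ g, HasWeakDeriv j u g

/-- The Wirtinger-type derivative `∂₁u + i s ∂₂u`. -/
def wirt (s : ℤ) (u : L2Ext R) : L2Ext R := weakDeriv 0 u + (s * Complex.I) • weakDeriv 1 u

/-- The two signs. -/
def signs : Finset ℤ := {1, -1}

theorem mem_signs {s : ℤ} : s ∈ signs ↔ s = 1 ∨ s = -1 := by simp [signs]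

theorem sum_signs {M : Type*} [AddCommMonoid M] (F : ℤ → M) : ∑ s ∈ signs, F s = F 1 + F (-1) :=
  Finset.sum_pair (by norm_num)

theorem IsH1.hasWeakDeriv {u : L2Ext R} (h : IsH1 u) (j : Fin 2) :
    HasWeakDeriv j u (weakDeriv j u) := hasWeakDeriv_weakDeriv (h j)

theorem IsH1.add {u v : L2Ext R} (hu : IsH1 u) (hv : IsH1 v) : IsH1 (u + v) := fun j =>
  ⟨_, (hu.hasWeakDeriv j).add (hv.hasWeakDeriv j)⟩

theorem IsH1.smul {u : L2Ext R} (hu : IsH1 u) (c : ℂ) : IsH1 (c • u) := fun j =>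
  ⟨_, (hu.hasWeakDeriv j).smul c⟩

theorem weakDeriv_add {u v : L2Ext R} (hu : IsH1 u) (hv : IsH1 v) (j : Fin 2) :
    weakDeriv j (u + v) = weakDeriv j u + weakDeriv j v :=
  weakDeriv_eq ((hu.hasWeakDeriv j).add (hv.hasWeakDeriv j))

theorem weakDeriv_smul {u : L2Ext R} (hu : IsH1 u) (c : ℂ) (j : Fin 2) :
    weakDeriv j (c • u) = c • weakDeriv j u :=
  weakDeriv_eq ((hu.hasWeakDeriv j).smul c)

theorem wirt_add {u v : L2Ext R} (hu : IsH1 u) (hv : IsH1 v) (s : ℤ) :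
    wirt s (u + v) = wirt s u + wirt s v := by
  unfold wirt
  rw [weakDeriv_add hu hv, weakDeriv_add hu hv, smul_add]
  abel

theorem wirt_smul {u : L2Ext R} (hu : IsH1 u) (c : ℂ) (s : ℤ) : wirt s (c • u) = c • wirt s u := by
  unfold wirt
  rw [weakDeriv_smul hu, weakDeriv_smul hu, smul_add, smul_comm c]

theorem weakDeriv_zero_eq (u : L2Ext R) :
    weakDeriv 0 u = (1 / 2 : ℂ) • wirt 1 u + (1 / 2 : ℂ) • wirt (-1) u := by
  unfold wirt
  push_cast
  module

theorem weakDeriv_one_eq (u : L2Ext R) :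
    weakDeriv 1 u = (-(Complex.I / 2)) • wirt 1 u + (Complex.I / 2) • wirt (-1) u := by
  unfold wirt
  push_cast
  match_scalars
  · linear_combination Complex.I_sq
  · ring

theorem isH1_mode (hR : 0 < R) {f g : L2Rad R} {a : ℂ} (h : HasRadDeriv f g a) (n : ℤ) :
    IsH1 (mode n f) := fun j => ⟨_, hasWeakDeriv_mode hR h n j⟩

theorem wirt_mode (hR : 0 < R) {f g : L2Rad R} {a : ℂ} (h : HasRadDeriv f g a) (n : ℤ) {s : ℤ}
    (hs : s = 1 ∨ s = -1) :
    wirt s (mode n f) = mode (n + s) (g - (s * n : ℂ) • invR hR f) := by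
  unfold wirt
  rw [weakDeriv_eq (hasWeakDeriv_mode hR h n 0), weakDeriv_eq (hasWeakDeriv_mode hR h n 1)]
  simp only [modeDeriv, Matrix.cons_val_zero, Matrix.cons_val_one]
  rcases hs with rfl | rfl
  · simp only [Int.cast_one, one_mul]
    match_scalars
    · linear_combination (-(1 / 2) : ℂ) * Complex.I_sq
    · linear_combination (1 / 2 : ℂ) * Complex.I_sq
  · simp only [Int.cast_neg, Int.cast_one, neg_mul, one_mul, neg_smul, sub_neg_eq_add,
      ← sub_eq_add_neg]
    match_scalars
    · linear_combination (1 / 2 : ℂ) * Complex.I_sq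
    · linear_combination (-(1 / 2) : ℂ) * Complex.I_sq

theorem WeakRadDeriv.unique (hR : 0 < R) {f g g' : L2Rad R} (h : WeakRadDeriv f g)
    (h' : WeakRadDeriv f g') : g = g' := by
  rw [← sub_eq_zero]
  apply (Lp.eq_zero_iff_ae_eq_zero).2
  refine (ae_radialMeasure_iff hR).2 ((ae_restrict_iff' measurableSet_Ioi).2 ?_)
  refine isOpen_Ioi.ae_eq_zero_of_integral_contDiff_smul_eq_zero
    (locallyIntegrableOn_coe hR _) fun ψ h1 h2 h3 => ?_
  have hψ : IsTest R ψ := ⟨h1, h2, h3⟩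
  have hs : ∫ r, ψ r • (g - g' : L2Rad R) r = ∫ r in Ioi R, ψ r • (g - g' : L2Rad R) r := by
    rw [setIntegral_eq_integral_of_forall_compl_eq_zero]
    intro x hx
    rw [image_eq_zero_of_notMem_tsupport fun h4 => hx (h3 h4), zero_smul]
  rw [hs, ← hψ.inner_toRad_div hR, inner_sub_right, hψ.inner_toRad_div hR, hψ.inner_toRad_div hR,
    sub_eq_zero]
  exact neg_injective ((h ψ hψ).symm.trans (h' ψ hψ))

/-- Both signs express the weak derivative of the same coefficient, so uniqueness makes the two
expressions equal and a single g serves both. -/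
theorem IsH1.exists_hasRadDeriv (hR : 0 < R) {u : L2Ext R} (hu : IsH1 u) (n : ℤ) :
    ∃ g a, HasRadDeriv (coef hR n u) g a ∧ ∀ s, (s = 1 ∨ s = -1) →
      g = coef hR (n + s) (wirt s u) + (s * n : ℂ) • invR hR (coef hR n u) := by
  have h := fun s hs => weakRadDeriv_coef hR (hu.hasWeakDeriv 0) (hu.hasWeakDeriv 1) n (s := s) hs
  obtain ⟨a, ha⟩ := (h 1 (Or.inl rfl)).exists hR
  exact ⟨_, a, ha, fun s hs => (h 1 (Or.inl rfl)).unique hR (h s hs)⟩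

/-- The orthogonal projection onto the `n`-th Fourier mode. -/
def proj (hR : 0 < R) (n : ℤ) (u : L2Ext R) : L2Ext R := mode n (coef hR n u)

theorem IsH1.proj {hR : 0 < R} {u : L2Ext R} (hu : IsH1 u) (n : ℤ) : IsH1 (proj hR n u) := by
  obtain ⟨g, a, h, -⟩ := hu.exists_hasRadDeriv hR n
  exact isH1_mode hR h n

/-- This is why ∂₁ ± i∂₂ are preferred to the partial derivatives, which mix the modes n - 1 and n +
1: here a projection is carried to a projection with shifted index. -/
theorem wirt_proj (hR : 0 < R) {u : L2Ext R} (hu : IsH1 u) (n : ℤ) {s : ℤ}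
    (hs : s = 1 ∨ s = -1) : wirt s (proj hR n u) = proj hR (n + s) (wirt s u) := by
  obtain ⟨g, a, h, hg⟩ := hu.exists_hasRadDeriv hR n
  unfold proj
  rw [wirt_mode hR h n hs, hg s hs, add_sub_cancel_right]

theorem inner_proj (hR : 0 < R) (n : ℤ) (u v : L2Ext R) :
    ⟪proj hR n v, u⟫_ℂ = ⟪v, proj hR n u⟫_ℂ := by
  unfold proj
  rw [← inner_coef_right, ← inner_coef_left]

theorem mem_H2_iff {u : L2Ext R} :
    u ∈ H2 R ↔ IsH1 u ∧ ∀ s, (s = 1 ∨ s = -1) → IsH1 (wirt s u) := by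
  constructor
  · intro h
    have h1 : ∀ j, IsH1 (weakDeriv j u) := fun j => (h j).2
    exact ⟨fun j => (h j).1, fun s _ => (h1 0).add ((h1 1).smul _)⟩
  · rintro ⟨h1, h2⟩ j
    refine ⟨h1 j, ?_⟩
    have hp := h2 1 (Or.inl rfl)
    have hm := h2 (-1) (Or.inr rfl)
    fin_cases j
    · change IsH1 (weakDeriv 0 u)
      rw [weakDeriv_zero_eq]
      exact (hp.smul _).add (hm.smul _)
    · change IsH1 (weakDeriv 1 u)
      rw [weakDeriv_one_eq]
      exact (hp.smul _).add (hm.smul _)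

theorem H2_add {u v : L2Ext R} (hu : u ∈ H2 R) (hv : v ∈ H2 R) : u + v ∈ H2 R := by
  rw [mem_H2_iff] at *
  refine ⟨hu.1.add hv.1, fun s hs => ?_⟩
  rw [wirt_add hu.1 hv.1]
  exact (hu.2 s hs).add (hv.2 s hs)

theorem H2_smul {u : L2Ext R} (hu : u ∈ H2 R) (c : ℂ) : c • u ∈ H2 R := by
  rw [mem_H2_iff] at *
  refine ⟨hu.1.smul c, fun s hs => ?_⟩
  rw [wirt_smul hu.1]
  exact (hu.2 s hs).smul c

theorem H2_proj (hR : 0 < R) {u : L2Ext R} (hu : u ∈ H2 R) (n : ℤ) : proj hR n u ∈ H2 R := by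
  rw [mem_H2_iff] at *
  refine ⟨hu.1.proj n, fun s hs => ?_⟩
  rw [wirt_proj hR hu.1 n hs]
  exact (hu.2 s hs).proj _

/-- The functions in `L²((R, ∞); r dr)` with two weak derivatives. -/
structure RadH2 (f f₁ f₂ : L2Rad R) (a b : ℂ) : Prop where
  fst : HasRadDeriv f f₁ a
  snd : HasRadDeriv f₁ f₂ b

theorem HasRadDeriv.wirt (hR : 0 < R) {f f₁ f₂ : L2Rad R} {a b : ℂ} (h : RadH2 f f₁ f₂ a b)
    (c : ℂ) : HasRadDeriv (f₁ - c • RobinBilaplacian.invR hR f)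
      (f₂ - c • (RobinBilaplacian.invR hR f₁
        - RobinBilaplacian.invR hR (RobinBilaplacian.invR hR f))) (b - c * ((R : ℂ)⁻¹ * a)) := by
  have := h.snd.add hR ((h.fst.invR hR).smul hR (-c))
  simpa only [neg_smul, neg_mul, ← sub_eq_add_neg] using this

theorem RadH2.mode_mem (hR : 0 < R) {f f₁ f₂ : L2Rad R} {a b : ℂ} (h : RadH2 f f₁ f₂ a b)
    (n : ℤ) : mode n f ∈ H2 R := by
  rw [mem_H2_iff]
  refine ⟨isH1_mode hR h.fst n, fun s hs => ?_⟩
  rw [wirt_mode hR h.fst n hs]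
  exact isH1_mode hR (HasRadDeriv.wirt hR h _) _

theorem exists_radH2 (hR : 0 < R) {u : L2Ext R} (hu : u ∈ H2 R) (n : ℤ) :
    ∃ f₁ f₂ a b, RadH2 (coef hR n u) f₁ f₂ a b := by
  rw [mem_H2_iff] at hu
  obtain ⟨f₁, a, h, hf₁⟩ := hu.1.exists_hasRadDeriv hR n
  obtain ⟨k, c, hk, -⟩ := (hu.2 1 (Or.inl rfl)).exists_hasRadDeriv hR (n + 1)
  -- By `hf₁` the derivative f₁ is the coefficient n + 1 of `wirt 1 u` plus n f/r, and both summands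
  -- are weakly differentiable.
  have h2 := hk.add hR ((h.invR hR).smul hR ((1 : ℤ) * n : ℂ))
  rw [← hf₁ 1 (Or.inl rfl)] at h2
  exact ⟨f₁, _, a, _, h, h2⟩

/-- The condition on the right does not involve n: all fiber forms share one domain and can be
compared on the same function. -/
theorem mem_fiberDom_iff (hR : 0 < R) {n : ℤ} {f : L2Rad R} :
    f ∈ fiberDom R n ↔ ∃ f₁ f₂ a b, RadH2 f f₁ f₂ a b := by
  constructor
  · intro h
    have := exists_radH2 hR h n
    rwa [coef_mode, if_pos rfl] at this
  · rintro ⟨f₁, f₂, a, b, h⟩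
    exact h.mode_mem hR n

theorem coef_mem_fiberDom (hR : 0 < R) {u : L2Ext R} (hu : u ∈ H2 R) (n : ℤ) :
    coef hR n u ∈ fiberDom R n := (mem_fiberDom_iff hR).2 (exists_radH2 hR hu n)

/-! ### The form in terms of Wirtinger derivatives -/

/-- The mixed terms carry the factor s and cancel in the sum over s = ±1. -/
theorem sum_inner_weakDeriv (u v : L2Ext R) :
    ∑ j, ⟪weakDeriv j v, weakDeriv j u⟫_ℂ
      = (1 / 2 : ℂ) * ∑ s ∈ signs, ⟪wirt s v, wirt s u⟫_ℂ := by
  rw [Fin.sum_univ_two, sum_signs]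
  unfold wirt
  simp only [inner_add_left, inner_add_right, inner_smul_left, inner_smul_right, map_mul,
    map_intCast, Complex.conj_I]
  push_cast
  linear_combination ⟪weakDeriv 1 v, weakDeriv 1 u⟫_ℂ * Complex.I_sq

/-- The identity `sum_inner_weakDeriv` is used for each of the two derivatives in the second-order
part, whence the factor 1/4 there and 1/2 in the gradient part. -/
theorem form_eq {τ γ : ℝ} {u v : L2Ext R} (hu : u ∈ H2 R) (hv : v ∈ H2 R) :
    form τ γ u v = (1 / 4 : ℂ) * ∑ s ∈ signs, ∑ s' ∈ signs,
        ⟪wirt s' (wirt s v), wirt s' (wirt s u)⟫_ℂ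
      + τ * ((1 / 2 : ℂ) * ∑ s ∈ signs, ⟪wirt s v, wirt s u⟫_ℂ)
      + γ * ⟪trace v, trace u⟫_ℂ := by
  unfold form
  congr 2
  swap
  · rw [sum_inner_weakDeriv]
  simp_rw [sum_inner_weakDeriv]
  rw [Fin.sum_univ_two]
  have hw : ∀ (w : L2Ext R), w ∈ H2 R → ∀ s s' : ℤ, wirt s' (wirt s w)
      = wirt s' (weakDeriv 0 w) + (s * Complex.I) • wirt s' (weakDeriv 1 w) := by
    intro w hw s s'
    have h1 : ∀ j, IsH1 (weakDeriv j w) := fun j => (hw j).2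
    unfold wirt
    rw [weakDeriv_add (h1 0) ((h1 1).smul _), weakDeriv_add (h1 0) ((h1 1).smul _),
      weakDeriv_smul (h1 1), weakDeriv_smul (h1 1)]
    module
  simp only [sum_signs, hw u hu, hw v hv]
  simp only [inner_add_left, inner_add_right, inner_smul_left, inner_smul_right, map_mul,
    map_intCast, Complex.conj_I]
  push_cast
  linear_combination (1 / 2 : ℂ) * (⟪wirt 1 (weakDeriv 1 v), wirt 1 (weakDeriv 1 u)⟫_ℂ
    + ⟪wirt (-1) (weakDeriv 1 v), wirt (-1) (weakDeriv 1 u)⟫_ℂ) * Complex.I_sq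

end Wirtinger


section TraceExistence

variable {R : ℝ}

/-! ### Existence of the trace -/

theorem hasSum_int_add {E : Type*} [AddCommMonoid E] [TopologicalSpace E] {F : ℤ → E} {a : E}
    (h : HasSum F a) (k : ℤ) : HasSum (fun n => F (n + k)) a :=
  (Equiv.hasSum_iff (f := F) (Equiv.addRight k)).2 h

theorem orthogonalFamily_modeL (hR : 0 < R) :
    OrthogonalFamily ℂ (fun _ : ℤ => L2Rad R) (modeL hR) := by
  intro m n hmn f g
  rw [modeL_apply, modeL_apply, inner_mode_mode hR, if_neg hmn]

theorem isHilbertSum_modeL (hR : 0 < R) : IsHilbertSum ℂ (fun _ : ℤ => L2Rad R) (modeL hR) := by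
  refine IsHilbertSum.mk (orthogonalFamily_modeL hR) ?_
  rw [top_le_iff, Submodule.topologicalClosure_eq_top_iff, Submodule.eq_bot_iff]
  intro u hu
  refine eq_zero_of_coef hR u fun n => ext_inner_left ℂ fun f => ?_
  rw [inner_coef_right, inner_zero_right]
  exact (Submodule.mem_orthogonal _ u).1 hu _
    (Submodule.mem_iSup_of_mem n ⟨f, rfl⟩)

theorem hasSum_proj (hR : 0 < R) (u : L2Ext R) : HasSum (fun n => proj hR n u) u := by
  have hV := isHilbertSum_modeL hR
  have h1 := hV.hasSum_linearIsometryEquiv_symm (hV.linearIsometryEquiv u)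
  rw [LinearIsometryEquiv.symm_apply_apply] at h1
  have h2 : ∀ n, hV.linearIsometryEquiv u n = coef hR n u := by
    intro n
    have h3 := h1.mapL (coef hR n)
    refine HasSum.unique ?_ h3
    have h4 : ∀ m, coef hR n (modeL hR m (hV.linearIsometryEquiv u m))
        = if n = m then hV.linearIsometryEquiv u m else 0 := fun m => coef_mode hR n m _
    simp_rw [h4]
    convert hasSum_single n (f := fun m => if n = m then hV.linearIsometryEquiv u m else 0)
      (fun m hm => if_neg (Ne.symm hm)) using 1
    simp
  simp_rw [h2] at h1
  exact h1

theorem summable_norm_coef_sq (hR : 0 < R) (u : L2Ext R) :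
    Summable fun n => ‖coef hR n u‖ ^ 2 :=
  ((orthogonalFamily_modeL hR).summable_iff_norm_sq_summable _).1 (hasSum_proj hR u).summable

theorem hasSum_proj_add (hR : 0 < R) (u : L2Ext R) (k : ℤ) :
    HasSum (fun n => proj hR (n + k) u) u :=
  hasSum_int_add (F := fun n => proj hR n u) (hasSum_proj hR u) k

/-- Weak differentiation is not continuous on L². The Fourier series may still be differentiated
termwise, because `wirt_proj` turns the differentiated terms into shifted projections of `wirt 1 u`
and `wirt (-1) u`. -/
theorem hasSum_weakDeriv_proj (hR : 0 < R) {u : L2Ext R} (hu : IsH1 u) (j : Fin 2) :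
    HasSum (fun n => weakDeriv j (proj hR n u)) (weakDeriv j u) := by
  have hp := hasSum_proj_add hR (wirt 1 u) 1
  have hm := hasSum_proj_add hR (wirt (-1) u) (-1)
  fin_cases j
  · simp only [Fin.zero_eta, weakDeriv_zero_eq, wirt_proj hR hu _ (Or.inl rfl),
      wirt_proj hR hu _ (Or.inr rfl)]
    exact (hp.const_smul _).add (hm.const_smul _)
  · simp only [Fin.mk_one, weakDeriv_one_eq, wirt_proj hR hu _ (Or.inl rfl),
      wirt_proj hR hu _ (Or.inr rfl)]
    exact (hp.const_smul _).add (hm.const_smul _)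

theorem orthonormal_circMode (hR : 0 < R) :
    Orthonormal ℂ fun n : ℤ => ((Real.sqrt R : ℝ) : ℂ)⁻¹ • circMode R n := by
  have hs : ((Real.sqrt R : ℝ) : ℂ) ≠ 0 := by exact_mod_cast (Real.sqrt_pos.2 hR).ne'
  have hsq : ((Real.sqrt R : ℝ) : ℂ) * (Real.sqrt R : ℝ) = R := by
    exact_mod_cast Real.mul_self_sqrt hR.le
  rw [orthonormal_iff_ite]
  intro m n
  rw [inner_smul_left, inner_smul_right, inner_circMode hR, map_inv₀, Complex.conj_ofReal]
  split_ifs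
  · rw [← hsq]; field_simp
  · simp

theorem summable_smul_circMode (hR : 0 < R) {a : ℤ → ℂ} (ha : Summable fun n => ‖a n‖ ^ 2) :
    Summable fun n => a n • circMode R n := by
  have hs : ((Real.sqrt R : ℝ) : ℂ) ≠ 0 := by exact_mod_cast (Real.sqrt_pos.2 hR).ne'
  have h := ((orthonormal_circMode hR).orthogonalFamily.summable_iff_norm_sq_summable
    (fun n => ((Real.sqrt R : ℝ) : ℂ) * a n)).2 (by
      simp_rw [norm_mul, mul_pow]
      exact ha.mul_left _)
  refine h.congr fun n => ?_
  rw [LinearIsometry.toSpanSingleton_apply, smul_smul]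
  congr 1
  field_simp

/-- The boundary values of the Fourier coefficients are square summable by
`HasRadDeriv.boundary_le`, so they define an element of L² of the circle. The Gauss-Green formula
holds for each mode, and all its terms are continuous under the L² convergence of the series. -/
theorem IsH1.exists_trace (hR : 0 < R) {u : L2Ext R} (hu : IsH1 u) :
    ∃ a : ℤ → ℂ, (∀ n, ∃ g, HasRadDeriv (coef hR n u) g (a n)) ∧
      ∃ t, HasTrace u t ∧ HasSum (fun n => a n • circMode R n) t := by
  choose g a hga hg using hu.exists_hasRadDeriv hR
  refine ⟨a, fun n => ⟨g n, hga n⟩, ?_⟩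
  -- Averaging over s = ±1 cancels the terms ± n f/r, whose factor n would spoil the summability.
  have hgn : ∀ n, g n = (1 / 2 : ℂ) • coef hR (n + 1) (wirt 1 u)
      + (1 / 2 : ℂ) • coef hR (n + -1) (wirt (-1) u) := by
    intro n
    have h1 := hg n 1 (Or.inl rfl)
    have h2 := hg n (-1) (Or.inr rfl)
    have h3 : g n = (1 / 2 : ℂ) • g n + (1 / 2 : ℂ) • g n := by module
    rw [h3]
    nth_rewrite 1 [h1]
    rw [h2]
    push_cast
    module
  have hsum : Summable fun n => ‖a n‖ ^ 2 := by
    have s0 := summable_norm_coef_sq hR u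
    have s1 : Summable fun n => ‖coef hR (n + 1) (wirt 1 u)‖ ^ 2 :=
      (hasSum_int_add (F := fun n => ‖coef hR n (wirt 1 u)‖ ^ 2)
        (summable_norm_coef_sq hR (wirt 1 u)).hasSum 1).summable
    have s2 : Summable fun n => ‖coef hR (n + -1) (wirt (-1) u)‖ ^ 2 :=
      (hasSum_int_add (F := fun n => ‖coef hR n (wirt (-1) u)‖ ^ 2)
        (summable_norm_coef_sq hR (wirt (-1) u)).hasSum (-1)).summable
    refine Summable.of_nonneg_of_le (fun n => by positivity) (fun n => ?_)
      (((s0.add (s1.add s2))).mul_left R⁻¹)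
    have h1 := (hga n).boundary_le hR
    have h2 : ‖g n‖ ≤ 1 / 2 * ‖coef hR (n + 1) (wirt 1 u)‖
        + 1 / 2 * ‖coef hR (n + -1) (wirt (-1) u)‖ := by
      rw [hgn n]
      refine (norm_add_le _ _).trans (le_of_eq ?_)
      rw [norm_smul, norm_smul]; norm_num
    rw [inv_mul_eq_div, le_div_iff₀ hR]
    have n0 := norm_nonneg (g n)
    nlinarith [sq_nonneg (‖g n‖ - ‖coef hR n u‖), sq_nonneg (‖coef hR (n + 1) (wirt 1 u)‖
      - ‖coef hR (n + -1) (wirt (-1) u)‖), mul_self_le_mul_self n0 h2]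
  have hS := (summable_smul_circMode hR hsum).hasSum
  refine ⟨_, ?_, hS⟩
  intro φ h1 h2 j
  have hL2 : ∀ {φ : ℂ → ℝ} (c1 : Continuous φ) (c2 : HasCompactSupport φ) (w : ℤ → L2Ext R)
      (W : L2Ext R), HasSum w W →
      HasSum (fun n => ∫ z in diskExt R, φ z • w n z) (∫ z in diskExt R, φ z • W z) := by
    intro φ c1 c2 w W hw
    have m : MemLp (fun z => (φ z : ℂ)) 2 ((volume : Measure ℂ).restrict (diskExt R)) :=
      (memLp_of_compact c1 c2).ofReal
    have e : ∀ v : L2Ext R, ∫ z in diskExt R, φ z • v z = ⟪m.toLp _, v⟫_ℂ := fun v => by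
      rw [L2.inner_def]
      apply integral_congr_ae
      filter_upwards [m.coeFn_toLp] with z hz
      rw [hz, RCLike.inner_apply, Complex.conj_ofReal, Complex.real_smul, mul_comm]
    simp_rw [e]
    exact hw.mapL (innerSL ℂ (m.toLp _))
  have hcoord : Continuous fun z : ℂ => coord z j := by
    fin_cases j
    · exact Complex.continuous_re
    · exact Complex.continuous_im
  have hC : HasSum (fun n => ∫ z, (φ z * -(coord z j / R)) • (a n • circMode R n : L2Circle R) z
      ∂arcMeasure R) (∫ z, (φ z * -(coord z j / R)) • (∑' n, a n • circMode R n : L2Circle R) z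
      ∂arcMeasure R) := by
    have m0 : MemLp (fun z => φ z * -(coord z j / R)) 2 (arcMeasure R) :=
      (h1.continuous.mul (hcoord.div_const R).neg).memLp_of_hasCompactSupport h2.mul_right
    have m : MemLp (fun z => ((φ z * -(coord z j / R) : ℝ) : ℂ)) 2 (arcMeasure R) := m0.ofReal
    have e : ∀ v : L2Circle R, ∫ z, (φ z * -(coord z j / R)) • v z ∂arcMeasure R
        = ⟪m.toLp _, v⟫_ℂ := fun v => by
      rw [L2.inner_def]
      apply integral_congr_ae
      filter_upwards [m.coeFn_toLp] with z hz
      rw [hz, RCLike.inner_apply, Complex.conj_ofReal, Complex.real_smul, mul_comm]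
    simp_rw [e]
    exact hS.mapL (innerSL ℂ (m.toLp _))
  have hA := hL2 h1.continuous h2 _ _ (hasSum_weakDeriv_proj hR hu j)
  have hB := hL2 (continuous_fderiv_dir h1 (dir j)) (hasCompactSupport_fderiv_dir h2 _) _ _
    (hasSum_proj hR u)
  have key : ∀ n, (∫ z in diskExt R, φ z • weakDeriv j (RobinBilaplacian.proj hR n u) z)
      + (∫ z in diskExt R, (fderiv ℝ φ z (dir j)) • RobinBilaplacian.proj hR n u z)
      = ∫ z, (φ z * -(coord z j / R)) • (a n • circMode R n : L2Circle R) z ∂arcMeasure R := by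
    intro n
    rw [← hasTrace_mode hR (hga n) n φ h1 h2 j, ← integral_add
      (integrable_smul_coe h1.continuous h2 _)
      (integrable_smul_coe (continuous_fderiv_dir h1 (dir j)) (hasCompactSupport_fderiv_dir h2 _) _)]
    rfl
  have hAB := hA.add hB
  simp_rw [key] at hAB
  rw [integral_add (integrable_smul_coe h1.continuous h2 _)
    (integrable_smul_coe (continuous_fderiv_dir h1 (dir j)) (hasCompactSupport_fderiv_dir h2 _) _)]
  exact hAB.unique hC

theorem IsH1.hasTrace (hR : 0 < R) {u : L2Ext R} (hu : IsH1 u) : HasTrace u (trace u) := by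
  obtain ⟨a, -, t, ht, -⟩ := hu.exists_trace hR
  rwa [trace_eq hR ht]

theorem trace_mode (hR : 0 < R) {f g : L2Rad R} {a : ℂ} (h : HasRadDeriv f g a) (n : ℤ) :
    trace (mode n f) = a • circMode R n := trace_eq hR (hasTrace_mode hR h n)

theorem trace_proj (hR : 0 < R) {u : L2Ext R} (hu : IsH1 u) (n : ℤ) :
    ∃ a : ℂ, trace (proj hR n u) = a • circMode R n ∧ ⟪circMode R n, trace u⟫_ℂ = a * R := by
  obtain ⟨a, hga, t, ht, hS⟩ := hu.exists_trace hR
  obtain ⟨g, hg⟩ := hga n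
  refine ⟨a n, trace_mode hR hg n, ?_⟩
  rw [trace_eq hR ht]
  have h1 : HasSum (fun m => ⟪circMode R n, a m • circMode R m⟫_ℂ) ⟪circMode R n, t⟫_ℂ :=
    hS.mapL (innerSL ℂ (circMode R n))
  simp only [inner_smul_right, inner_circMode hR] at h1
  refine h1.unique ?_
  convert hasSum_single n (f := fun m => a m * if n = m then (R : ℂ) else 0)
    (fun m hm => by rw [if_neg (Ne.symm hm), mul_zero]) using 1
  simp

theorem inner_trace_proj (hR : 0 < R) {u v : L2Ext R} (hu : IsH1 u) (hv : IsH1 v) (n : ℤ) :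
    ⟪trace v, trace (proj hR n u)⟫_ℂ = ⟪trace (proj hR n v), trace u⟫_ℂ := by
  obtain ⟨a, h1, h2⟩ := trace_proj hR hu n
  obtain ⟨b, h3, h4⟩ := trace_proj hR hv n
  rw [h1, h3, inner_smul_left, inner_smul_right, h2, ← inner_conj_symm, h4, map_mul,
    Complex.conj_ofReal]
  ring

theorem trace_add (hR : 0 < R) {u v : L2Ext R} (hu : IsH1 u) (hv : IsH1 v) :
    trace (u + v) = trace u + trace v := by
  refine trace_eq hR fun φ h1 h2 j => ?_
  have hcoord : Continuous fun z : ℂ => coord z j := by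
    fin_cases j
    · exact Complex.continuous_re
    · exact Complex.continuous_im
  have m0 : MemLp (fun z => φ z * -(coord z j / R)) 2 (arcMeasure R) :=
    (h1.continuous.mul (hcoord.div_const R).neg).memLp_of_hasCompactSupport h2.mul_right
  have hInt : ∀ w : L2Circle R, Integrable (fun z => (φ z * -(coord z j / R)) • w z)
      (arcMeasure R) := fun w => by
    simpa only [Complex.real_smul] using! (m0.ofReal (K := ℂ)).integrable_mul (Lp.memLp w)
  have k1 := continuous_fderiv_dir h1 (dir j)
  have k2 := hasCompactSupport_fderiv_dir h2 (dir j)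
  have hs : ∀ w : L2Ext R, ∫ z in diskExt R, (φ z • weakDeriv j w z + (fderiv ℝ φ z (dir j)) • w z)
      = (∫ z in diskExt R, φ z • weakDeriv j w z) + ∫ z in diskExt R, (fderiv ℝ φ z (dir j)) • w z :=
    fun w => integral_add (integrable_smul_coe h1.continuous h2 _) (integrable_smul_coe k1 k2 _)
  have eu := hu.hasTrace hR φ h1 h2 j
  have ev := hv.hasTrace hR φ h1 h2 j
  rw [hs] at eu ev ⊢
  rw [weakDeriv_add hu hv, integral_smul_add h1.continuous h2, integral_smul_add k1 k2]
  have e : ∫ z, (φ z * -(coord z j / R)) • (trace u + trace v : L2Circle R) z ∂arcMeasure R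
      = (∫ z, (φ z * -(coord z j / R)) • trace u z ∂arcMeasure R)
        + ∫ z, (φ z * -(coord z j / R)) • trace v z ∂arcMeasure R := by
    rw [← integral_add (hInt _) (hInt _)]
    apply integral_congr_ae
    filter_upwards [Lp.coeFn_add (trace u) (trace v)] with z hz
    rw [hz, Pi.add_apply, smul_add]
  rw [e]
  linear_combination eu + ev

theorem trace_smul (hR : 0 < R) {u : L2Ext R} (hu : IsH1 u) (c : ℂ) :
    trace (c • u) = c • trace u := by
  refine trace_eq hR fun φ h1 h2 j => ?_
  have k1 := continuous_fderiv_dir h1 (dir j)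
  have k2 := hasCompactSupport_fderiv_dir h2 (dir j)
  have hs : ∀ w : L2Ext R, ∫ z in diskExt R, (φ z • weakDeriv j w z + (fderiv ℝ φ z (dir j)) • w z)
      = (∫ z in diskExt R, φ z • weakDeriv j w z) + ∫ z in diskExt R, (fderiv ℝ φ z (dir j)) • w z :=
    fun w => integral_add (integrable_smul_coe h1.continuous h2 _) (integrable_smul_coe k1 k2 _)
  have eu := hu.hasTrace hR φ h1 h2 j
  rw [hs] at eu ⊢
  rw [weakDeriv_smul hu, integral_smul_smul, integral_smul_smul]
  have e : ∫ z, (φ z * -(coord z j / R)) • (c • trace u : L2Circle R) z ∂arcMeasure R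
      = c * (∫ z, (φ z * -(coord z j / R)) • trace u z ∂arcMeasure R) := by
    rw [← integral_const_mul]
    apply integral_congr_ae
    filter_upwards [Lp.coeFn_smul c (trace u)] with z hz
    rw [hz, Pi.smul_apply, Complex.real_smul, Complex.real_smul, smul_eq_mul]
    ring
  rw [e]
  linear_combination c * eu

/-! ### Properties of the form -/

theorem H2_isH1 {u : L2Ext R} (hu : u ∈ H2 R) : IsH1 u := (mem_H2_iff.1 hu).1

theorem form_add (hR : 0 < R) {τ γ : ℝ} {u u' v : L2Ext R} (hu : u ∈ H2 R) (hu' : u' ∈ H2 R) :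
    form τ γ (u + u') v = form τ γ u v + form τ γ u' v := by
  have h1 := H2_isH1 hu
  have h1' := H2_isH1 hu'
  have h2 : ∀ j, IsH1 (weakDeriv j u) := fun j => (hu j).2
  have h2' : ∀ j, IsH1 (weakDeriv j u') := fun j => (hu' j).2
  unfold form
  simp only [weakDeriv_add h1 h1', weakDeriv_add (h2 _) (h2' _), trace_add hR h1 h1',
    inner_add_right, Finset.sum_add_distrib]
  ring

theorem form_smul (hR : 0 < R) {τ γ : ℝ} {u v : L2Ext R} (hu : u ∈ H2 R) (c : ℂ) :
    form τ γ (c • u) v = c * form τ γ u v := by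
  have h1 := H2_isH1 hu
  have h2 : ∀ j, IsH1 (weakDeriv j u) := fun j => (hu j).2
  unfold form
  simp only [weakDeriv_smul h1, weakDeriv_smul (h2 _), trace_smul hR h1,
    inner_smul_right, ← Finset.mul_sum]
  ring

/-- Every inner product in `form_eq` can be moved from one argument to the other by `wirt_proj` and
`inner_proj`, and the trace term by `inner_trace_proj`. The form is therefore diagonal in the
Fourier modes. -/
theorem form_proj (hR : 0 < R) {τ γ : ℝ} {u v : L2Ext R} (hu : u ∈ H2 R) (hv : v ∈ H2 R) (n : ℤ) :
    form τ γ (proj hR n u) v = form τ γ u (proj hR n v) := by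
  have hu' := mem_H2_iff.1 hu
  have hv' := mem_H2_iff.1 hv
  rw [form_eq (H2_proj hR hu n) hv, form_eq hu (H2_proj hR hv n), inner_trace_proj hR hu'.1 hv'.1]
  congr 2
  · congr 1
    refine Finset.sum_congr rfl fun s hs => Finset.sum_congr rfl fun s' hs' => ?_
    rw [mem_signs] at hs hs'
    rw [wirt_proj hR hu'.1 n hs, wirt_proj hR hv'.1 n hs, wirt_proj hR (hu'.2 s hs) _ hs',
      wirt_proj hR (hv'.2 s hs) _ hs', inner_proj]
  · congr 2
    refine Finset.sum_congr rfl fun s hs => ?_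
    rw [mem_signs] at hs
    rw [wirt_proj hR hu'.1 n hs, wirt_proj hR hv'.1 n hs, inner_proj]

theorem form_mode_left (hR : 0 < R) {τ γ : ℝ} {n : ℤ} {f : L2Rad R} (hf : f ∈ fiberDom R n)
    {v : L2Ext R} (hv : v ∈ H2 R) : form τ γ (mode n f) v = fiberForm τ γ n f (coef hR n v) := by
  have h := form_proj hR (τ := τ) (γ := γ) hf hv n
  have h2 : proj hR n (mode n f) = mode n f := by
    unfold proj; rw [coef_mode, if_pos rfl]
  rw [h2] at h
  exact h

theorem form_mode_right (hR : 0 < R) {τ γ : ℝ} {n : ℤ} {f : L2Rad R} (hf : f ∈ fiberDom R n)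
    {u : L2Ext R} (hu : u ∈ H2 R) : form τ γ u (mode n f) = fiberForm τ γ n (coef hR n u) f := by
  have h := form_proj hR (τ := τ) (γ := γ) hu hf n
  have h2 : proj hR n (mode n f) = mode n f := by
    unfold proj; rw [coef_mode, if_pos rfl]
  rw [h2] at h
  exact h.symm

end TraceExistence


/-! ### Eigenvectors of the operator associated with a form -/

section FormOperator

variable {E : Type*} [NormedAddCommGroup E] [InnerProductSpace ℂ E]

/-- If no associated operator exists, the default value has domain 0 and no eigenvectors. The
existence of the operator is thus not needed in this direction. -/
theorem IsEigenvector.form_eq {D : Set E} {h : E → E → ℂ} {μ : ℂ} {u : E}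
    (hu : IsEigenvector (formOperator D h) μ u) :
    u ≠ 0 ∧ u ∈ D ∧ ∀ v ∈ D, h u v = μ * ⟪v, u⟫_ℂ := by
  obtain ⟨h0, hd, he⟩ := hu
  refine ⟨h0, ?_⟩
  by_cases H : ∃ A : E →ₗ.[ℂ] E, IsAssociated A D h
  · have hA : IsAssociated (formOperator D h) D h := by
      unfold formOperator; rw [dif_pos H]; exact H.choose_spec
    have hg : (u, μ • u) ∈ (formOperator D h).graph := by
      rw [← he]; exact LinearPMap.mem_graph _ ⟨u, hd⟩
    obtain ⟨h1, h2⟩ := (hA u _).1 hg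
    exact ⟨h1, fun v hv => by rw [h2 v hv, inner_smul_right]⟩
  · exfalso
    have hb : formOperator D h = ⊥ := by unfold formOperator; rw [dif_neg H]
    rw [hb] at hd
    exact h0 ((Submodule.mem_bot ℂ).1 hd)

/-- The relation itself is a linear subspace and is taken as the graph; density of D makes it
single-valued. Linearity in the first argument suffices, without closedness or symmetry. -/
theorem exists_isAssociated {D : Submodule ℂ E} (hD : Dense (D : Set E)) {h : E → E → ℂ}
    (hadd : ∀ u ∈ D, ∀ u' ∈ D, ∀ v ∈ D, h (u + u') v = h u v + h u' v)
    (hsmul : ∀ (c : ℂ), ∀ u ∈ D, ∀ v ∈ D, h (c • u) v = c * h u v) :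
    ∃ A : E →ₗ.[ℂ] E, IsAssociated A (D : Set E) h := by
  let G : Submodule ℂ (E × E) :=
    { carrier := {p | p.1 ∈ D ∧ ∀ v ∈ D, h p.1 v = ⟪v, p.2⟫_ℂ}
      add_mem' := fun {p q} hp hq => ⟨D.add_mem hp.1 hq.1, fun v hv => by
        rw [Prod.fst_add, Prod.snd_add, hadd _ hp.1 _ hq.1 v hv, hp.2 v hv, hq.2 v hv,
          inner_add_right]⟩
      zero_mem' := ⟨D.zero_mem, fun v hv => by
        have := hsmul 0 0 D.zero_mem v hv
        rw [smul_zero, zero_mul] at this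
        rw [Prod.fst_zero, Prod.snd_zero, inner_zero_right, this]⟩
      smul_mem' := fun c p hp => ⟨D.smul_mem c hp.1, fun v hv => by
        rw [Prod.smul_fst, Prod.smul_snd, hsmul c _ hp.1 v hv, hp.2 v hv, inner_smul_right]⟩ }
  have hG : ∀ x ∈ G, x.1 = 0 → x.2 = 0 := by
    rintro ⟨x, y⟩ hx (rfl : x = 0)
    have h0 := G.zero_mem
    refine hD.eq_zero_of_inner_right ℂ fun v hv => ?_
    have h1 := hx.2 v hv
    have h2 := h0.2 v hv
    change h 0 v = _ at h1
    change h 0 v = _ at h2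
    rw [← h1, h2]
    exact inner_zero_right _
  refine ⟨G.toLinearPMap, fun u w => ?_⟩
  rw [Submodule.toLinearPMap_graph_eq G hG]
  exact Iff.rfl

theorem isEigenvector_formOperator {D : Submodule ℂ E} (hD : Dense (D : Set E)) {h : E → E → ℂ}
    (hadd : ∀ u ∈ D, ∀ u' ∈ D, ∀ v ∈ D, h (u + u') v = h u v + h u' v)
    (hsmul : ∀ (c : ℂ), ∀ u ∈ D, ∀ v ∈ D, h (c • u) v = c * h u v)
    {μ : ℂ} {u : E} (h0 : u ≠ 0) (hu : u ∈ D) (he : ∀ v ∈ D, h u v = μ * ⟪v, u⟫_ℂ) :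
    IsEigenvector (formOperator (D : Set E) h) μ u := by
  have H := exists_isAssociated hD hadd hsmul
  have hA : IsAssociated (formOperator (D : Set E) h) (D : Set E) h := by
    unfold formOperator; rw [dif_pos H]; exact H.choose_spec
  have hg : (u, μ • u) ∈ (formOperator (D : Set E) h).graph :=
    (hA u _).2 ⟨hu, fun v hv => by rw [he v hv, inner_smul_right]⟩
  obtain ⟨⟨y, hy⟩, h1, h2⟩ := (LinearPMap.mem_graph_iff _).1 hg
  simp only at h1 h2
  subst h1
  exact ⟨h0, hy, h2⟩

end FormOperator

/-! ### Rank-one perturbations of non-negative closed forms -/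

section GroundState

variable {W E F : Type*} [NormedAddCommGroup W] [NormedSpace ℂ W] [CompleteSpace W]
  [NormedAddCommGroup E] [InnerProductSpace ℂ E] [CompleteSpace E]
  [NormedAddCommGroup F] [InnerProductSpace ℂ F] [CompleteSpace F]

/-- A map that is bounded below has closed range. The range is then a Hilbert space, ℓ passes to a
bounded functional on it, and the Riesz theorem applies there; W itself needs no inner product. -/
theorem exists_riesz_of_bounded_below (S : W →L[ℂ] F) {c : ℝ} (hc : 0 < c)
    (hS : ∀ w, c * ‖w‖ ≤ ‖S w‖) (ℓ : W →ₗ[ℂ] ℂ) {C : ℝ} (hℓ : ∀ w, ‖ℓ w‖ ≤ C * ‖S w‖) :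
    ∃ g, ∀ v, ⟪S g, S v⟫_ℂ = ℓ v := by
  have hanti : AntilipschitzWith (Real.toNNReal c⁻¹) S := by
    refine AddMonoidHomClass.antilipschitz_of_bound S fun w => ?_
    rw [Real.coe_toNNReal _ (inv_pos.2 hc).le, inv_mul_eq_div, le_div_iff₀ hc, mul_comm]
    exact hS w
  have hcl : IsClosed (LinearMap.range (S : W →ₗ[ℂ] F) : Set F) :=
    hanti.isClosed_range S.uniformContinuous
  have : CompleteSpace (LinearMap.range (S : W →ₗ[ℂ] F)) := hcl.completeSpace_coe
  let e := LinearEquiv.ofInjective (S : W →ₗ[ℂ] F) hanti.injective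
  let L : LinearMap.range (S : W →ₗ[ℂ] F) →L[ℂ] ℂ :=
    (ℓ ∘ₗ e.symm.toLinearMap).mkContinuous C fun y => by
      obtain ⟨w, rfl⟩ := e.surjective y
      rw [LinearMap.comp_apply, LinearEquiv.coe_coe, e.symm_apply_apply]
      exact hℓ w
  obtain ⟨g, hg⟩ := e.surjective ((InnerProductSpace.toDual ℂ _).symm L)
  refine ⟨g, fun v => ?_⟩
  have h1 := InnerProductSpace.toDual_symm_apply (x := e v) (y := L)
  rw [← hg, Submodule.coe_inner] at h1
  refine h1.trans ?_
  change ℓ (e.symm (e v)) = ℓ v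
  rw [e.symm_apply_apply]

/-- A closed non-negative form `‖T·‖²` perturbed by the rank-one form `-β|ℓ|²` attains its lower
bound relative to `‖J·‖²`, if this bound is negative. -/
theorem exists_ground_state (J : W →L[ℂ] E) (T : W →L[ℂ] F) (ℓ : W →ₗ[ℂ] ℂ) {β c C : ℝ} (hβ : 0 < β)
    (hc : 0 < c) (hcoer : ∀ w, c * ‖w‖ ^ 2 ≤ ‖T w‖ ^ 2 + ‖J w‖ ^ 2)
    (hbdd : ∀ w, β * ‖ℓ w‖ ^ 2 ≤ ‖T w‖ ^ 2 + C * ‖J w‖ ^ 2)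
    (hneg : ∃ w, ‖T w‖ ^ 2 < β * ‖ℓ w‖ ^ 2) :
    ∃ μ : ℝ, 0 < μ ∧ (∀ w, β * ‖ℓ w‖ ^ 2 ≤ ‖T w‖ ^ 2 + μ * ‖J w‖ ^ 2) ∧
      ∃ g, g ≠ 0 ∧ ∀ v, ⟪T v, T g⟫_ℂ - β * (starRingEnd ℂ (ℓ v) * ℓ g) = -μ * ⟪J v, J g⟫_ℂ := by
  obtain ⟨w₀, hw₀⟩ := hneg
  -- The admissible shifts of the form. The least one is minus the lower bound of the perturbed
  -- form; the vector w₀ forces it to be positive.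
  set A : Set ℝ := {m | ∀ w, β * ‖ℓ w‖ ^ 2 ≤ ‖T w‖ ^ 2 + m * ‖J w‖ ^ 2} with hA
  have hA0 : ∀ m ∈ A, 0 < m := by
    intro m hm
    by_contra h
    nlinarith [hm w₀, sq_nonneg ‖J w₀‖]
  have hAcl : IsClosed A := by
    rw [hA, ofPred_forall]
    exact isClosed_iInter fun w => isClosed_le continuous_const (by fun_prop)
  have hAbdd : BddBelow A := ⟨0, fun m hm => (hA0 m hm).le⟩
  have hμA : sInf A ∈ A := hAcl.csInf_mem ⟨C, hbdd⟩ hAbdd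
  set μ := sInf A with hμ
  have hμ0 := hA0 μ hμA
  refine ⟨μ, hμ0, hμA, ?_⟩
  -- ‖S·‖² is the unperturbed form shifted by μ.
  let S : W →L[ℂ] WithLp 2 (E × F) :=
    (WithLp.prodContinuousLinearEquiv 2 ℂ E F).symm.toContinuousLinearMap ∘L
      ((((Real.sqrt μ : ℝ) : ℂ) • J).prod T)
  have hSi : ∀ v w, ⟪S v, S w⟫_ℂ = μ * ⟪J v, J w⟫_ℂ + ⟪T v, T w⟫_ℂ := by
    intro v w
    rw [WithLp.prod_inner_apply]
    change ⟪((Real.sqrt μ : ℝ) : ℂ) • J v, ((Real.sqrt μ : ℝ) : ℂ) • J w⟫_ℂ + ⟪T v, T w⟫_ℂ = _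
    rw [inner_smul_left, inner_smul_right, Complex.conj_ofReal, ← mul_assoc, ← Complex.ofReal_mul,
      Real.mul_self_sqrt hμ0.le]
  have hSn : ∀ w, ‖S w‖ ^ 2 = μ * ‖J w‖ ^ 2 + ‖T w‖ ^ 2 := by
    intro w
    have h := hSi w w
    simp only [inner_self_eq_norm_sq_to_K] at h
    rw [← Complex.ofReal_inj]
    push_cast
    exact h
  have hmin : 0 < min 1 μ := lt_min one_pos hμ0
  have hSb : ∀ w, Real.sqrt (min 1 μ * c) * ‖w‖ ≤ ‖S w‖ := by
    intro w
    refine abs_le_of_sq_le_sq' ?_ (norm_nonneg _) |>.2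
    rw [mul_pow, Real.sq_sqrt (mul_pos hmin hc).le, hSn]
    have h1 := min_le_left 1 μ
    have h2 := min_le_right 1 μ
    have h3 := mul_le_mul_of_nonneg_left (hcoer w) hmin.le
    have h4 := mul_le_mul_of_nonneg_right h1 (sq_nonneg ‖T w‖)
    have h5 := mul_le_mul_of_nonneg_right h2 (sq_nonneg ‖J w‖)
    linarith
  have hℓ : ∀ w, ‖ℓ w‖ ≤ Real.sqrt β⁻¹ * ‖S w‖ := by
    intro w
    refine abs_le_of_sq_le_sq' ?_ (by positivity) |>.2
    rw [mul_pow, Real.sq_sqrt (inv_pos.2 hβ).le, hSn, inv_mul_eq_div, le_div_iff₀ hβ]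
    linarith [hμA w]
  obtain ⟨g, hg⟩ := exists_riesz_of_bounded_below S (Real.sqrt_pos.2 (mul_pos hmin hc)) hSb ℓ hℓ
  have hgg : ℓ g = ((‖S g‖ ^ 2 : ℝ) : ℂ) := by
    rw [← hg g, inner_self_eq_norm_sq_to_K]; norm_cast
  have hCS : ∀ v, ‖ℓ v‖ ^ 2 ≤ ‖S g‖ ^ 2 * ‖S v‖ ^ 2 := by
    intro v
    rw [← hg v, ← mul_pow]
    exact pow_le_pow_left₀ (norm_nonneg _) (norm_inner_le_norm _ _) 2
  have hle : β * ‖S g‖ ^ 2 ≤ 1 := by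
    have h1 := hμA g
    rw [hgg, Complex.norm_real, Real.norm_of_nonneg (sq_nonneg _)] at h1
    have h2 := hSn g
    by_contra h
    push Not at h
    have h3 : 0 < ‖S g‖ ^ 2 := by
      by_contra h4
      nlinarith [sq_nonneg ‖S g‖]
    nlinarith
  -- Otherwise Cauchy-Schwarz, applied to ℓ = ⟨Sg, S·⟩, would make the smaller number β‖Sg‖²μ
  -- admissible, against the minimality of μ.
  have hge : 1 ≤ β * ‖S g‖ ^ 2 := by
    by_contra h
    push Not at h
    have hmem : β * ‖S g‖ ^ 2 * μ ∈ A := by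
      intro w
      have h1 := mul_le_mul_of_nonneg_left (hCS w) hβ.le
      rw [hSn w] at h1
      nlinarith [sq_nonneg ‖T w‖]
    have := csInf_le hAbdd hmem
    nlinarith
  have heq : β * ‖S g‖ ^ 2 = 1 := le_antisymm hle hge
  refine ⟨g, ?_, fun v => ?_⟩
  · rintro rfl
    simp at heq
  · have h1 : ⟪S v, S g⟫_ℂ = starRingEnd ℂ (ℓ v) := by rw [← hg v, inner_conj_symm]
    rw [hSi] at h1
    -- With this normalisation the equation ⟨Sv, Sg⟩ = conj ℓ(v) of the representer is the
    -- eigenvalue equation.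
    have h2 : (β : ℂ) * ℓ g = 1 := by rw [hgg]; exact_mod_cast heq
    linear_combination h1 - starRingEnd ℂ (ℓ v) * h2

end GroundState


section RadialSpace

variable {R : ℝ}

/-! ### The form domain of the fiber forms as a Hilbert space -/

/-- Written with inner products, weak differentiability is a family of continuous linear conditions;
this makes `radSpace` a closed subspace and hence complete. -/
theorem weakRadDeriv_iff_inner (hR : 0 < R) {f g : L2Rad R} :
    WeakRadDeriv f g ↔ ∀ ψ, ∀ hψ : IsTest R ψ,
      ⟪(hψ.deriv.div hR).toRad, f⟫_ℂ + ⟪(hψ.div hR).toRad, g⟫_ℂ = 0 := by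
  refine forall₂_congr fun ψ hψ => ?_
  rw [hψ.deriv.inner_toRad_div hR, hψ.inner_toRad_div hR, eq_neg_iff_add_eq_zero]

/-- The triples of a function and its first two weak derivatives. -/
def radSpace (hR : 0 < R) : Submodule ℂ (L2Rad R × L2Rad R × L2Rad R) where
  carrier := {p | WeakRadDeriv p.1 p.2.1 ∧ WeakRadDeriv p.2.1 p.2.2}
  add_mem' {p q} hp hq := by
    simp only [mem_ofPred_eq, weakRadDeriv_iff_inner hR, Prod.fst_add, Prod.snd_add,
      inner_add_right] at *
    exact ⟨fun ψ hψ => by linear_combination hp.1 ψ hψ + hq.1 ψ hψ,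
      fun ψ hψ => by linear_combination hp.2 ψ hψ + hq.2 ψ hψ⟩
  zero_mem' := by
    simp only [mem_ofPred_eq, weakRadDeriv_iff_inner hR, Prod.fst_zero, Prod.snd_zero,
      inner_zero_right, add_zero, implies_true, and_self]
  smul_mem' c p hp := by
    simp only [mem_ofPred_eq, weakRadDeriv_iff_inner hR, Prod.smul_fst, Prod.smul_snd,
      inner_smul_right] at *
    exact ⟨fun ψ hψ => by linear_combination c * hp.1 ψ hψ,
      fun ψ hψ => by linear_combination c * hp.2 ψ hψ⟩

theorem isClosed_radSpace (hR : 0 < R) :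
    IsClosed (radSpace hR : Set (L2Rad R × L2Rad R × L2Rad R)) := by
  have : (radSpace hR : Set (L2Rad R × L2Rad R × L2Rad R))
      = {p | ∀ ψ, ∀ hψ : IsTest R ψ,
        ⟪(hψ.deriv.div hR).toRad, p.1⟫_ℂ + ⟪(hψ.div hR).toRad, p.2.1⟫_ℂ = 0}
      ∩ {p | ∀ ψ, ∀ hψ : IsTest R ψ,
        ⟪(hψ.deriv.div hR).toRad, p.2.1⟫_ℂ + ⟪(hψ.div hR).toRad, p.2.2⟫_ℂ = 0} := by
    ext p
    exact and_congr (weakRadDeriv_iff_inner hR) (weakRadDeriv_iff_inner hR)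
  rw [this]
  simp only [ofPred_forall]
  exact (isClosed_iInter fun ψ => isClosed_iInter fun hψ =>
      isClosed_eq (by fun_prop) continuous_const).inter
    (isClosed_iInter fun ψ => isClosed_iInter fun hψ =>
      isClosed_eq (by fun_prop) continuous_const)

instance (hR : 0 < R) : CompleteSpace (radSpace hR) := (isClosed_radSpace hR).completeSpace_coe

theorem mem_radSpace_iff (hR : 0 < R) {f f₁ f₂ : L2Rad R} :
    (f, f₁, f₂) ∈ radSpace hR ↔ ∃ a b, RadH2 f f₁ f₂ a b := by
  constructor
  · rintro ⟨h1, h2⟩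
    obtain ⟨a, ha⟩ := h1.exists hR
    obtain ⟨b, hb⟩ := h2.exists hR
    exact ⟨a, b, ha, hb⟩
  · rintro ⟨a, b, h⟩
    exact ⟨h.fst.weak hR, h.snd.weak hR⟩

/-- The boundary estimate is applied to the zero function, obtained as f - f. -/
theorem HasRadDeriv.boundary_unique (hR : 0 < R) {f g : L2Rad R} {a b : ℂ} (h : HasRadDeriv f g a)
    (h' : HasRadDeriv f g b) : a = b := by
  have h1 := (h.add hR (h'.smul hR (-1))).boundary_le hR
  rw [neg_one_smul, add_neg_cancel, norm_zero, zero_mul, mul_zero] at h1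
  have h2 : ‖a + -1 * b‖ ^ 2 = 0 := le_antisymm (by nlinarith) (sq_nonneg _)
  have h3 := norm_eq_zero.1 (pow_eq_zero_iff two_ne_zero |>.1 h2)
  linear_combination h3

theorem exists_boundary (hR : 0 < R) (w : radSpace hR) : ∃ a, HasRadDeriv w.1.1 w.1.2.1 a :=
  WeakRadDeriv.exists hR w.2.1

/-- The boundary value of a function in the form domain of the fiber forms. -/
def boundary (hR : 0 < R) : radSpace hR →ₗ[ℂ] ℂ where
  toFun w := (exists_boundary hR w).choose
  map_add' w v := (exists_boundary hR (w + v)).choose_spec.boundary_unique hR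
    ((exists_boundary hR w).choose_spec.add hR (exists_boundary hR v).choose_spec)
  map_smul' c w := (exists_boundary hR (c • w)).choose_spec.boundary_unique hR
    ((exists_boundary hR w).choose_spec.smul hR c)

theorem hasRadDeriv_boundary (hR : 0 < R) (w : radSpace hR) :
    HasRadDeriv w.1.1 w.1.2.1 (boundary hR w) := (exists_boundary hR w).choose_spec

theorem exists_radH2_boundary (hR : 0 < R) (w : radSpace hR) :
    ∃ b, RadH2 w.1.1 w.1.2.1 w.1.2.2 (boundary hR w) b := by
  obtain ⟨b, hb⟩ := w.2.2.exists hR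
  exact ⟨b, hasRadDeriv_boundary hR w, hb⟩

theorem mem_fiberDom_iff_radSpace (hR : 0 < R) {n : ℤ} {f : L2Rad R} :
    f ∈ fiberDom R n ↔ ∃ w : radSpace hR, w.1.1 = f := by
  rw [mem_fiberDom_iff hR]
  constructor
  · rintro ⟨f₁, f₂, h⟩
    exact ⟨⟨(f, f₁, f₂), (mem_radSpace_iff hR).2 h⟩, rfl⟩
  · rintro ⟨w, rfl⟩
    exact ⟨_, _, (mem_radSpace_iff hR).1 w.2⟩

theorem radSpace_eq_zero (hR : 0 < R) {w : radSpace hR} (h : w.1.1 = 0) : w = 0 := by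
  have h0 : WeakRadDeriv (0 : L2Rad R) 0 := (radSpace hR).zero_mem.1
  have h1 : w.1.2.1 = 0 := by
    refine WeakRadDeriv.unique hR ?_ h0
    rw [← h]; exact w.2.1
  have h2 : w.1.2.2 = 0 := by
    refine WeakRadDeriv.unique hR ?_ h0
    rw [← h1]; exact w.2.2
  ext1
  exact Prod.ext h (Prod.ext h1 h2)

/-! ### Density of the form domains -/

/-- If g is orthogonal to all test functions, then both g and 0 are weak derivatives of 0. -/
theorem eq_zero_of_inner_test (hR : 0 < R) {g : L2Rad R}
    (h : ∀ ψ, ∀ hψ : IsTest R ψ, ⟪hψ.toRad, g⟫_ℂ = 0) : g = 0 := by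
  refine WeakRadDeriv.unique hR (f := 0) (fun ψ hψ => ?_) (fun ψ hψ => ?_)
  · rw [← hψ.deriv.inner_toRad_div hR, ← hψ.inner_toRad_div hR, h, inner_zero_right, neg_zero]
  · rw [← hψ.deriv.inner_toRad_div hR, ← hψ.inner_toRad_div hR, inner_zero_right, inner_zero_right,
      neg_zero]

theorem IsTest.toRad_mem_fiberDom (hR : 0 < R) {ψ : ℝ → ℝ} (hψ : IsTest R ψ) (n : ℤ) :
    hψ.toRad ∈ fiberDom R n :=
  (mem_fiberDom_iff hR).2 ⟨hψ.deriv.toRad, hψ.deriv.deriv.toRad, _, _,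
    HasRadDeriv.of_isPrim hR hψ.isPrim hψ.coeFn_toRad hψ.deriv.coeFn_toRad,
    HasRadDeriv.of_isPrim hR hψ.deriv.isPrim hψ.deriv.coeFn_toRad hψ.deriv.deriv.coeFn_toRad⟩

/-- The domain of the form as a subspace. -/
def H2Submodule (hR : 0 < R) : Submodule ℂ (L2Ext R) where
  carrier := H2 R
  add_mem' := H2_add
  zero_mem' := by
    have := RadH2.mode_mem hR ((mem_radSpace_iff hR).1 (radSpace hR).zero_mem).choose_spec.choose_spec 0
    have h2 := H2_smul this 0
    rwa [zero_smul] at h2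
  smul_mem' c _ h := H2_smul h c

/-- The domain of a fiber form as a subspace. -/
def fiberSubmodule (hR : 0 < R) (n : ℤ) : Submodule ℂ (L2Rad R) :=
  (H2Submodule hR).comap (modeL hR n).toLinearMap

theorem dense_fiberSubmodule (hR : 0 < R) (n : ℤ) : Dense (fiberSubmodule hR n : Set (L2Rad R)) := by
  rw [Submodule.dense_iff_topologicalClosure_eq_top, Submodule.topologicalClosure_eq_top_iff,
    Submodule.eq_bot_iff]
  intro g hg
  exact eq_zero_of_inner_test hR fun ψ hψ =>
    (Submodule.mem_orthogonal _ g).1 hg _ (hψ.toRad_mem_fiberDom hR n)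

theorem dense_H2Submodule (hR : 0 < R) : Dense (H2Submodule hR : Set (L2Ext R)) := by
  rw [Submodule.dense_iff_topologicalClosure_eq_top, Submodule.topologicalClosure_eq_top_iff,
    Submodule.eq_bot_iff]
  intro u hu
  refine eq_zero_of_coef hR u fun n => eq_zero_of_inner_test hR fun ψ hψ => ?_
  rw [inner_coef_right]
  exact (Submodule.mem_orthogonal _ u).1 hu _ (hψ.toRad_mem_fiberDom hR n)

theorem isEigenvector_robinOp (hR : 0 < R) {τ γ : ℝ} {μ : ℂ} {u : L2Ext R} (h0 : u ≠ 0)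
    (hu : u ∈ H2 R) (he : ∀ v ∈ H2 R, form τ γ u v = μ * ⟪v, u⟫_ℂ) :
    IsEigenvector (robinOp R τ γ) μ u :=
  isEigenvector_formOperator (D := H2Submodule hR) (dense_H2Submodule hR)
    (fun _ hu _ hu' _ _ => form_add hR hu hu') (fun c _ hu _ _ => form_smul hR hu c) h0 hu he

theorem isEigenvector_fiberOp (hR : 0 < R) {τ γ : ℝ} {n : ℤ} {μ : ℂ} {f : L2Rad R} (h0 : f ≠ 0)
    (hf : f ∈ fiberDom R n) (he : ∀ g ∈ fiberDom R n, fiberForm τ γ n f g = μ * ⟪g, f⟫_ℂ) :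
    IsEigenvector (fiberOp R τ γ n) μ f := by
  refine isEigenvector_formOperator (D := fiberSubmodule hR n) (dense_fiberSubmodule hR n)
    (fun f hf f' hf' g _ => ?_) (fun c f hf g _ => ?_) h0 hf he
  · unfold fiberForm
    rw [mode_add]
    exact form_add hR hf hf'
  · unfold fiberForm
    rw [mode_smul]
    exact form_smul hR hf c

end RadialSpace


section FiberForms

variable {R : ℝ}

/-! ### The fiber forms -/

/-- The Wirtinger derivative of a Fourier mode. -/
def fiberFst (hR : 0 < R) (n s : ℤ) : L2Rad R × L2Rad R × L2Rad R →L[ℂ] L2Rad R :=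
  ContinuousLinearMap.fst ℂ _ _ ∘L ContinuousLinearMap.snd ℂ _ _
    - (s * n : ℂ) • invR hR ∘L ContinuousLinearMap.fst ℂ _ _

theorem fiberFst_apply (hR : 0 < R) (n s : ℤ) (p : L2Rad R × L2Rad R × L2Rad R) :
    fiberFst hR n s p = p.2.1 - (s * n : ℂ) • invR hR p.1 := rfl

/-- The second Wirtinger derivative of a Fourier mode. -/
def fiberSnd (hR : 0 < R) (n s s' : ℤ) : L2Rad R × L2Rad R × L2Rad R →L[ℂ] L2Rad R :=
  ContinuousLinearMap.snd ℂ _ _ ∘L ContinuousLinearMap.snd ℂ _ _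
    - (s * n : ℂ) • (invR hR ∘L ContinuousLinearMap.fst ℂ _ _ ∘L ContinuousLinearMap.snd ℂ _ _
      - invR hR ∘L invR hR ∘L ContinuousLinearMap.fst ℂ _ _)
    - (s' * (n + s : ℤ) : ℂ) • invR hR ∘L fiberFst hR n s

theorem fiberSnd_apply (hR : 0 < R) (n s s' : ℤ) (p : L2Rad R × L2Rad R × L2Rad R) :
    fiberSnd hR n s s' p = p.2.2 - (s * n : ℂ) • (invR hR p.2.1 - invR hR (invR hR p.1))
      - (s' * (n + s : ℤ) : ℂ) • invR hR (p.2.1 - (s * n : ℂ) • invR hR p.1) := rfl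

/-- The components of the first and second derivatives of a Fourier mode. -/
def fiberGrad (hR : 0 < R) (τ : ℝ) (n : ℤ) :
    L2Rad R × L2Rad R × L2Rad R →L[ℂ] PiLp 2 fun _ : Fin 6 => L2Rad R :=
  (PiLp.continuousLinearEquiv 2 ℂ fun _ : Fin 6 => L2Rad R).symm.toContinuousLinearMap ∘L
    ContinuousLinearMap.pi ![(1 / 2 : ℂ) • fiberSnd hR n 1 1, (1 / 2 : ℂ) • fiberSnd hR n 1 (-1),
      (1 / 2 : ℂ) • fiberSnd hR n (-1) 1, (1 / 2 : ℂ) • fiberSnd hR n (-1) (-1),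
      ((Real.sqrt (τ / 2) : ℝ) : ℂ) • fiberFst hR n 1,
      ((Real.sqrt (τ / 2) : ℝ) : ℂ) • fiberFst hR n (-1)]

/-- The weights 1/2 and √(τ/2) in `fiberGrad` are the square roots of the coefficients 1/4 and τ/2
in `form_eq`. The part of the fiber form without the boundary term becomes the squared norm of one
bounded operator. -/
theorem inner_fiberGrad (hR : 0 < R) {τ : ℝ} (hτ : 0 ≤ τ) (n : ℤ)
    (p q : L2Rad R × L2Rad R × L2Rad R) :
    ⟪fiberGrad hR τ n q, fiberGrad hR τ n p⟫_ℂ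
      = (1 / 4 : ℂ) * ∑ s ∈ signs, ∑ s' ∈ signs, ⟪fiberSnd hR n s s' q, fiberSnd hR n s s' p⟫_ℂ
        + τ * ((1 / 2 : ℂ) * ∑ s ∈ signs, ⟪fiberFst hR n s q, fiberFst hR n s p⟫_ℂ) := by
  have hs : ((Real.sqrt (τ / 2) : ℝ) : ℂ) * (Real.sqrt (τ / 2) : ℝ) = (τ / 2 : ℂ) := by
    rw [← Complex.ofReal_mul, Real.mul_self_sqrt (by positivity)]; push_cast; rfl
  rw [PiLp.inner_apply, Fin.sum_univ_six]
  simp only [sum_signs]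
  change ⟪(1 / 2 : ℂ) • fiberSnd hR n 1 1 q, (1 / 2 : ℂ) • fiberSnd hR n 1 1 p⟫_ℂ
    + ⟪(1 / 2 : ℂ) • fiberSnd hR n 1 (-1) q, (1 / 2 : ℂ) • fiberSnd hR n 1 (-1) p⟫_ℂ
    + ⟪(1 / 2 : ℂ) • fiberSnd hR n (-1) 1 q, (1 / 2 : ℂ) • fiberSnd hR n (-1) 1 p⟫_ℂ
    + ⟪(1 / 2 : ℂ) • fiberSnd hR n (-1) (-1) q, (1 / 2 : ℂ) • fiberSnd hR n (-1) (-1) p⟫_ℂ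
    + ⟪((Real.sqrt (τ / 2) : ℝ) : ℂ) • fiberFst hR n 1 q,
        ((Real.sqrt (τ / 2) : ℝ) : ℂ) • fiberFst hR n 1 p⟫_ℂ
    + ⟪((Real.sqrt (τ / 2) : ℝ) : ℂ) • fiberFst hR n (-1) q,
        ((Real.sqrt (τ / 2) : ℝ) : ℂ) • fiberFst hR n (-1) p⟫_ℂ = _
  simp only [inner_smul_left, inner_smul_right, Complex.conj_ofReal, map_div₀, map_one,
    Complex.conj_ofNat]
  linear_combination (⟪fiberFst hR n 1 q, fiberFst hR n 1 p⟫_ℂ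
    + ⟪fiberFst hR n (-1) q, fiberFst hR n (-1) p⟫_ℂ) * hs

theorem wirt_mode_fiberFst (hR : 0 < R) (w : radSpace hR) (n : ℤ) {s : ℤ} (hs : s = 1 ∨ s = -1) :
    wirt s (mode n w.1.1) = mode (n + s) (fiberFst hR n s w.1) :=
  wirt_mode hR (hasRadDeriv_boundary hR w) n hs

theorem wirt_wirt_mode (hR : 0 < R) (w : radSpace hR) (n : ℤ) {s s' : ℤ} (hs : s = 1 ∨ s = -1)
    (hs' : s' = 1 ∨ s' = -1) :
    wirt s' (wirt s (mode n w.1.1)) = mode (n + s + s') (fiberSnd hR n s s' w.1) := by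
  obtain ⟨b, hb⟩ := exists_radH2_boundary hR w
  rw [wirt_mode_fiberFst hR w n hs]
  exact wirt_mode hR (HasRadDeriv.wirt hR hb (s * n : ℂ)) (n + s) hs'

/-- A non-negative form plus a rank-one form, as `exists_ground_state` requires. The factor R is the
squared norm of `circMode`. -/
theorem fiberForm_eq (hR : 0 < R) {τ γ : ℝ} (hτ : 0 ≤ τ) (n : ℤ) (w v : radSpace hR) :
    fiberForm τ γ n w.1.1 v.1.1 = ⟪fiberGrad hR τ n v, fiberGrad hR τ n w⟫_ℂ
      + γ * R * (starRingEnd ℂ (boundary hR v) * boundary hR w) := by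
  obtain ⟨b, hb⟩ := exists_radH2_boundary hR w
  obtain ⟨c, hc⟩ := exists_radH2_boundary hR v
  unfold fiberForm
  rw [RobinBilaplacian.form_eq (hb.mode_mem hR n) (hc.mode_mem hR n), inner_fiberGrad hR hτ,
    trace_mode hR hb.fst, trace_mode hR hc.fst, inner_smul_left, inner_smul_right,
    inner_circMode hR, if_pos rfl]
  congr 1
  swap
  · ring
  congr 2
  · refine Finset.sum_congr rfl fun s hs => Finset.sum_congr rfl fun s' hs' => ?_
    rw [mem_signs] at hs hs'
    rw [wirt_wirt_mode hR w n hs hs', wirt_wirt_mode hR v n hs hs', inner_mode_mode hR, if_pos rfl]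
  · congr 1
    refine Finset.sum_congr rfl fun s hs => ?_
    rw [mem_signs] at hs
    rw [wirt_mode_fiberFst hR w n hs, wirt_mode_fiberFst hR v n hs, inner_mode_mode hR, if_pos rfl]

theorem norm_sq_combination (x y z : L2Rad R) (α β : ℝ) :
    ‖x + (α : ℂ) • y + (β : ℂ) • z‖ ^ 2 = ‖x‖ ^ 2 + α ^ 2 * ‖y‖ ^ 2 + β ^ 2 * ‖z‖ ^ 2
      + 2 * α * (⟪x, y⟫_ℂ).re + 2 * β * (⟪x, z⟫_ℂ).re + 2 * α * β * (⟪y, z⟫_ℂ).re := by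
  rw [@norm_add_sq ℂ, @norm_add_sq ℂ, inner_add_left, inner_smul_left, inner_smul_right,
    inner_smul_right, inner_smul_right, norm_smul, norm_smul, Complex.norm_real, Complex.norm_real,
    mul_pow, mul_pow, Real.norm_eq_abs, Real.norm_eq_abs, sq_abs, sq_abs, Complex.conj_ofReal]
  simp only [RCLike.re_to_complex, Complex.add_re, Complex.re_ofReal_mul]
  ring

/-- The expansion of ‖f''‖² + 2n²‖f'/r - f/r²‖² + ‖f'/r - n²f/r²‖², which comes from the Hessian in
polar coordinates, together with the gradient term. -/
theorem norm_fiberGrad_sq (hR : 0 < R) {τ : ℝ} (hτ : 0 ≤ τ) (n : ℤ)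
    (p : L2Rad R × L2Rad R × L2Rad R) :
    ‖fiberGrad hR τ n p‖ ^ 2 = ‖p.2.2‖ ^ 2 + (2 * n ^ 2 + 1) * ‖invR hR p.2.1‖ ^ 2
      - 6 * n ^ 2 * (⟪invR hR p.2.1, invR hR (invR hR p.1)⟫_ℂ).re
      + (n ^ 4 + 2 * n ^ 2) * ‖invR hR (invR hR p.1)‖ ^ 2
      + τ * (‖p.2.1‖ ^ 2 + n ^ 2 * ‖invR hR p.1‖ ^ 2) := by
  have h := congrArg Complex.re (inner_fiberGrad hR hτ n p p)
  have hre : ∀ x : L2Rad R, ⟪x, x⟫_ℂ = ((‖x‖ ^ 2 : ℝ) : ℂ) := fun x => by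
    rw [inner_self_eq_norm_sq_to_K]; norm_cast
  have hre' : (⟪fiberGrad hR τ n p, fiberGrad hR τ n p⟫_ℂ).re = ‖fiberGrad hR τ n p‖ ^ 2 := by
    rw [inner_self_eq_norm_sq_to_K]; norm_cast
  have hs : ∀ s s' : ℤ, ‖fiberSnd hR n s s' p‖ ^ 2
      = ‖p.2.2 + ((-(s * n) - s' * (n + s) : ℝ) : ℂ) • invR hR p.2.1
        + ((s * n + s' * (n + s) * (s * n) : ℝ) : ℂ) • invR hR (invR hR p.1)‖ ^ 2 := by
    intro s s'
    rw [fiberSnd_apply, map_sub, map_smul]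
    congr 2
    push_cast
    module
  have hf : ∀ s : ℤ, ‖fiberFst hR n s p‖ ^ 2
      = ‖p.2.1 + ((-(s * n) : ℝ) : ℂ) • invR hR p.1 + ((0 : ℝ) : ℂ) • 0‖ ^ 2 := by
    intro s
    rw [fiberFst_apply]
    congr 2
    push_cast
    module
  rw [hre'] at h
  simp only [hre, hs, hf, norm_sq_combination, sum_signs] at h
  rw [h, ← Complex.ofReal_re (_ + τ * _)]
  congr 1
  push_cast
  ring

theorem norm_sub_smul_sq (y z : L2Rad R) (β : ℝ) :
    ‖y‖ ^ 2 - 2 * β * (⟪y, z⟫_ℂ).re + β ^ 2 * ‖z‖ ^ 2 = ‖y - (β : ℂ) • z‖ ^ 2 := by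
  have := norm_sq_combination y z 0 (-β) 0
  rw [smul_zero, add_zero, Complex.ofReal_neg, neg_smul, ← sub_eq_add_neg] at this
  rw [this]; simp; ring

/-- All terms other than ‖f''‖² form a sum of squares. -/
theorem norm_snd_sq_le (hR : 0 < R) {τ : ℝ} (hτ : 0 ≤ τ) (n : ℤ)
    (p : L2Rad R × L2Rad R × L2Rad R) : ‖p.2.2‖ ^ 2 ≤ ‖fiberGrad hR τ n p‖ ^ 2 := by
  rw [norm_fiberGrad_sq hR hτ]
  have h1 := norm_sub_smul_sq (invR hR p.2.1) (invR hR (invR hR p.1)) 1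
  have h2 := norm_sub_smul_sq (invR hR p.2.1) (invR hR (invR hR p.1)) (n ^ 2)
  have h3 : 0 ≤ τ * (‖p.2.1‖ ^ 2 + n ^ 2 * ‖invR hR p.1‖ ^ 2) := by positivity
  have h4 := sq_nonneg ‖invR hR p.2.1 - (((n : ℝ) ^ 2 : ℝ) : ℂ) • invR hR (invR hR p.1)‖
  have h5 := mul_nonneg (sq_nonneg (n : ℝ))
    (sq_nonneg ‖invR hR p.2.1 - ((1 : ℝ) : ℂ) • invR hR (invR hR p.1)‖)
  rw [← h2] at h4
  rw [← h1] at h5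
  nlinarith

/-- The form controls f'', and f' follows from the interpolation inequality with 10‖f''‖‖f‖ ≤
5‖f''‖² + 5‖f‖². This holds even for τ = 0. -/
theorem fiberGrad_coercive (hR : 0 < R) {τ : ℝ} (hτ : 0 ≤ τ) (n : ℤ) (w : radSpace hR) :
    (7 + 4 * (R ^ 2)⁻¹)⁻¹ * ‖w‖ ^ 2 ≤ ‖fiberGrad hR τ n w‖ ^ 2 + ‖w.1.1‖ ^ 2 := by
  obtain ⟨b, hb⟩ := exists_radH2_boundary hR w
  have h1 := hb.fst.norm_deriv_sq_le hR hb.snd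
  have h2 := norm_snd_sq_le hR hτ n w.1
  have h3 : ‖w‖ ^ 2 ≤ ‖w.1.1‖ ^ 2 + (‖w.1.2.1‖ ^ 2 + ‖w.1.2.2‖ ^ 2) := by
    rw [Submodule.coe_norm, Prod.norm_def, Prod.norm_def]
    rcases max_choice ‖w.1.1‖ (max ‖w.1.2.1‖ ‖w.1.2.2‖) with h | h <;> rw [h]
    · nlinarith [sq_nonneg ‖w.1.2.1‖, sq_nonneg ‖w.1.2.2‖]
    rcases max_choice ‖w.1.2.1‖ ‖w.1.2.2‖ with h | h <;> rw [h]
    · nlinarith [sq_nonneg ‖w.1.1‖, sq_nonneg ‖w.1.2.2‖]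
    · nlinarith [sq_nonneg ‖w.1.1‖, sq_nonneg ‖w.1.2.1‖]
  have hR2 : 0 < (R ^ 2)⁻¹ := by positivity
  rw [inv_mul_le_iff₀ (by positivity)]
  nlinarith [sq_nonneg (‖w.1.2.2‖ - ‖w.1.1‖), sq_nonneg ‖w.1.1‖, sq_nonneg ‖w.1.2.2‖,
    mul_nonneg hR2.le (sq_nonneg ‖fiberGrad hR τ n w‖)]

/-- The boundary estimate and -2γ‖f'‖‖f‖ ≤ ‖f'‖²/5 + 5γ²‖f‖² leave a fifth of ‖f'‖². By
interpolation this is at most 2‖f''‖‖f‖ + (4/5)R⁻²‖f‖², and the first term is at most ‖f''‖² + ‖f‖²,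
so that ‖f''‖² appears with coefficient 1. -/
theorem boundary_sq_le (hR : 0 < R) {τ γ : ℝ} (hτ : 0 ≤ τ) (hγ : γ < 0) (n : ℤ) (w : radSpace hR) :
    -γ * R * ‖boundary hR w‖ ^ 2 ≤ ‖fiberGrad hR τ n w‖ ^ 2
      + (1 + 4 / 5 * (R ^ 2)⁻¹ + 5 * γ ^ 2) * ‖w.1.1‖ ^ 2 := by
  obtain ⟨b, hb⟩ := exists_radH2_boundary hR w
  have h1 := hb.fst.norm_deriv_sq_le hR hb.snd
  have h2 := norm_snd_sq_le hR hτ n w.1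
  have h3 := mul_le_mul_of_nonneg_left (hb.fst.boundary_le hR) (neg_pos.2 hγ).le
  nlinarith [sq_nonneg (‖w.1.2.2‖ - ‖w.1.1‖), sq_nonneg (‖w.1.2.1‖ + 5 * γ * ‖w.1.1‖)]

/-! ### Comparison of the fiber forms -/

/-- For n² ≥ 4 the difference of the two sides is bounded below by n² times the quadratic form 2x² -
6xy + 6y², which has negative discriminant. For n² = 1 the last coefficient is 3 and the form is
indefinite, hence the exclusion of n = ±1. -/
theorem norm_fiberGrad_lt (hR : 0 < R) {τ : ℝ} (hτ : 0 ≤ τ) {n : ℤ} (hn : n ∉ ({-1, 0, 1} : Set ℤ))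
    {p : L2Rad R × L2Rad R × L2Rad R} (hp : p.1 ≠ 0) :
    ‖fiberGrad hR τ 0 p‖ ^ 2 < ‖fiberGrad hR τ n p‖ ^ 2 := by
  have hn4 : (4 : ℝ) ≤ (n : ℝ) ^ 2 := by
    simp only [mem_insert_iff, mem_singleton_iff, not_or] at hn
    have : 4 ≤ n ^ 2 := by
      rcases lt_or_gt_of_ne hn.2.1 with h | h
      · have : n ≤ -2 := by omega
        nlinarith
      · have : 2 ≤ n := by omega
        nlinarith
    exact_mod_cast this
  rw [norm_fiberGrad_sq hR hτ, norm_fiberGrad_sq hR hτ]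
  have hy : 0 < ‖invR hR (invR hR p.1)‖ := norm_pos_iff.2 (invR_ne_zero hR (invR_ne_zero hR hp))
  have hCS := (Complex.re_le_norm _).trans
    (norm_inner_le_norm (𝕜 := ℂ) (invR hR p.2.1) (invR hR (invR hR p.1)))
  have h3 : 0 ≤ τ * (n ^ 2 * ‖invR hR p.1‖ ^ 2) := by positivity
  set x := ‖invR hR p.2.1‖
  set y := ‖invR hR (invR hR p.1)‖
  set m : ℝ := (n : ℝ) ^ 2 with hm
  have h4 : 0 < m * (2 * x ^ 2 - 6 * (x * y) + (m + 2) * y ^ 2) := by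
    refine mul_pos (by linarith) ?_
    nlinarith [sq_nonneg (2 * x - 3 * y), mul_pos hy hy, mul_nonneg (sub_nonneg.2 hn4) (sq_nonneg y)]
  have h5 : (n : ℝ) ^ 4 = m ^ 2 := by rw [hm]; ring
  have h6 := mul_le_mul_of_nonneg_left hCS (by linarith : 0 ≤ m)
  rw [h5]
  push_cast
  nlinarith

theorem norm_fiberGrad_neg_one (hR : 0 < R) {τ : ℝ} (hτ : 0 ≤ τ) (p : L2Rad R × L2Rad R × L2Rad R) :
    ‖fiberGrad hR τ (-1) p‖ ^ 2 = ‖fiberGrad hR τ 1 p‖ ^ 2 := by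
  rw [norm_fiberGrad_sq hR hτ, norm_fiberGrad_sq hR hτ]
  push_cast
  ring

/-- Integration by parts of f against f/r³. The mixed term is thereby expressed through ‖f/r²‖² and
the boundary value, the latter with a sign that helps in `norm_fiberGrad_one_lt`. -/
theorem two_re_inner_invR (hR : 0 < R) {f f' : L2Rad R} {a : ℂ} (h : HasRadDeriv f f' a) :
    2 * (⟪invR hR f', invR hR (invR hR f)⟫_ℂ).re
      = 2 * ‖invR hR (invR hR f)‖ ^ 2 - ‖a‖ ^ 2 * (R ^ 2)⁻¹ := by
  have h3 := ((h.invR hR).invR hR).invR hR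
  have hI := congrArg Complex.re (h.integral_by_parts hR h3)
  set M := invR hR
  have e1 : ⟪M (M (M f)), f'⟫_ℂ = ⟪M (M f), M f'⟫_ℂ := inner_invR_left hR _ _
  have e2 : ⟪M (M (M f)), M f⟫_ℂ = ⟪M (M f), M (M f)⟫_ℂ := inner_invR_left hR _ _
  have e3 : ⟪M (M (M f')), f⟫_ℂ = ⟪M f', M (M f)⟫_ℂ := by
    rw [inner_invR_left hR, inner_invR_left hR]
  have e4 : ⟪M (M (M (M f))), f⟫_ℂ = ⟪M (M f), M (M f)⟫_ℂ := by
    rw [inner_invR_left hR, inner_invR_left hR]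
  have e5 : (⟪M (M f), M f'⟫_ℂ).re = (⟪M f', M (M f)⟫_ℂ).re := by
    rw [← inner_conj_symm, Complex.conj_re]
  have e6 : (⟪M (M f), M (M f)⟫_ℂ).re = ‖M (M f)‖ ^ 2 := by
    rw [inner_self_eq_norm_sq_to_K]; norm_cast
  simp only [map_sub, inner_sub_left, e1, e2, e3, e4, Complex.add_re, Complex.sub_re, e5, e6] at hI
  have e7 : (-((R : ℂ) * a * starRingEnd ℂ ((R : ℂ)⁻¹ * ((R : ℂ)⁻¹ * ((R : ℂ)⁻¹ * a))))).re
      = -(‖a‖ ^ 2 * (R ^ 2)⁻¹) := by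
    have hR0 : (R : ℂ) ≠ 0 := by exact_mod_cast hR.ne'
    have : -((R : ℂ) * a * starRingEnd ℂ ((R : ℂ)⁻¹ * ((R : ℂ)⁻¹ * ((R : ℂ)⁻¹ * a))))
        = ((-(‖a‖ ^ 2 * (R ^ 2)⁻¹) : ℝ) : ℂ) := by
      simp only [map_mul, map_inv₀, Complex.conj_ofReal]
      push_cast
      rw [← Complex.mul_conj']
      field_simp
    rw [this, Complex.ofReal_re]
  rw [e7] at hI
  linarith

/-- By `two_re_inner_invR` the difference of the two sides is 2‖f'/r - f/r²‖² - ‖f/r²‖² + R⁻²|f(R)|²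
+ τ‖f/r‖². The only negative term is less than R⁻²‖f/r‖², hence less than the last one. -/
theorem norm_fiberGrad_one_lt (hR : 0 < R) {τ : ℝ} (hτ : 1 / R ^ 2 ≤ τ) {w : radSpace hR}
    (hw : w.1.1 ≠ 0) : ‖fiberGrad hR τ 0 w‖ ^ 2 < ‖fiberGrad hR τ 1 w‖ ^ 2 := by
  have hτ0 : 0 ≤ τ := le_trans (by positivity) hτ
  rw [norm_fiberGrad_sq hR hτ0, norm_fiberGrad_sq hR hτ0]
  have h1 := two_re_inner_invR hR (hasRadDeriv_boundary hR w)
  have h2 := norm_invR_sq_lt hR (invR_ne_zero hR hw)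
  have h3 := norm_sub_smul_sq (invR hR w.1.2.1) (invR hR (invR hR w.1.1)) 1
  have h4 := sq_nonneg ‖invR hR w.1.2.1 - ((1 : ℝ) : ℂ) • invR hR (invR hR w.1.1)‖
  have h5 : 0 ≤ ‖boundary hR w‖ ^ 2 * (R ^ 2)⁻¹ := by positivity
  have h6 := mul_le_mul_of_nonneg_right hτ (sq_nonneg ‖invR hR w.1.1‖)
  rw [one_div] at h6
  rw [← h3] at h4
  push_cast
  nlinarith

end FiberForms


section Trial

variable {R : ℝ}

/-! ### A trial function -/

/-- Bounds for x ≤ 1 are enough: the cutoff is composed with 1 - log(r/R)/L, which does not exceed 1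
for r ≥ R. -/
theorem exists_cutoff : ∃ (φ : ℝ → ℝ) (K : ℝ), ContDiff ℝ ∞ φ ∧ 0 < K ∧ φ 1 = 1 ∧
    (∀ x < 0, φ x = 0 ∧ deriv φ x = 0 ∧ deriv (deriv φ) x = 0) ∧
    ∀ x ≤ 1, |φ x| ≤ K ∧ |deriv φ x| ≤ K ∧ |deriv (deriv φ) x| ≤ K := by
  have hφ : ContDiff ℝ ∞ Real.smoothTransition := Real.smoothTransition.contDiff
  have hφ1 : ContDiff ℝ ∞ (deriv Real.smoothTransition) :=
    (contDiff_infty_iff_deriv.1 hφ).2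
  have hφ2 : ContDiff ℝ ∞ (deriv (deriv Real.smoothTransition)) :=
    (contDiff_infty_iff_deriv.1 hφ1).2
  have hz : ∀ f : ℝ → ℝ, (∀ x < 0, f x = 0) → ∀ x < 0, deriv f x = 0 := by
    intro f hf x hx
    have : f =ᶠ[nhds x] fun _ => 0 := by
      filter_upwards [Iio_mem_nhds hx] with y hy using hf y hy
    rw [this.deriv_eq, deriv_const]
  have hz0 : ∀ x < 0, Real.smoothTransition x = 0 :=
    fun x hx => Real.smoothTransition.zero_of_nonpos hx.le
  have hz1 := hz _ hz0
  have hz2 := hz _ hz1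
  have hb : ∀ f : ℝ → ℝ, Continuous f → (∀ x < 0, f x = 0) → ∃ C, ∀ x ≤ 1, |f x| ≤ C := by
    intro f hf h0
    obtain ⟨C, hC⟩ := (isCompact_Icc (a := (0 : ℝ)) (b := 1)).exists_bound_of_continuousOn
      hf.continuousOn
    refine ⟨C, fun x hx => ?_⟩
    by_cases h : x < 0
    · rw [h0 x h, abs_zero]
      exact (norm_nonneg _).trans (hC 0 ⟨le_rfl, zero_le_one⟩)
    · exact hC x ⟨not_lt.1 h, hx⟩
  obtain ⟨C0, h0⟩ := hb _ hφ.continuous hz0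
  obtain ⟨C1, h1⟩ := hb _ hφ1.continuous hz1
  obtain ⟨C2, h2⟩ := hb _ hφ2.continuous hz2
  refine ⟨Real.smoothTransition, max 1 (max C0 (max C1 C2)), hφ, by positivity,
    Real.smoothTransition.one_of_one_le le_rfl, fun x hx => ⟨hz0 x hx, hz1 x hx, hz2 x hx⟩,
    fun x hx => ⟨(h0 x hx).trans ?_, (h1 x hx).trans ?_, (h2 x hx).trans ?_⟩⟩ <;> simp

/-- The function `1 / r` on a bounded interval. -/
def invFun (R B : ℝ) (r : ℝ) : ℂ := (Ioc R B).indicator (fun r : ℝ => (r : ℂ)⁻¹) r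

theorem memLp_invFun (hR : 0 < R) (B : ℝ) : MemLp (invFun R B) 2 (radialMeasure R) := by
  have : IsFiniteMeasure ((radialMeasure R).restrict (Ioc R B)) :=
    ⟨by
      rw [Measure.restrict_apply_univ]
      exact (measure_mono Ioc_subset_Icc_self).trans_lt (isCompact_Icc).measure_lt_top⟩
  refine (memLp_indicator_iff_restrict measurableSet_Ioc).2 ?_
  refine MemLp.of_bound (by fun_prop : Measurable fun r : ℝ => (r : ℂ)⁻¹).aestronglyMeasurable R⁻¹ ?_
  filter_upwards [ae_restrict_mem measurableSet_Ioc] with r hr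
  rw [norm_inv, Complex.norm_real, Real.norm_of_nonneg (hR.trans hr.1).le]
  exact inv_anti₀ hR hr.1.le

/-- The weight r turns r⁻² into 1/r, whose integral over (R, Re^L) is L. A function bounded by
(K/L)/r on this interval and zero beyond it therefore has squared norm at most K²/L. -/
theorem norm_invFun_sq (hR : 0 < R) {L : ℝ} (hL : 0 < L) :
    ‖(memLp_invFun hR (R * Real.exp L)).toLp _‖ ^ 2 = L := by
  have hRB : R ≤ R * Real.exp L := le_mul_of_one_le_right hR.le (Real.one_le_exp hL.le)
  have h0 : ((‖(memLp_invFun hR (R * Real.exp L)).toLp _‖ ^ 2 : ℝ) : ℂ) = (L : ℂ) := by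
    have h1 := inner_self_eq_norm_sq_to_K (𝕜 := ℂ) ((memLp_invFun hR (R * Real.exp L)).toLp _)
    rw [L2.inner_def, integral_radialMeasure hR] at h1
    push_cast
    refine h1.symm.trans ?_
    have h2 : ∫ r in Ioi R, (r : ℂ) * ⟪(memLp_invFun hR (R * Real.exp L)).toLp _ r,
        (memLp_invFun hR (R * Real.exp L)).toLp _ r⟫_ℂ
        = ∫ r in Ioi R, (Ioc R (R * Real.exp L)).indicator (fun r : ℝ => ((r⁻¹ : ℝ) : ℂ)) r := by
      apply integral_congr_ae
      filter_upwards [(ae_radialMeasure_iff hR).1 (memLp_invFun hR (R * Real.exp L)).coeFn_toLp,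
        ae_restrict_mem measurableSet_Ioi] with r h3 h4
      have hr0 : (r : ℂ) ≠ 0 := by exact_mod_cast (hR.trans h4).ne'
      rw [h3, RCLike.inner_apply]
      unfold invFun
      by_cases h : r ∈ Ioc R (R * Real.exp L)
      · rw [indicator_of_mem h, indicator_of_mem h, map_inv₀, Complex.conj_ofReal]
        push_cast
        field_simp
      · rw [indicator_of_notMem h, indicator_of_notMem h, zero_mul, mul_zero]
    rw [h2, setIntegral_indicator measurableSet_Ioc, inter_eq_right.2 Ioc_subset_Ioi_self,
      integral_complex_ofReal, ← intervalIntegral.integral_of_le hRB,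
      integral_inv_of_pos hR (by positivity), mul_div_cancel_left₀ _ hR.ne', Real.log_exp]
  exact_mod_cast h0

theorem norm_sq_le_of_le_invFun (hR : 0 < R) {L : ℝ} (hL : 0 < L) {G : ℝ → ℂ}
    (hG : MemLp G 2 (radialMeasure R)) {K : ℝ}
    (hle : ∀ r, R < r → ‖G r‖ ≤ K * ‖invFun R (R * Real.exp L) r‖) :
    ‖hG.toLp G‖ ^ 2 ≤ K ^ 2 * L := by
  rw [← norm_invFun_sq hR hL, ← mul_pow]
  refine pow_le_pow_left₀ (norm_nonneg _) (Lp.norm_le_mul_norm_of_ae_le_mul ?_) 2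
  filter_upwards [hG.coeFn_toLp, (memLp_invFun hR (R * Real.exp L)).coeFn_toLp,
    ae_radialMeasure_gt R] with r h1 h2 h3
  rw [h1, h2]
  exact hle r h3

theorem continuousOn_memLp_of_le_invFun (hR : 0 < R) {B : ℝ} {G : ℝ → ℂ}
    (hG : ContinuousOn G (Ici R)) {K : ℝ}
    (hle : ∀ r, R < r → ‖G r‖ ≤ K * ‖invFun R B r‖) : MemLp G 2 (radialMeasure R) := by
  refine (memLp_invFun hR B).of_le_mul ?_ (c := K) ?_
  · have h1 : AEStronglyMeasurable G (volume.restrict (Ioi R)) :=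
      (hG.mono Ioi_subset_Ici_self).aestronglyMeasurable measurableSet_Ioi
    exact h1.mono_ac (withDensity_absolutelyContinuous _ _)
  · filter_upwards [ae_radialMeasure_gt R] with r hr using hle r hr

/-- The trial function is φ(1 - log(r/R)/L), with boundary value 1. Its derivatives are O(1/(Lr)),
so its energy is O(1/L) and falls below -γR for large L, however small |γ| is. -/
theorem exists_fiberGrad_lt_boundary (hR : 0 < R) {τ γ : ℝ} (hτ : 0 ≤ τ) (hγ : γ < 0) :
    ∃ w : radSpace hR, ‖fiberGrad hR τ 0 w‖ ^ 2 < -γ * R * ‖boundary hR w‖ ^ 2 := by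
  obtain ⟨φ, K, hφ, hK, hφ1, hφ0, hφb⟩ := exists_cutoff
  -- The energy is at most Q/L; the three summands bound the contributions of f'', f'/r and f'.
  set Q : ℝ := (4 * (R ^ 2)⁻¹ + (R ^ 2)⁻¹ + τ) * K ^ 2 with hQ
  have hQ0 : 0 ≤ Q := by positivity
  have hγR : 0 < -γ * R := mul_pos (neg_pos.2 hγ) hR
  -- The condition L ≥ 1 allows L⁻² to be replaced by L⁻¹ in the bound for the second derivative.
  obtain ⟨L, hL1, hLQ⟩ : ∃ L : ℝ, 1 ≤ L ∧ Q < -γ * R * L := by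
    refine ⟨Q / (-γ * R) + 1, by linarith [div_nonneg hQ0 hγR.le], ?_⟩
    rw [mul_add, mul_div_cancel₀ _ hγR.ne']
    linarith
  have hL : 0 < L := one_pos.trans_le hL1
  set B := R * Real.exp L with hB
  set x : ℝ → ℝ := fun r => 1 - Real.log (r / R) / L with hx
  have hxR : x R = 1 := by simp [hx, hR.ne']
  have hxle : ∀ r, R < r → x r ≤ 1 := by
    intro r hr
    have : 0 ≤ Real.log (r / R) / L :=
      div_nonneg (Real.log_nonneg ((one_le_div hR).2 hr.le)) hL.le
    simp only [hx]; linarith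
  have hxneg : ∀ r, R < r → r ∉ Ioc R B → x r < 0 := by
    intro r hr hrB
    have h1 : B < r := by
      by_contra h
      exact hrB ⟨hr, not_lt.1 h⟩
    have h2 : L < Real.log (r / R) := by
      rw [Real.lt_log_iff_exp_lt (div_pos (hR.trans hr) hR), lt_div_iff₀ hR, mul_comm]
      exact h1
    have h3 : 1 < Real.log (r / R) / L := (one_lt_div hL).2 h2
    simp only [hx]; linarith
  have hxd : ∀ r, R ≤ r → HasDerivAt x (-(r⁻¹ / L)) r := by
    intro r hr
    have hr0 : r ≠ 0 := (hR.trans_le hr).ne'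
    have h1 := ((hasDerivAt_id r).div_const R).log (div_ne_zero hr0 hR.ne')
    have h2 := (h1.div_const L).const_sub 1
    refine h2.congr_deriv ?_
    simp only [id]
    field_simp
  have hx_c : ContinuousOn x (Ici R) := fun r hr => (hxd r hr).continuousAt.continuousWithinAt
  have hd0 : Differentiable ℝ φ := hφ.differentiable (by simp)
  have hφ' : ContDiff ℝ ∞ (deriv φ) := (contDiff_infty_iff_deriv.1 hφ).2
  have hd1 : Differentiable ℝ (deriv φ) := hφ'.differentiable (by simp)
  have hφ'' : ContDiff ℝ ∞ (deriv (deriv φ)) := (contDiff_infty_iff_deriv.1 hφ').2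
  set F0 : ℝ → ℝ := fun r => φ (x r) with hF0
  set F1 : ℝ → ℝ := fun r => deriv φ (x r) * -(r⁻¹ / L) with hF1
  set F2 : ℝ → ℝ := fun r => deriv (deriv φ) (x r) * (r⁻¹ / L) ^ 2 + deriv φ (x r) * (r⁻¹ ^ 2 / L)
    with hF2
  have hD0 : ∀ r, R ≤ r → HasDerivAt F0 (F1 r) r := fun r hr =>
    (hd0 (x r)).hasDerivAt.comp r (hxd r hr)
  have hD1 : ∀ r, R ≤ r → HasDerivAt F1 (F2 r) r := by
    intro r hr
    have hr0 : r ≠ 0 := (hR.trans_le hr).ne'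
    have h1 : HasDerivAt (fun r => deriv φ (x r)) (deriv (deriv φ) (x r) * -(r⁻¹ / L)) r :=
      (hd1 (x r)).hasDerivAt.comp r (hxd r hr)
    have h2 := h1.mul (((hasDerivAt_inv hr0).div_const L).neg)
    refine h2.congr_deriv ?_
    simp only [hF2, Pi.neg_apply]
    field_simp
  have hinv : ContinuousOn (fun r : ℝ => r⁻¹) (Ici R) :=
    continuousOn_inv₀.mono fun r hr => (hR.trans_le hr).ne'
  have hC0 : ContinuousOn F0 (Ici R) := fun r hr => (hD0 r hr).continuousAt.continuousWithinAt
  have hC1 : ContinuousOn F1 (Ici R) := fun r hr => (hD1 r hr).continuousAt.continuousWithinAt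
  have hC2 : ContinuousOn F2 (Ici R) :=
    ((hφ''.continuous.comp_continuousOn hx_c).mul ((hinv.div_const L).pow 2)).add
      ((hφ'.continuous.comp_continuousOn hx_c).mul ((hinv.pow 2).div_const L))
  have hnorm : ∀ r ∈ Ioc R B, ‖invFun R B r‖ = r⁻¹ := by
    intro r hr
    unfold invFun
    rw [indicator_of_mem hr, norm_inv, Complex.norm_real, Real.norm_of_nonneg (hR.trans hr.1).le]
  -- The norm of the trial function does not enter the energy, so this crude constant serves only to
  -- show membership in L².
  have hb0 : ∀ r, R < r → ‖(F0 r : ℂ)‖ ≤ (K * B) * ‖invFun R B r‖ := by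
    intro r hr
    rw [Complex.norm_real, Real.norm_eq_abs]
    by_cases h : r ∈ Ioc R B
    · rw [hnorm r h, mul_assoc]
      refine ((hφb _ (hxle r hr)).1).trans (le_mul_of_one_le_right hK.le ?_)
      rw [← div_eq_mul_inv]
      exact (one_le_div (hR.trans hr)).2 h.2
    · simp only [hF0]
      rw [(hφ0 _ (hxneg r hr h)).1, abs_zero]
      positivity
  have hb1 : ∀ r, R < r → ‖(F1 r : ℂ)‖ ≤ (K / L) * ‖invFun R B r‖ := by
    intro r hr
    have hr0 := hR.trans hr
    rw [Complex.norm_real, Real.norm_eq_abs]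
    by_cases h : r ∈ Ioc R B
    · simp only [hF1]
      rw [hnorm r h, abs_mul, abs_neg, abs_of_pos (by positivity : 0 < r⁻¹ / L)]
      refine (mul_le_mul_of_nonneg_right (hφb _ (hxle r hr)).2.1 (by positivity)).trans (le_of_eq ?_)
      ring
    · simp only [hF1]
      rw [(hφ0 _ (hxneg r hr h)).2.1, zero_mul, abs_zero]
      positivity
  have hb2 : ∀ r, R < r → ‖(F2 r : ℂ)‖ ≤ (2 * K / (L * R)) * ‖invFun R B r‖ := by
    intro r hr
    have hr0 := hR.trans hr
    rw [Complex.norm_real, Real.norm_eq_abs]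
    by_cases h : r ∈ Ioc R B
    · simp only [hF2]
      have hrR : r⁻¹ ≤ R⁻¹ := inv_anti₀ hR hr.le
      have hr1 : 0 < r⁻¹ := inv_pos.2 hr0
      have hL2 : L⁻¹ ≤ 1 := inv_le_one_of_one_le₀ hL1
      have hL3 : 0 < L⁻¹ := inv_pos.2 hL
      have hs : (r⁻¹ / L) ^ 2 ≤ L⁻¹ * R⁻¹ * r⁻¹ := by
        rw [div_eq_mul_inv, mul_pow]
        have h1 : r⁻¹ ^ 2 ≤ R⁻¹ * r⁻¹ := by rw [sq]; exact mul_le_mul_of_nonneg_right hrR hr1.le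
        have h2 : L⁻¹ ^ 2 ≤ L⁻¹ := by rw [sq]; exact mul_le_of_le_one_left hL3.le hL2
        calc r⁻¹ ^ 2 * L⁻¹ ^ 2 ≤ (R⁻¹ * r⁻¹) * L⁻¹ := mul_le_mul h1 h2 (by positivity) (by positivity)
          _ = _ := by ring
      have ht : r⁻¹ ^ 2 / L ≤ L⁻¹ * R⁻¹ * r⁻¹ := by
        have h1 : r⁻¹ ^ 2 ≤ R⁻¹ * r⁻¹ := by rw [sq]; exact mul_le_mul_of_nonneg_right hrR hr1.le
        calc r⁻¹ ^ 2 / L ≤ (R⁻¹ * r⁻¹) / L := div_le_div_of_nonneg_right h1 hL.le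
          _ = _ := by ring
      rw [hnorm r h]
      refine (abs_add_le _ _).trans ?_
      rw [abs_mul, abs_mul, abs_of_pos (by positivity : 0 < (r⁻¹ / L) ^ 2),
        abs_of_pos (by positivity : 0 < r⁻¹ ^ 2 / L)]
      have h5 := mul_le_mul (hφb _ (hxle r hr)).2.2 hs (by positivity) hK.le
      have h6 := mul_le_mul (hφb _ (hxle r hr)).2.1 ht (by positivity) hK.le
      refine (add_le_add h5 h6).trans (le_of_eq ?_)
      field_simp
      ring
    · simp only [hF2]
      rw [(hφ0 _ (hxneg r hr h)).2.1, (hφ0 _ (hxneg r hr h)).2.2, zero_mul, zero_mul, add_zero,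
        abs_zero]
      positivity
  have hof : ∀ {G : ℝ → ℝ}, ContinuousOn G (Ici R) → ContinuousOn (fun r => (G r : ℂ)) (Ici R) :=
    fun h => Complex.continuous_ofReal.comp_continuousOn h
  have m0 := continuousOn_memLp_of_le_invFun hR (hof hC0) hb0
  have m1 := continuousOn_memLp_of_le_invFun hR (hof hC1) hb1
  have m2 := continuousOn_memLp_of_le_invFun hR (hof hC2) hb2
  have P0 : IsPrim R (fun r => (F0 r : ℂ)) (fun r => (F1 r : ℂ)) :=
    IsPrim.of_hasDerivAt (fun r hr => (hD0 r hr).ofReal_comp) (hof hC1)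
  have P1 : IsPrim R (fun r => (F1 r : ℂ)) (fun r => (F2 r : ℂ)) :=
    IsPrim.of_hasDerivAt (fun r hr => (hD1 r hr).ofReal_comp) (hof hC2)
  have r0 := HasRadDeriv.of_isPrim hR P0 m0.coeFn_toLp m1.coeFn_toLp
  have r1 := HasRadDeriv.of_isPrim hR P1 m1.coeFn_toLp m2.coeFn_toLp
  let w : radSpace hR := ⟨(m0.toLp _, m1.toLp _, m2.toLp _), r0.weak hR, r1.weak hR⟩
  have hbd : boundary hR w = 1 := by
    have := (hasRadDeriv_boundary hR w).boundary_unique hR r0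
    rw [this]
    simp only [hF0, hxR, hφ1, Complex.ofReal_one]
  refine ⟨w, ?_⟩
  have n1 : ‖m1.toLp _‖ ^ 2 ≤ (K / L) ^ 2 * L :=
    norm_sq_le_of_le_invFun hR hL m1 hb1
  have n2 : ‖m2.toLp _‖ ^ 2 ≤ (2 * K / (L * R)) ^ 2 * L :=
    norm_sq_le_of_le_invFun hR hL m2 hb2
  have n3 : ‖invR hR (m1.toLp _)‖ ^ 2 ≤ (R ^ 2)⁻¹ * ‖m1.toLp _‖ ^ 2 := by
    have := pow_le_pow_left₀ (norm_nonneg _) (norm_invR_le hR (m1.toLp _)) 2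
    rwa [mul_pow, inv_pow] at this
  rw [hbd, norm_one, norm_fiberGrad_sq hR hτ]
  change ‖m2.toLp _‖ ^ 2 + (2 * ((0 : ℤ) : ℝ) ^ 2 + 1) * ‖invR hR (m1.toLp _)‖ ^ 2
    - 6 * ((0 : ℤ) : ℝ) ^ 2 * _ + (((0 : ℤ) : ℝ) ^ 4 + 2 * ((0 : ℤ) : ℝ) ^ 2) * _
    + τ * (‖m1.toLp _‖ ^ 2 + ((0 : ℤ) : ℝ) ^ 2 * _) < _
  have e1 : (K / L) ^ 2 * L = K ^ 2 / L := by field_simp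
  have e2 : (2 * K / (L * R)) ^ 2 * L = 4 * (R ^ 2)⁻¹ * (K ^ 2 / L) := by field_simp; ring
  rw [e1] at n1
  rw [e2] at n2
  have n4 := mul_le_mul_of_nonneg_left n1 hτ
  have n5 := mul_le_mul_of_nonneg_left n1 (by positivity : 0 ≤ (R ^ 2)⁻¹)
  have hfin : Q / L < -γ * R := (div_lt_iff₀ hL).2 hLQ
  have e3 : Q / L = 4 * (R ^ 2)⁻¹ * (K ^ 2 / L) + (R ^ 2)⁻¹ * (K ^ 2 / L) + τ * (K ^ 2 / L) := by
    rw [hQ]; ring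
  simp only [Int.cast_zero, ne_eq, OfNat.ofNat_ne_zero, not_false_eq_true, zero_pow, mul_zero,
    zero_mul, add_zero, zero_add, one_mul, sub_zero, one_pow, mul_one]
  linarith

end Trial


section Main

variable {R : ℝ}

/-! ### The lowest eigenvalue -/

theorem fiberForm_self (hR : 0 < R) {τ γ : ℝ} (hτ : 0 ≤ τ) (n : ℤ) (w : radSpace hR) :
    fiberForm τ γ n w.1.1 w.1.1
      = ((‖fiberGrad hR τ n w‖ ^ 2 - -γ * R * ‖boundary hR w‖ ^ 2 : ℝ) : ℂ) := by
  have h : ⟪fiberGrad hR τ n w, fiberGrad hR τ n w⟫_ℂ = ((‖fiberGrad hR τ n w‖ ^ 2 : ℝ) : ℂ) := by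
    rw [inner_self_eq_norm_sq_to_K]; norm_cast
  rw [fiberForm_eq hR hτ, mul_comm (starRingEnd ℂ _), Complex.mul_conj', h]
  push_cast
  ring

/-- The embedding of the form domain of the fiber forms into `L²((R, ∞); r dr)`. -/
def radEmb (hR : 0 < R) : radSpace hR →L[ℂ] L2Rad R :=
  ContinuousLinearMap.fst ℂ _ _ ∘L (radSpace hR).subtypeL

theorem exists_fiber_ground_state (hR : 0 < R) {τ γ : ℝ} (hτ : 0 ≤ τ) (hγ : γ < 0) (n : ℤ)
    (hneg : ∃ w : radSpace hR, ‖fiberGrad hR τ n w‖ ^ 2 < -γ * R * ‖boundary hR w‖ ^ 2) :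
    ∃ μ : ℝ, 0 < μ ∧
      (∀ w : radSpace hR, -γ * R * ‖boundary hR w‖ ^ 2
        ≤ ‖fiberGrad hR τ n w‖ ^ 2 + μ * ‖w.1.1‖ ^ 2) ∧
      ∃ g ∈ fiberDom R n, g ≠ 0 ∧
        ∀ f ∈ fiberDom R n, fiberForm τ γ n g f = ((-μ : ℝ) : ℂ) * ⟪f, g⟫_ℂ := by
  obtain ⟨μ, h0, h1, g, hg0, hg⟩ := exists_ground_state (radEmb hR)
    (fiberGrad hR τ n ∘L (radSpace hR).subtypeL) (boundary hR) (mul_pos (neg_pos.2 hγ) hR)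
    (by positivity) (fiberGrad_coercive hR hτ n) (boundary_sq_le hR hτ hγ n) hneg
  refine ⟨μ, h0, h1, g.1.1, (mem_fiberDom_iff_radSpace hR).2 ⟨g, rfl⟩,
    fun h => hg0 (radSpace_eq_zero hR h), fun f hf => ?_⟩
  obtain ⟨v, rfl⟩ := (mem_fiberDom_iff_radSpace hR).1 hf
  rw [fiberForm_eq hR hτ]
  have h2 : ⟪fiberGrad hR τ n v, fiberGrad hR τ n g⟫_ℂ
      - ((-γ * R : ℝ) : ℂ) * (starRingEnd ℂ (boundary hR v) * boundary hR g)
      = -μ * ⟪v.1.1, g.1.1⟫_ℂ := hg v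
  push_cast at h2 ⊢
  linear_combination h2

/-- The common lower bound of the fiber forms is attained in one of the modes `0` and `1`. -/
theorem exists_lowest (hR : 0 < R) {τ γ : ℝ} (hτ : 0 ≤ τ) (hγ : γ < 0) :
    ∃ μ : ℝ, 0 < μ ∧
      (∀ n ∈ ({-1, 0, 1} : Set ℤ), ∀ w : radSpace hR, -γ * R * ‖boundary hR w‖ ^ 2
        ≤ ‖fiberGrad hR τ n w‖ ^ 2 + μ * ‖w.1.1‖ ^ 2) ∧
      ∃ n ∈ ({-1, 0, 1} : Set ℤ), ∃ g ∈ fiberDom R n, g ≠ 0 ∧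
        ∀ f ∈ fiberDom R n, fiberForm τ γ n g f = ((-μ : ℝ) : ℂ) * ⟪f, g⟫_ℂ := by
  have hall : ∀ μ : ℝ,
      (∀ w : radSpace hR, -γ * R * ‖boundary hR w‖ ^ 2
        ≤ ‖fiberGrad hR τ 0 w‖ ^ 2 + μ * ‖w.1.1‖ ^ 2) →
      (∀ w : radSpace hR, -γ * R * ‖boundary hR w‖ ^ 2
        ≤ ‖fiberGrad hR τ 1 w‖ ^ 2 + μ * ‖w.1.1‖ ^ 2) →
      ∀ n ∈ ({-1, 0, 1} : Set ℤ), ∀ w : radSpace hR, -γ * R * ‖boundary hR w‖ ^ 2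
        ≤ ‖fiberGrad hR τ n w‖ ^ 2 + μ * ‖w.1.1‖ ^ 2 := by
    rintro μ h0 h1 n (rfl | rfl | rfl) w
    · rw [norm_fiberGrad_neg_one hR hτ]; exact h1 w
    · exact h0 w
    · exact h1 w
  obtain ⟨μ, hμ, hle, g, hg⟩ :=
    exists_fiber_ground_state hR hτ hγ 0 (exists_fiberGrad_lt_boundary hR hτ hγ)
  -- Either the shift of mode 0 is admissible for mode 1 as well, or mode 1 lies lower. In the
  -- second case mode 1 also has a negative direction, because μ > 0, and its own ground state is
  -- the lowest one. Mode -1 has the same form as mode 1.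
  by_cases h : ∀ w : radSpace hR, -γ * R * ‖boundary hR w‖ ^ 2
      ≤ ‖fiberGrad hR τ 1 w‖ ^ 2 + μ * ‖w.1.1‖ ^ 2
  · exact ⟨μ, hμ, hall μ hle h, 0, by simp, g, hg⟩
  · push Not at h
    obtain ⟨w, hw⟩ := h
    obtain ⟨μ', hμ', hle', g', hg'⟩ := exists_fiber_ground_state hR hτ hγ 1
      ⟨w, lt_of_le_of_lt (le_add_of_nonneg_right (by positivity)) hw⟩
    have hlt : μ < μ' := by
      by_contra hc
      have := mul_le_mul_of_nonneg_right (not_lt.1 hc) (sq_nonneg ‖w.1.1‖)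
      linarith [hle' w]
    refine ⟨μ', hμ', hall μ' (fun v => (hle v).trans ?_) hle', 1, by simp, g', hg'⟩
    have := mul_le_mul_of_nonneg_right hlt.le (sq_nonneg ‖v.1.1‖)
    linarith

/-- The boundary term is the same in all modes, so a strict comparison of the positive parts with
mode 0 carries over to the full forms. -/
theorem lt_fiberForm (hR : 0 < R) {τ γ μ : ℝ} (hτ : 0 ≤ τ)
    (h0 : ∀ w : radSpace hR, -γ * R * ‖boundary hR w‖ ^ 2
        ≤ ‖fiberGrad hR τ 0 w‖ ^ 2 + μ * ‖w.1.1‖ ^ 2) {n : ℤ}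
    (hn : n ∉ ({-1, 0, 1} : Set ℤ) ∨ 1 / R ^ 2 ≤ τ ∧ n ≠ 0)
    {f : L2Rad R} (hf : f ∈ fiberDom R n) (hf0 : f ≠ 0) :
    -μ * ‖f‖ ^ 2 < (fiberForm τ γ n f f).re := by
  obtain ⟨w, rfl⟩ := (mem_fiberDom_iff_radSpace hR).1 hf
  rw [fiberForm_self hR hτ, Complex.ofReal_re]
  have key : ‖fiberGrad hR τ 0 w‖ ^ 2 < ‖fiberGrad hR τ n w‖ ^ 2 := by
    by_cases h : n ∈ ({-1, 0, 1} : Set ℤ)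
    · obtain ⟨h1, h2⟩ := hn.resolve_left (not_not.2 h)
      rcases h with rfl | rfl | rfl
      · rw [norm_fiberGrad_neg_one hR hτ]; exact norm_fiberGrad_one_lt hR h1 hf0
      · exact absurd rfl h2
      · exact norm_fiberGrad_one_lt hR h1 hf0
    · exact norm_fiberGrad_lt hR hτ h hf0
  linarith [h0 w]

theorem le_fiberForm (hR : 0 < R) {τ γ μ : ℝ} (hτ : 0 ≤ τ)
    (hle : ∀ n ∈ ({-1, 0, 1} : Set ℤ), ∀ w : radSpace hR, -γ * R * ‖boundary hR w‖ ^ 2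
        ≤ ‖fiberGrad hR τ n w‖ ^ 2 + μ * ‖w.1.1‖ ^ 2) {n : ℤ}
    {f : L2Rad R} (hf : f ∈ fiberDom R n) (hf0 : f ≠ 0) :
    -μ * ‖f‖ ^ 2 ≤ (fiberForm τ γ n f f).re := by
  by_cases h : n ∈ ({-1, 0, 1} : Set ℤ)
  · obtain ⟨w, rfl⟩ := (mem_fiberDom_iff_radSpace hR).1 hf
    rw [fiberForm_self hR hτ, Complex.ofReal_re]
    linarith [hle n h w]
  · exact (lt_fiberForm hR hτ (hle 0 (by simp)) (Or.inl h) hf hf0).le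

theorem re_mul_inner_self {E : Type*} [NormedAddCommGroup E] [InnerProductSpace ℂ E] (ν : ℝ)
    (f : E) : ((ν : ℂ) * ⟪f, f⟫_ℂ).re = ν * ‖f‖ ^ 2 := by
  rw [Complex.re_ofReal_mul]
  congr 1
  exact inner_self_eq_norm_sq (𝕜 := ℂ) f

/-- The eigenvalue equation is tested with the n-th mode of u itself. -/
theorem fiberForm_coef_of_isEigenvector (hR : 0 < R) {τ γ ν : ℝ} {u : L2Ext R}
    (hu : IsEigenvector (robinOp R τ γ) (ν : ℂ) u) (n : ℤ) :
    coef hR n u ∈ fiberDom R n ∧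
      (fiberForm τ γ n (coef hR n u) (coef hR n u)).re = ν * ‖coef hR n u‖ ^ 2 := by
  obtain ⟨-, hu2, he⟩ := hu.form_eq
  have hc := coef_mem_fiberDom hR hu2 n
  refine ⟨hc, ?_⟩
  rw [← form_mode_right hR hc hu2, he _ hc, ← inner_coef_right hR, re_mul_inner_self]

theorem not_isEigenvalue_fiberOp {τ γ μ : ℝ} {n : ℤ}
    (h : ∀ f ∈ fiberDom R n, f ≠ 0 → -μ * ‖f‖ ^ 2 < (fiberForm τ γ n f f).re) :
    ¬ IsEigenvalue (fiberOp R τ γ n) ((-μ : ℝ) : ℂ) := by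
  rintro ⟨f, hf⟩
  obtain ⟨h0, h1, h2⟩ := hf.form_eq
  have := h f h1 h0
  rw [h2 f h1, re_mul_inner_self] at this
  exact lt_irrefl _ this

/-- A mode sees only the n-th coefficient of the second argument, both in the form and in the inner
product, so a fiber eigenfunction lifts to one of the full operator. -/
theorem isEigenvector_robinOp_mode (hR : 0 < R) {τ γ : ℝ} {n : ℤ} {μ : ℂ} {g : L2Rad R}
    (hg : g ∈ fiberDom R n) (hg0 : g ≠ 0)
    (he : ∀ f ∈ fiberDom R n, fiberForm τ γ n g f = μ * ⟪f, g⟫_ℂ) :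
    IsEigenvector (robinOp R τ γ) μ (mode n g) := by
  refine isEigenvector_robinOp hR (fun h => hg0 ?_) hg fun v hv => ?_
  · have h1 := coef_mode hR n n g
    rwa [h, map_zero, if_pos rfl, eq_comm] at h1
  · rw [form_mode_left hR hg hv, he _ (coef_mem_fiberDom hR hv n), inner_coef_left]

end Main

end RobinBilaplacian

end

/-! ### Proof of the theorem from the fiber comparison and the ground state -/

open RobinBilaplacian in
theorem theorem3p3 (R τ γ : ℝ) (hR : 0 < R) (hτ : 0 ≤ τ) (hγ : γ < 0) :
    ∃ lam : ℝ, lam < 0 ∧ IsLeast {μ : ℝ | IsEigenvalue (robinOp R τ γ) (μ : ℂ)} lam ∧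
      -- (i)
      ((∀ n : ℤ, n ∉ ({-1, 0, 1} : Set ℤ) → ¬ IsEigenvalue (fiberOp R τ γ n) (lam : ℂ)) ∧
        (∃ n ∈ ({-1, 0, 1} : Set ℤ), IsEigenvalue (fiberOp R τ γ n) (lam : ℂ)) ∧
        (∀ u : L2Ext R, IsEigenvector (robinOp R τ γ) (lam : ℂ) u →
          ∃ f g h : L2Rad R, u = mode (-1) f + mode 0 g + mode 1 h)) ∧
      -- (ii)
      (1 / R ^ 2 ≤ τ →
        (∀ n : ℤ, IsEigenvalue (fiberOp R τ γ n) (lam : ℂ) ↔ n = 0) ∧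
        (∀ u : L2Ext R, IsEigenvector (robinOp R τ γ) (lam : ℂ) u →
          ∃ f : L2Rad R, u = mode 0 f)) := by
  obtain ⟨μ, hμ, hle, k, hk, g, hg, hg0, hge⟩ := exists_lowest hR hτ hγ
  have hle0 := hle 0 (by simp)
  have hnot : ∀ n : ℤ, (n ∉ ({-1, 0, 1} : Set ℤ) ∨ 1 / R ^ 2 ≤ τ ∧ n ≠ 0) →
      ¬ IsEigenvalue (fiberOp R τ γ n) ((-μ : ℝ) : ℂ) := fun n hn =>
    not_isEigenvalue_fiberOp fun f hf hf0 => lt_fiberForm hR hτ hle0 hn hf hf0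
  have hcoef : ∀ u : L2Ext R, IsEigenvector (robinOp R τ γ) ((-μ : ℝ) : ℂ) u →
      ∀ n : ℤ, (n ∉ ({-1, 0, 1} : Set ℤ) ∨ 1 / R ^ 2 ≤ τ ∧ n ≠ 0) → coef hR n u = 0 := by
    intro u hu n hn
    by_contra h0
    obtain ⟨h1, h2⟩ := fiberForm_coef_of_isEigenvector hR hu n
    have := lt_fiberForm hR hτ hle0 hn h1 h0
    rw [h2] at this
    exact lt_irrefl _ this
  have hfib : IsEigenvalue (fiberOp R τ γ k) ((-μ : ℝ) : ℂ) :=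
    ⟨g, isEigenvector_fiberOp hR hg0 hg hge⟩
  refine ⟨-μ, neg_lt_zero.2 hμ, ⟨⟨_, isEigenvector_robinOp_mode hR hg hg0 hge⟩, ?_⟩,
    ⟨fun n hn => hnot n (Or.inl hn), ⟨k, hk, hfib⟩, fun u hu => ?_⟩,
    fun hτR => ⟨fun n => ?_, fun u hu => ?_⟩⟩
  -- An eigenfunction has some non-zero Fourier coefficient, on which the fiber form takes the value
  -- ν times the squared norm; this cannot lie below the common lower bound -μ.
  · rintro ν ⟨u, hu⟩
    have hu0 := hu.1
    have : ∃ n, coef hR n u ≠ 0 := by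
      by_contra! h
      exact hu0 (eq_zero_of_coef hR u h)
    obtain ⟨n, hn⟩ := this
    obtain ⟨h1, h2⟩ := fiberForm_coef_of_isEigenvector hR hu n
    have h3 := le_fiberForm hR hτ hle h1 hn
    rw [h2] at h3
    exact le_of_mul_le_mul_right h3 (pow_pos (norm_pos_iff.2 hn) 2)
  · refine ⟨coef hR (-1) u, coef hR 0 u, coef hR 1 u, ?_⟩
    rw [← sub_eq_zero]
    refine eq_zero_of_coef hR _ fun n => ?_
    rw [map_sub, map_add, map_add, coef_mode, coef_mode, coef_mode]
    by_cases h : n ∈ ({-1, 0, 1} : Set ℤ)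
    · rcases h with rfl | rfl | rfl <;> simp
    · have h' := h
      simp only [mem_insert_iff, mem_singleton_iff, not_or] at h'
      rw [hcoef u hu n (Or.inl h), if_neg h'.1, if_neg h'.2.1, if_neg h'.2.2]
      simp
  · constructor
    · intro h
      by_contra hn
      exact hnot n (Or.inr ⟨hτR, hn⟩) h
    · rintro rfl
      -- The lowest eigenvalue is attained in some mode k, and all non-zero modes are excluded when
      -- τ ≥ 1/R².
      have : k = 0 := by
        by_contra hn
        exact hnot k (Or.inr ⟨hτR, hn⟩) hfib
      rwa [this] at hfib
  · refine ⟨coef hR 0 u, ?_⟩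
    rw [← sub_eq_zero]
    refine eq_zero_of_coef hR _ fun n => ?_
    rw [map_sub, coef_mode]
    by_cases h : n = 0
    · subst h; simp
    · rw [hcoef u hu n (Or.inr ⟨hτR, h⟩), if_neg h, sub_zero]
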